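/- Let $4\le n\le 7$, $m>0$, $R_0=(m/2)^{1/(n-2)}$, and let $M^n=\{x\in\mathbb R^n: |x|\ge R_0\}$ carry the Riemannian Schwarzschild metric $g_{Sch}=\bigl(1+\tfrac{m}{2|x|^{n-2}}\bigr)^{\frac{4}{n-2}}\delta$, where $\delta$ is the Euclidean metric. Let $\Gamma\subset\mathbb S^{n-1}$ be a nonempty closed (compact, without boundary) embedded orientable minimal hypersurface of the unit sphere, and let $\Sigma_\Gamma=\{\lambda y: y\in\Gamma,\ \lambda>0,\ |\lambda y|\ge R_0\}$ be the truncated cone over $\Gamma$, with $g_{Sch}$-unit normal $\xi$. For $R>R_0$ put $\Sigma_\Gamma(R)=\Sigma_\Gamma\cap\{|x|\le R\}$, and for smooth $u:\Sigma_\Gamma(R)\to\mathbb R$ vanishing on $\{|x|=R\}$ put $$Q(u,u)=-\int_{\Sigma_\Gamma(R)}u\bigl(\Delta_{\Sigma}u+(\overline{\mathrm{Ric}}(\xi,\xi)+|A_\Sigma|^2)u\bigr)\,dv+\int_{\partial\Sigma_\Gamma}u\Bigl(\frac{\partial u}{\partial\nu}-A_{\partial M}(\xi,\xi)u\Bigr)ds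 ,$$ where $\partial\Sigma_\Gamma=\Sigma_\Gamma\cap\{|x|=R_0\}$, all geometric quantities are those of $g_{Sch}$, $\nu$ is the outward unit conormal of $\partial\Sigma_\Gamma$, and $A_{\partial M}(v,w)=-g_{Sch}(\bar\nabla_v\eta,w)$ with $\eta$ the unit normal of $\partial M$ pointing into $M$. Let $\mathrm{Ind}_F(\Sigma_\Gamma(R))$ be the maximal dimension of a linear space of smooth functions on $\Sigma_\Gamma(R)$ vanishing on $\{|x|=R\}$ on which $Q$ is negative definite, let $\mathrm{Ind}_D(\Sigma_\Gamma(R))$ be the same with functions vanishing on the whole boundary $\Sigma_\Gamma\cap\{|x|\in\{R_0,R\}\}$, and let the Morse index be $\mathrm{Ind}(\Sigma_\Gamma)=\limsup_{R\to\infty}\mathrm{Ind}_F(\Sigma_\Gamma(R))\in\{0,1,2,\dots,\infty\}$. Then: 1. $\mathrm{Ind}(\Sigma_\Gamma)<\infty$ if and only if $\Gamma$ is totally geodesic in $\mathbb S^{n-1}$. 2. $\Gamma$ is totally geodesic in $\mathbb S^{n-1}$ if and only if some rotation of $\mathbb R^n$ maps $\Sigma_\Gamma$ onto $\Sigma_0=\{x\in\mathbb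 R^n: x_n=0,\ |x|\ge R_0\}$. 3. If $\Gamma$ is totally geodesic, then $\mathrm{Ind}(\Sigma_\Gamma)=0$. 4. If $\Gamma$ is not totally geodesic, then $\mathrm{Ind}_D(\Sigma_\Gamma(R))\to\infty$ as $R\to\infty$. -/

import Mathlib

open Filter Topology MeasureTheory
open scoped ContDiff RealInnerProductSpace

noncomputable section

/-- Euclidean `n`-space; its points are also used as coordinates of tangent vectors. -/
abbrev Pt (n : ℕ) := EuclideanSpace ℝ (Fin n)

/-! ### Riemannian geometry in the global coordinates of an open subset of `ℝⁿ`

A metric is given by its matrix `G x = (g_ij(x))`. All indices are coordinate indices. -/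

/-- A Riemannian metric (or any 2-tensor) in coordinates. -/
abbrev MetricField (n : ℕ) := Pt n → Matrix (Fin n) (Fin n) ℝ

/-- Partial derivative `∂_i f (x)`. -/
def partialD {n : ℕ} (i : Fin n) (f : Pt n → ℝ) (x : Pt n) : ℝ :=
  fderiv ℝ f x (EuclideanSpace.single i 1)

/-- `g_x(v, w) = ∑ g_ij v^i w^j`. -/
def metricInner {n : ℕ} (G : MetricField n) (x v w : Pt n) : ℝ :=
  ∑ i, ∑ j, G x i j * v i * w j

/-- Christoffel symbol
`Γ^k_ij = ½ ∑_l g^{kl} (∂_i g_jl + ∂_j g_il - ∂_l g_ij)` of the Levi-Civita connection. -/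
def christoffel {n : ℕ} (G : MetricField n) (k i j : Fin n) (x : Pt n) : ℝ :=
  (1 / 2) * ∑ l, (G x)⁻¹ k l *
    (partialD i (fun y => G y j l) x + partialD j (fun y => G y i l) x
      - partialD l (fun y => G y i j) x)

/-- Ricci tensor
`R_ij = ∂_k Γ^k_ij - ∂_j Γ^k_ik + Γ^k_kl Γ^l_ij - Γ^k_jl Γ^l_ik` (sums over `k`, `l`). -/
def ricci {n : ℕ} (G : MetricField n) : MetricField n := fun x i j =>
  (∑ k, partialD k (christoffel G k i j) x) - (∑ k, partialD j (christoffel G k i k) x)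
    + (∑ k, ∑ l, christoffel G k k l x * christoffel G l i j x)
    - ∑ k, ∑ l, christoffel G k j l x * christoffel G l i k x

/-- Matrix of the covariant derivative of a vector field `X`:
`(∇X)^k_i = ∂_i X^k + ∑_j Γ^k_ij X^j`, so that `∇_v X = (∇X) v`. -/
def covDeriv {n : ℕ} (G : MetricField n) (X : Pt n → Pt n) (x : Pt n) :
    Matrix (Fin n) (Fin n) ℝ := fun k i =>
  partialD i (fun y => X y k) x + ∑ j, christoffel G k i j x * X x j

/-- Gradient `(grad u)^k = ∑_l g^{kl} ∂_l u`. -/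
def gradG {n : ℕ} (G : MetricField n) (u : Pt n → ℝ) (x : Pt n) : Pt n :=
  WithLp.toLp 2 fun k => ∑ l, (G x)⁻¹ k l * partialD l u x

/-! ### Hypersurfaces with a unit normal field

`ξ` is a smooth vector field defined near a hypersurface `S` and restricting to a `g`-unit normal
field on `S`. The following quantities, evaluated at points of `S`, depend only on `S`, on `ξ|_S`
and (for the operators) on the restriction to `S` of the function or tangential field. -/

/-- Matrix of the `g`-orthogonal projection `v ↦ v - g(ξ, v) ξ` onto the tangent space. -/
def tangentProj {n : ℕ} (G : MetricField n) (ξ : Pt n → Pt n) (x : Pt n) :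
    Matrix (Fin n) (Fin n) ℝ := fun k i =>
  (if k = i then 1 else 0) - ξ x k * ∑ j, G x i j * ξ x j

/-- Tangential gradient `∇_S u = grad u - du(ξ) ξ`. -/
def tangentGrad {n : ℕ} (G : MetricField n) (ξ : Pt n → Pt n) (u : Pt n → ℝ) (x : Pt n) : Pt n :=
  gradG G u x - (fderiv ℝ u x (ξ x)) • ξ x

/-- Laplace–Beltrami operator of `S`: `Δ_S u = div_S (∇_S u)`, where the divergence
`div_S X` is the trace over the tangent space of `v ↦ ∇_v X`. -/
def surfaceLaplacian {n : ℕ} (G : MetricField n) (ξ : Pt n → Pt n) (u : Pt n → ℝ) (x : Pt n) : ℝ :=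
  (tangentProj G ξ x * covDeriv G (tangentGrad G ξ u) x).trace

/-- Shape operator `v ↦ -∇_v ξ` of `S` (extended by zero to the normal direction), i.e.
`A_S(v, w) = -g(∇_v ξ, w)`. -/
def shapeOp {n : ℕ} (G : MetricField n) (ξ : Pt n → Pt n) (x : Pt n) :
    Matrix (Fin n) (Fin n) ℝ :=
  -(tangentProj G ξ x * covDeriv G ξ x * tangentProj G ξ x)

/-- `|A_S|²`, the trace of the square of the (self-adjoint) shape operator. -/
def normSqSecondForm {n : ℕ} (G : MetricField n) (ξ : Pt n → Pt n) (x : Pt n) : ℝ :=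
  (shapeOp G ξ x * shapeOp G ξ x).trace

/-- Jacobi operator `J_S u = Δ_S u + (Ric(ξ, ξ) + |A_S|²) u`. -/
def jacobiOp {n : ℕ} (G : MetricField n) (ξ : Pt n → Pt n) (u : Pt n → ℝ) (x : Pt n) : ℝ :=
  surfaceLaplacian G ξ u x
    + (metricInner (ricci G) x (ξ x) (ξ x) + normSqSecondForm G ξ x) * u x

/-! ### The Riemannian Schwarzschild space -/

/-- Radius of the horizon, `R₀ = (m/2)^{1/(n-2)}`. -/
def horizonRadius (n : ℕ) (m : ℝ) : ℝ := (m / 2) ^ (1 / ((n : ℝ) - 2))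

/-- `φ(x) = (1 + m / (2 |x|^{n-2}))^{2/(n-2)}`, so that `g_Sch = φ² δ`. -/
def confFactor (n : ℕ) (m : ℝ) (x : Pt n) : ℝ :=
  (1 + m / (2 * ‖x‖ ^ (n - 2))) ^ (2 / ((n : ℝ) - 2))

/-- `g_Sch = (1 + m / (2 |x|^{n-2}))^{4/(n-2)} δ`. -/
def schwarzschild (n : ℕ) (m : ℝ) : MetricField n := fun x =>
  ((1 + m / (2 * ‖x‖ ^ (n - 2))) ^ (4 / ((n : ℝ) - 2))) • (1 : Matrix (Fin n) (Fin n) ℝ)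

/-- The radial `g_Sch`-unit field `η`; on the horizon `|x| = R₀` it is the unit normal of `∂M`
pointing into `M = {|x| ≥ R₀}`. -/
def radialUnit (n : ℕ) (m : ℝ) (x : Pt n) : Pt n := (confFactor n m x * ‖x‖)⁻¹ • x

/-- `A_{∂M}(v, v) = -g_Sch(∇_v η, v)` at a point `x` of the horizon. -/
def horizonSecondForm (n : ℕ) (m : ℝ) (x v : Pt n) : ℝ :=
  -metricInner (schwarzschild n m) x
    (WithLp.toLp 2 ((covDeriv (schwarzschild n m) (radialUnit n m) x).mulVec v)) v

/-- The index form
`Q(u, u) = -∫_{S(R)} u J_S u dv + ∫_{∂S} u (∂u/∂ν - A_{∂M}(ξ, ξ) u) ds`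
of a free boundary hypersurface `S` of Schwarzschild space with unit normal `ξ`, for functions `u`
vanishing on `{|x| = R}`. Here `S(R) = S ∩ {|x| ≤ R}`, `∂S = S ∩ {|x| = R₀}`. As `g_Sch = φ² δ`,
its `d`-dimensional area element is `φ^d` times the Euclidean `d`-dimensional area. As `S` meets
`∂M` orthogonally, the outward unit conormal is `ν = -η`. -/
def indexForm (n : ℕ) (m : ℝ) (S : Set (Pt n)) (ξ : Pt n → Pt n) (R : ℝ) (u : Pt n → ℝ) : ℝ :=
  -(∫ x in S ∩ {x | ‖x‖ ≤ R},
      u x * jacobiOp (schwarzschild n m) ξ u x * confFactor n m x ^ (n - 1) ∂μHE[n - 1])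
  + ∫ x in S ∩ {x | ‖x‖ = horizonRadius n m},
      u x * (fderiv ℝ u x (-radialUnit n m x) - horizonSecondForm n m x (ξ x) * u x)
        * confFactor n m x ^ (n - 2) ∂μHE[n - 2]

/-- The largest dimension of a linear space `V` of smooth functions on `S(R)` which vanish on the
part `Z` of `S(R)` and on which the index form is negative definite.

Smooth functions on `S(R)` are represented by smooth functions on `ℝⁿ`. Since the index form only
depends on the restriction to `S(R)`, a nonzero element of a `V` as below never vanishes identically
on `S(R)`, so `V` and its space of restrictions have the same dimension. -/
def negIndex (n : ℕ) (m : ℝ) (S : Set (Pt n)) (ξ : Pt n → Pt n) (R : ℝ) (Z : Set (Pt n)) : ℕ∞ :=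
  ⨆ (V : Submodule ℝ (Pt n → ℝ))
    (_ : (∀ u ∈ V, ContDiff ℝ ∞ u ∧ ∀ x ∈ Z, u x = 0) ∧
      ∀ u ∈ V, u ≠ 0 → indexForm n m S ξ R u < 0),
    Cardinal.toENat (Module.rank ℝ V)

/-- `Ind_F(S(R))`: the functions vanish on `S ∩ {|x| = R}`. -/
def indF (n : ℕ) (m : ℝ) (S : Set (Pt n)) (ξ : Pt n → Pt n) (R : ℝ) : ℕ∞ :=
  negIndex n m S ξ R (S ∩ {x | ‖x‖ = R})

/-- The Dirichlet index `Ind_D(S(R))`: the functions vanish on the whole boundary of `S(R)`. -/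
def indD (n : ℕ) (m : ℝ) (S : Set (Pt n)) (ξ : Pt n → Pt n) (R : ℝ) : ℕ∞ :=
  negIndex n m S ξ R (S ∩ {x | ‖x‖ = R ∨ ‖x‖ = horizonRadius n m})

/-- The Morse index `limsup_{R → ∞} Ind_F(S(R))`. -/
def morseIndex (n : ℕ) (m : ℝ) (S : Set (Pt n)) (ξ : Pt n → Pt n) : ℕ∞ :=
  limsup (fun R : ℝ => indF n m S ξ R) atTop

/-! ### Hypersurfaces of the unit sphere and the cones over them -/

/-- Smooth embedded `d`-dimensional submanifold (without boundary) of `ℝⁿ`, by slice charts. -/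
def IsEmbeddedSubmanifold {n : ℕ} (d : ℕ) (S : Set (Pt n)) : Prop :=
  ∀ p ∈ S, ∃ Φ : OpenPartialHomeomorph (Pt n) (Pt n), p ∈ Φ.source ∧
    ContDiffOn ℝ ∞ Φ Φ.source ∧ ContDiffOn ℝ ∞ Φ.symm Φ.target ∧
    ∃ L : Submodule ℝ (Pt n), Module.finrank ℝ L = d ∧ ∀ x ∈ Φ.source, x ∈ S ↔ Φ x ∈ L

/-- `Γ` is a nonempty closed embedded hypersurface of the unit sphere `𝕊^{n-1}`, oriented by the
unit normal field `ν|_Γ`. (A smooth normal field along the compact `Γ` is the restriction of a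
smooth vector field on `ℝⁿ`; nothing is required of `ν` away from `Γ`.) -/
structure IsClosedOrientedHypersurface {n : ℕ} (Γ : Set (Pt n)) (ν : Pt n → Pt n) : Prop where
  nonempty : Γ.Nonempty
  isCompact : IsCompact Γ
  subset_sphere : Γ ⊆ Metric.sphere 0 1
  embedded : IsEmbeddedSubmanifold (n - 2) Γ
  smooth : ContDiff ℝ ∞ ν
  unit : ∀ p ∈ Γ, ‖ν p‖ = 1
  tangent_sphere : ∀ p ∈ Γ, ⟪p, ν p⟫ = 0
  normal : ∀ p ∈ Γ, ∀ v ∈ tangentConeAt ℝ Γ p, ⟪ν p, v⟫ = 0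

/-- The tangent space `T_pΓ`: the orthogonal complement of `p` and `ν p`. -/
def linkTangent {n : ℕ} (ν : Pt n → Pt n) (p : Pt n) : Set (Pt n) :=
  {v | ⟪p, v⟫ = 0 ∧ ⟪ν p, v⟫ = 0}

/-- Second fundamental form `A_Γ(v, w) = -⟨D_v ν, w⟩` of `Γ` in the sphere, `v, w ∈ T_pΓ`. -/
def linkSecondForm {n : ℕ} (ν : Pt n → Pt n) (p v w : Pt n) : ℝ :=
  -⟪fderiv ℝ ν p v, w⟫

/-- `Γ` is minimal in the sphere: `A_Γ` has zero trace at every point. -/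
def IsMinimalInSphere {n : ℕ} (Γ : Set (Pt n)) (ν : Pt n → Pt n) : Prop :=
  ∀ p ∈ Γ, ∀ e : Fin (n - 2) → Pt n, Orthonormal ℝ e → (∀ i, e i ∈ linkTangent ν p) →
    ∑ i, linkSecondForm ν p (e i) (e i) = 0

/-- `Γ` is totally geodesic in the sphere: `A_Γ = 0`. -/
def IsTotallyGeodesicInSphere {n : ℕ} (Γ : Set (Pt n)) (ν : Pt n → Pt n) : Prop :=
  ∀ p ∈ Γ, ∀ v ∈ linkTangent ν p, ∀ w ∈ linkTangent ν p, linkSecondForm ν p v w = 0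

/-- The cone `C_Γ = {λ y : y ∈ Γ, λ > 0}`. -/
def coneOver {n : ℕ} (Γ : Set (Pt n)) : Set (Pt n) :=
  {x | ∃ c : ℝ, 0 < c ∧ ∃ y ∈ Γ, x = c • y}

/-- The truncated cone `Σ_Γ = {x ∈ C_Γ : |x| ≥ R₀}`. -/
def truncatedCone (n : ℕ) (m : ℝ) (Γ : Set (Pt n)) : Set (Pt n) :=
  coneOver Γ ∩ {x | horizonRadius n m ≤ ‖x‖}

/-- The `g_Sch`-unit normal field of `Σ_Γ`, `ξ(x) = φ(x)⁻¹ ν(x / |x|)`. -/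
def coneNormal (n : ℕ) (m : ℝ) (ν : Pt n → Pt n) (x : Pt n) : Pt n :=
  (confFactor n m x)⁻¹ • ν (‖x‖⁻¹ • x)

/-- `Σ₀ = {x : x_n = 0, |x| ≥ R₀}` (last coordinate zero). -/
def truncatedHyperplane (n : ℕ) (m : ℝ) : Set (Pt n) :=
  {x | (∀ i : Fin n, (i : ℕ) + 1 = n → x i = 0) ∧ horizonRadius n m ≤ ‖x‖}

end

noncomputable section

/-! ### The tangent spaces of the link -/

/-! Put t = log |x| and z = d(log φ)/dt. Everything is reduced to a weighted one-dimensional problem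
in t.

If Γ is not totally geodesic, the test functions are u = θ(log |x|) g with g = (|x|²|A|² + ε)^{1/2},
where A is the Euclidean second fundamental form of the cone; g is homogeneous of degree 0. Simons'
identity and a Kato inequality give (n-2)|A|² ≤ g Δg + |A|² g²
(`MinimalConeCalculus.simons_inequality`), and Ric(ξ, ξ) ≥ 0 may be dropped. Polar coordinates on
the cone (`exists_polar_integral`) then bound Q(u, u) by (κ + εκ') ∫ qθ'² - (n-2) κ ∫ qθ², where q =
(φ eᵗ)^{n-3} and κ, κ' are the constants belonging to the densities |x|²|A|² and 1
(`indexForm_coneTest_le`). The substitution θ = e^{-(n-3)t/2} χ turns this into a Hardy inequality: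
wide bumps χ make the form negative as soon as (n-3)²/4 < n-2, which for integers n ≥ 4 means n ≤ 7.
Disjoint bumps span negative spaces of any dimension, and their elements vanish on the horizon, so
already the Dirichlet index is unbounded (`eventually_le_indD`).

If Γ is totally geodesic, its normal is locally constant, so Γ is locally, and by connectedness
globally, a great sphere (`eq_great_sphere`); conversely the normal of a great sphere is ±b for a
fixed b. The cone is then a piece of a hyperplane and A = 0. The Laplacian splits into a spherical
part, half a sum of squares of rotation fields, which has a sign because rotations preserve Lebesgue
measure (`integral_spherical_nonpos`), and a radial part. Comparison with the function (φ r)⁻¹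
writes the radial integrand as a total derivative minus (φ r)^{n-3} r⁻¹ ((w' + (1+z)w)² +
(n-4)(1+z)²w²), with w' = dw/dt (`integral_radialDensity_le`). The remainder is nonnegative for n ≥
4. At the horizon 1 + z = 0, so the only surviving boundary term is the one that the conormal
derivative in Q cancels; hence Q ≥ 0 and the index is 0.

Two technical devices support this. Simons' computation is done in an abstract commutative algebra
with derivations (`MinimalConeCalculus`) and then applied to functions on the cone. Areas are
Hausdorff measures: on a general cone only their behaviour under dilations is used, while the
hyperplane case needs that the Hausdorff measure of the unit sphere is its surface measure
(`euclideanHausdorffMeasure_sphere`). -/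

lemma tangentConeAt_sphere_inner_eq_zero {n : ℕ} {Γ : Set (Pt n)} (hs : Γ ⊆ Metric.sphere 0 1)
    {p v : Pt n} (hp : p ∈ Γ) (hv : v ∈ tangentConeAt ℝ Γ p) : ⟪p, v⟫ = 0 := by
  have h1 : HasFDerivWithinAt (fun x : Pt n => ⟪x, x⟫) (2 • (innerSL ℝ p)) Γ p := by
    have h := ((hasFDerivAt_id p).inner ℝ (hasFDerivAt_id p)).hasFDerivWithinAt (s := Γ)
    refine h.congr_fderiv ?_
    ext w
    simp [fderivInnerCLM_apply, real_inner_comm, two_mul]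
  have h2 : HasFDerivWithinAt (fun x : Pt n => ⟪x, x⟫) (0 : Pt n →L[ℝ] ℝ) Γ p := by
    refine (hasFDerivWithinAt_const (1 : ℝ) p Γ).congr ?_ ?_
    · intro x hx
      have := hs hx
      rw [mem_sphere_zero_iff_norm] at this
      simp [this]
    · have := hs hp
      rw [mem_sphere_zero_iff_norm] at this
      simp [this]
  have := h1.unique_on h2 hv
  simpa using this

/-- Data of a slice chart of the link around a point. -/
structure LinkChart {n : ℕ} (Γ : Set (Pt n)) (ν : Pt n → Pt n)
    (Φ : OpenPartialHomeomorph (Pt n) (Pt n)) (L : Submodule ℝ (Pt n)) : Prop where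
  smooth : ContDiffOn ℝ ∞ Φ Φ.source
  smooth_symm : ContDiffOn ℝ ∞ Φ.symm Φ.target
  finrank : Module.finrank ℝ L = n - 2
  mem_iff : ∀ x ∈ Φ.source, x ∈ Γ ↔ Φ x ∈ L

namespace LinkChart

variable {n : ℕ} {Γ : Set (Pt n)} {ν : Pt n → Pt n}
  {Φ : OpenPartialHomeomorph (Pt n) (Pt n)} {L : Submodule ℝ (Pt n)}

lemma contDiffAt (h : LinkChart Γ ν Φ L) {x : Pt n} (hx : x ∈ Φ.source) :
    ContDiffAt ℝ ∞ Φ x :=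
  h.smooth.contDiffAt (Φ.open_source.mem_nhds hx)

lemma contDiffAt_symm (h : LinkChart Γ ν Φ L) {y : Pt n} (hy : y ∈ Φ.target) :
    ContDiffAt ℝ ∞ Φ.symm y :=
  h.smooth_symm.contDiffAt (Φ.open_target.mem_nhds hy)

lemma symm_mem (h : LinkChart Γ ν Φ L) {y : Pt n} (hy : y ∈ Φ.target) (hyL : y ∈ L) :
    Φ.symm y ∈ Γ := by
  rw [h.mem_iff _ (Φ.map_target hy), Φ.right_inv hy]
  exact hyL

lemma fderiv_symm_mem_tangentConeAt (h : LinkChart Γ ν Φ L) {y l : Pt n}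
    (hy : y ∈ Φ.target) (hyL : y ∈ L) (hl : l ∈ L) :
    fderiv ℝ Φ.symm y l ∈ tangentConeAt ℝ Γ (Φ.symm y) := by
  have hd : HasFDerivAt Φ.symm (fderiv ℝ Φ.symm y) y :=
    ((h.contDiffAt_symm hy).differentiableAt (by simp)).hasFDerivAt
  have hline : HasLineDerivAt ℝ Φ.symm (fderiv ℝ Φ.symm y l) y l := hd.hasLineDerivAt l
  have hs := hasDerivAt_iff_tendsto_slope_zero.1 hline
  have hcont : Tendsto (fun t : ℝ => y + t • l) (𝓝[≠] 0) (𝓝 y) := by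
    have : Continuous fun t : ℝ => y + t • l := by fun_prop
    exact (this.tendsto' 0 y (by simp)).mono_left nhdsWithin_le_nhds
  refine mem_tangentConeAt_of_seq (𝓝[≠] (0 : ℝ)) (fun t => t⁻¹)
    (fun t => Φ.symm (y + t • l) - Φ.symm y) ?_ ?_ ?_
  · have := (hd.continuousAt.tendsto.comp hcont).sub_const (Φ.symm y)
    simpa [Function.comp_def] using this
  · filter_upwards [hcont.eventually (Φ.open_target.mem_nhds hy)] with t ht
    rw [add_sub_cancel]
    exact h.symm_mem ht (L.add_mem hyL (L.smul_mem _ hl))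
  · simpa using hs

lemma fderiv_symm_injective (h : LinkChart Γ ν Φ L) {y : Pt n} (hy : y ∈ Φ.target) :
    Function.Injective (fderiv ℝ Φ.symm y) := by
  have h1 : HasFDerivAt Φ.symm (fderiv ℝ Φ.symm y) y :=
    ((h.contDiffAt_symm hy).differentiableAt (by simp)).hasFDerivAt
  have h2 : HasFDerivAt Φ (fderiv ℝ Φ (Φ.symm y)) (Φ.symm y) :=
    ((h.contDiffAt (Φ.map_target hy)).differentiableAt (by simp)).hasFDerivAt
  have h3 := h2.comp y h1
  have h4 : HasFDerivAt (Φ ∘ Φ.symm) (ContinuousLinearMap.id ℝ (Pt n)) y := by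
    refine (hasFDerivAt_id y).congr_of_eventuallyEq ?_
    filter_upwards [Φ.open_target.mem_nhds hy] with z hz
    simp [Φ.right_inv hz]
  have h5 := h3.unique h4
  intro v w hvw
  have := congrArg (fun T => T v) h5
  have h' := congrArg (fun T => T w) h5
  simp only [ContinuousLinearMap.comp_apply, ContinuousLinearMap.id_apply] at this h'
  rw [← this, ← h', hvw]

end LinkChart

/-- The tangent space of the link as a submodule. -/
def linkTangentSubmodule {n : ℕ} (ν : Pt n → Pt n) (p : Pt n) : Submodule ℝ (Pt n) :=
  (Submodule.span ℝ {p, ν p})ᗮ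

lemma mem_linkTangentSubmodule {n : ℕ} {ν : Pt n → Pt n} {p v : Pt n} :
    v ∈ linkTangentSubmodule ν p ↔ v ∈ linkTangent ν p := by
  rw [linkTangentSubmodule, Submodule.mem_orthogonal]
  constructor
  · intro h
    exact ⟨h _ (Submodule.subset_span (by simp)), h _ (Submodule.subset_span (by simp))⟩
  · rintro ⟨h1, h2⟩ u hu
    induction hu using Submodule.span_induction with
    | mem x hx =>
      rcases hx with rfl | hx
      · exact h1
      · rw [Set.mem_singleton_iff] at hx
        rw [hx]; exact h2
    | zero => simp
    | add x y _ _ hx hy => rw [inner_add_left, hx, hy, add_zero]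
    | smul c x _ hx => rw [inner_smul_left, hx, mul_zero]

namespace IsClosedOrientedHypersurface

variable {n : ℕ} {Γ : Set (Pt n)} {ν : Pt n → Pt n}

lemma norm_eq_one (hΓ : IsClosedOrientedHypersurface Γ ν) {p : Pt n} (hp : p ∈ Γ) : ‖p‖ = 1 :=
  mem_sphere_zero_iff_norm.1 (hΓ.subset_sphere hp)

lemma exists_chart (hΓ : IsClosedOrientedHypersurface Γ ν) {p : Pt n} (hp : p ∈ Γ) :
    ∃ Φ L, p ∈ Φ.source ∧ LinkChart Γ ν Φ L := by
  obtain ⟨Φ, h1, h2, h3, L, h4, h5⟩ := hΓ.embedded p hp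
  exact ⟨Φ, L, h1, h2, h3, h4, h5⟩

lemma tangentConeAt_subset (hΓ : IsClosedOrientedHypersurface Γ ν) {p v : Pt n} (hp : p ∈ Γ)
    (hv : v ∈ tangentConeAt ℝ Γ p) : v ∈ linkTangent ν p :=
  ⟨tangentConeAt_sphere_inner_eq_zero hΓ.subset_sphere hp hv, hΓ.normal p hp v hv⟩

lemma finrank_linkTangentSubmodule (hΓ : IsClosedOrientedHypersurface Γ ν) {p : Pt n}
    (hp : p ∈ Γ) : Module.finrank ℝ (linkTangentSubmodule ν p) = n - 2 := by
  have horth : Orthonormal ℝ ![p, ν p] := by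
    rw [orthonormal_iff_ite]
    have h1 := hΓ.norm_eq_one hp
    have h2 := hΓ.unit p hp
    have h3 := hΓ.tangent_sphere p hp
    have h4 : ⟪ν p, p⟫ = 0 := by rw [real_inner_comm]; exact h3
    intro i j
    fin_cases i <;> fin_cases j <;> simp [h1, h2, h3, h4]
  have h := finrank_span_eq_card horth.linearIndependent
  rw [Matrix.range_cons, Matrix.range_cons, Matrix.range_empty, Set.union_empty] at h
  have h' := Submodule.finrank_add_finrank_orthogonal (Submodule.span ℝ {p, ν p})
  have e : ({p} ∪ {ν p} : Set (Pt n)) = {p, ν p} := rfl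
  rw [e] at h
  rw [h] at h'
  simp only [Fintype.card_fin, finrank_euclideanSpace] at h'
  rw [linkTangentSubmodule]
  omega

lemma fderiv_symm_mem_linkTangent (hΓ : IsClosedOrientedHypersurface Γ ν)
    {Φ : OpenPartialHomeomorph (Pt n) (Pt n)} {L : Submodule ℝ (Pt n)} (hΦ : LinkChart Γ ν Φ L)
    {y l : Pt n} (hy : y ∈ Φ.target) (hyL : y ∈ L) (hl : l ∈ L) :
    fderiv ℝ Φ.symm y l ∈ linkTangent ν (Φ.symm y) :=
  hΓ.tangentConeAt_subset (hΦ.symm_mem hy hyL) (hΦ.fderiv_symm_mem_tangentConeAt hy hyL hl)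

/-- The hypotheses on ν say only that tangent vectors are orthogonal to ν p. Together with
orthogonality to p this is one inclusion; since both spaces have dimension n - 2, the derivative of
the inverse chart fills the whole complement of p and ν p. -/
lemma exists_fderiv_symm_eq (hΓ : IsClosedOrientedHypersurface Γ ν)
    {Φ : OpenPartialHomeomorph (Pt n) (Pt n)} {L : Submodule ℝ (Pt n)} (hΦ : LinkChart Γ ν Φ L)
    {y v : Pt n} (hy : y ∈ Φ.target) (hyL : y ∈ L) (hv : v ∈ linkTangent ν (Φ.symm y)) :
    ∃ l ∈ L, fderiv ℝ Φ.symm y l = v := by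
  set D : Pt n →ₗ[ℝ] Pt n := (fderiv ℝ Φ.symm y : Pt n →ₗ[ℝ] Pt n) with hD
  have hle : L.map D ≤ linkTangentSubmodule ν (Φ.symm y) := by
    rintro _ ⟨l, hl, rfl⟩
    exact mem_linkTangentSubmodule.2 (hΓ.fderiv_symm_mem_linkTangent hΦ hy hyL hl)
  have hinj : Function.Injective D := hΦ.fderiv_symm_injective hy
  have hfr : Module.finrank ℝ (L.map D)
      = Module.finrank ℝ (linkTangentSubmodule ν (Φ.symm y)) := by
    rw [hΓ.finrank_linkTangentSubmodule (hΦ.symm_mem hy hyL), ← hΦ.finrank]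
    exact (Submodule.equivMapOfInjective D hinj L).finrank_eq.symm
  have heq := Submodule.eq_of_le_of_finrank_eq hle hfr
  have hv' : v ∈ L.map D := by rw [heq]; exact mem_linkTangentSubmodule.2 hv
  obtain ⟨l, hl, h⟩ := hv'
  exact ⟨l, hl, h⟩

lemma linkTangent_subset_tangentConeAt (hΓ : IsClosedOrientedHypersurface Γ ν) {p v : Pt n}
    (hp : p ∈ Γ) (hv : v ∈ linkTangent ν p) : v ∈ tangentConeAt ℝ Γ p := by
  obtain ⟨Φ, L, hs, hΦ⟩ := hΓ.exists_chart hp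
  have hy := Φ.map_source hs
  have e := Φ.left_inv hs
  obtain ⟨l, hl, rfl⟩ := hΓ.exists_fderiv_symm_eq hΦ hy ((hΦ.mem_iff _ hs).1 hp) (by rwa [e])
  have := hΦ.fderiv_symm_mem_tangentConeAt hy ((hΦ.mem_iff _ hs).1 hp) hl
  rwa [e] at this

/-- The tangential derivatives of a function only depend on its restriction to the link. -/
lemma fderiv_eq_of_eqOn (hΓ : IsClosedOrientedHypersurface Γ ν) {F : Type*}
    [NormedAddCommGroup F] [NormedSpace ℝ F] {f g : Pt n → F} {p v : Pt n} (hp : p ∈ Γ)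
    (hf : DifferentiableAt ℝ f p) (hg : DifferentiableAt ℝ g p) (hfg : Set.EqOn f g Γ)
    (hv : v ∈ linkTangent ν p) : fderiv ℝ f p v = fderiv ℝ g p v := by
  have h1 := hf.hasFDerivAt.hasFDerivWithinAt (s := Γ)
  have h2 := (hg.hasFDerivAt.hasFDerivWithinAt (s := Γ)).congr hfg (hfg hp)
  exact h1.unique_on h2 (hΓ.linkTangent_subset_tangentConeAt hp hv)

lemma differentiable_normal (hΓ : IsClosedOrientedHypersurface Γ ν) : Differentiable ℝ ν :=
  hΓ.smooth.differentiable (by simp)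

lemma inner_fderiv_normal_normal (hΓ : IsClosedOrientedHypersurface Γ ν) {p v : Pt n}
    (hp : p ∈ Γ) (hv : v ∈ linkTangent ν p) : ⟪ν p, fderiv ℝ ν p v⟫ = 0 := by
  have hν := (hΓ.differentiable_normal p).hasFDerivAt
  have h := hν.inner ℝ hν
  have h2 := hΓ.fderiv_eq_of_eqOn (f := fun x => ⟪ν x, ν x⟫) (g := fun _ => (1 : ℝ)) hp
    h.differentiableAt (by fun_prop) (fun x hx => by simp [hΓ.unit x hx]) hv
  rw [h.fderiv] at h2
  simp [fderivInnerCLM_apply, real_inner_comm] at h2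
  exact h2

lemma inner_fderiv_normal_self (hΓ : IsClosedOrientedHypersurface Γ ν) {p v : Pt n}
    (hp : p ∈ Γ) (hv : v ∈ linkTangent ν p) : ⟪p, fderiv ℝ ν p v⟫ = 0 := by
  have hν := (hΓ.differentiable_normal p).hasFDerivAt
  have h := (hasFDerivAt_id p).inner ℝ hν
  have h2 := hΓ.fderiv_eq_of_eqOn (f := fun x => ⟪id x, ν x⟫) (g := fun _ => (0 : ℝ)) hp
    h.differentiableAt (by fun_prop) (fun x hx => by simp [hΓ.tangent_sphere x hx]) hv
  rw [h.fderiv] at h2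
  have h3 := hv.2
  rw [real_inner_comm] at h3
  simpa [fderivInnerCLM_apply, h3] using h2

/-- The second fundamental form of the link is symmetric. -/
lemma inner_fderiv_normal_comm (hΓ : IsClosedOrientedHypersurface Γ ν) {p v w : Pt n}
    (hp : p ∈ Γ) (hv : v ∈ linkTangent ν p) (hw : w ∈ linkTangent ν p) :
    ⟪fderiv ℝ ν p v, w⟫ = ⟪fderiv ℝ ν p w, v⟫ := by
  obtain ⟨Φ, L, hs, hΦ⟩ := hΓ.exists_chart hp
  have hy := Φ.map_source hs
  have e := Φ.left_inv hs
  have hyL := (hΦ.mem_iff _ hs).1 hp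
  set y := Φ p with hydef
  have hsm := hΦ.contDiffAt_symm hy
  have hψ : HasFDerivAt Φ.symm (fderiv ℝ Φ.symm y) y := (hsm.differentiableAt (by simp)).hasFDerivAt
  have hψ' : HasFDerivAt (fderiv ℝ Φ.symm) (fderiv ℝ (fderiv ℝ Φ.symm) y) y :=
    (((hsm.fderiv_right (m := 1) (by norm_cast)).differentiableAt (by simp))).hasFDerivAt
  have hsymm : IsSymmSndFDerivAt ℝ Φ.symm y := hsm.isSymmSndFDerivAt (by simp; norm_cast)
  -- With ψ the inverse chart, ⟪ν ∘ ψ, Dψ k⟫ = 0 along L. Differentiating in the direction l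
  -- expresses the form through D²ψ(l, k), which is symmetric.
  have key : ∀ l ∈ L, ∀ k ∈ L, ⟪fderiv ℝ ν p (fderiv ℝ Φ.symm y l), fderiv ℝ Φ.symm y k⟫
      = -⟪ν p, fderiv ℝ (fderiv ℝ Φ.symm) y l k⟫ := by
    intro l hl k hk
    have hν : HasFDerivAt ν (fderiv ℝ ν p) (Φ.symm y) := by
      rw [e]; exact (hΓ.differentiable_normal p).hasFDerivAt
    have hνψ := hν.comp y hψ
    have happ : HasFDerivAt (fun z => fderiv ℝ Φ.symm z k)
        ((fderiv ℝ (fderiv ℝ Φ.symm) y).flip k) y := by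
      have := hψ'.clm_apply (hasFDerivAt_const k y)
      refine this.congr_fderiv ?_
      ext; simp
    have hin := hνψ.inner ℝ happ
    have hline := hin.hasLineDerivAt l
    have hzero : HasDerivAt (fun t : ℝ => ⟪(ν ∘ Φ.symm) (y + t • l),
        fderiv ℝ Φ.symm (y + t • l) k⟫) 0 0 := by
      refine (hasDerivAt_const (0 : ℝ) (0 : ℝ)).congr_of_eventuallyEq ?_
      have hcont : Tendsto (fun t : ℝ => y + t • l) (𝓝 0) (𝓝 y) := by
        have : Continuous fun t : ℝ => y + t • l := by fun_prop
        exact this.tendsto' 0 y (by simp)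
      filter_upwards [hcont.eventually (Φ.open_target.mem_nhds hy)] with t ht
      exact (hΓ.fderiv_symm_mem_linkTangent hΦ ht (L.add_mem hyL (L.smul_mem _ hl)) hk).2
    have := hline.unique hzero
    simp only [ContinuousLinearMap.comp_apply, fderivInnerCLM_apply, ContinuousLinearMap.prod_apply,
      Function.comp_apply, ContinuousLinearMap.flip_apply, e] at this
    linarith
  obtain ⟨l, hl, rfl⟩ := hΓ.exists_fderiv_symm_eq hΦ hy hyL (v := v) (by rwa [e])
  obtain ⟨k, hk, rfl⟩ := hΓ.exists_fderiv_symm_eq hΦ hy hyL (v := w) (by rwa [e])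
  rw [key l hl k hk, key k hk l hl, hsymm.eq]

end IsClosedOrientedHypersurface

/-! ### Totally geodesic links are great spheres -/

namespace IsClosedOrientedHypersurface

variable {n : ℕ} {Γ : Set (Pt n)} {ν : Pt n → Pt n}

lemma fderiv_normal_mem_linkTangent (hΓ : IsClosedOrientedHypersurface Γ ν) {p v : Pt n}
    (hp : p ∈ Γ) (hv : v ∈ linkTangent ν p) : fderiv ℝ ν p v ∈ linkTangent ν p :=
  ⟨hΓ.inner_fderiv_normal_self hp hv, hΓ.inner_fderiv_normal_normal hp hv⟩

/-- The derivative of ν in a tangent direction is itself tangent to the link, so it can be used as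
the second argument of A_Γ = 0. -/
lemma fderiv_normal_eq_zero (hΓ : IsClosedOrientedHypersurface Γ ν)
    (hTG : IsTotallyGeodesicInSphere Γ ν) {p v : Pt n} (hp : p ∈ Γ) (hv : v ∈ linkTangent ν p) :
    fderiv ℝ ν p v = 0 := by
  have h := hTG p hp v hv _ (hΓ.fderiv_normal_mem_linkTangent hp hv)
  rw [linkSecondForm, neg_eq_zero] at h
  exact inner_self_eq_zero.1 h

/-- In a slice chart ν has zero derivative on a ball of L, and a ball is connected. -/
lemma eventually_normal_eq (hΓ : IsClosedOrientedHypersurface Γ ν)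
    (hTG : IsTotallyGeodesicInSphere Γ ν) {p : Pt n} (hp : p ∈ Γ) :
    ∀ᶠ q in 𝓝 p, q ∈ Γ → ν q = ν p := by
  obtain ⟨Φ, L, hs, hΦ⟩ := hΓ.exists_chart hp
  have hy := Φ.map_source hs
  have hyL := (hΦ.mem_iff _ hs).1 hp
  obtain ⟨r, hr, hball⟩ := Metric.isOpen_iff.1 Φ.open_target _ hy
  set B : Set L := Metric.ball ⟨Φ p, hyL⟩ r
  have hB : ∀ l ∈ B, (l : Pt n) ∈ Φ.target := fun l hl => hball (by
    have hl' : dist l ⟨Φ p, hyL⟩ < r := hl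
    rwa [Subtype.dist_eq] at hl')
  have hder : ∀ l ∈ B, HasFDerivAt (fun l : L => ν (Φ.symm (l : Pt n)))
      (0 : L →L[ℝ] Pt n) l := by
    intro l hl
    have h1 : HasFDerivAt (fun k : L => (k : Pt n)) L.subtypeL l := L.subtypeL.hasFDerivAt
    have h2 : HasFDerivAt Φ.symm (fderiv ℝ Φ.symm l) (l : Pt n) :=
      ((hΦ.contDiffAt_symm (hB l hl)).differentiableAt (by simp)).hasFDerivAt
    have h3 := (hΓ.differentiable_normal (Φ.symm l)).hasFDerivAt
    have h4 : HasFDerivAt (fun k : L => Φ.symm (k : Pt n))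
        (fderiv ℝ Φ.symm l ∘SL L.subtypeL) l := h2.comp l h1
    have h5 : HasFDerivAt (fun k : L => ν (Φ.symm (k : Pt n)))
        (fderiv ℝ ν (Φ.symm l) ∘SL (fderiv ℝ Φ.symm l ∘SL L.subtypeL)) l := h3.comp l h4
    refine h5.congr_fderiv ?_
    ext1 k
    exact hΓ.fderiv_normal_eq_zero hTG (hΦ.symm_mem (hB l hl) l.2)
      (hΓ.fderiv_symm_mem_linkTangent hΦ (hB l hl) l.2 k.2)
  have hconst : ∀ x y : L, x ∈ B → y ∈ B → ν (Φ.symm (x : Pt n)) = ν (Φ.symm (y : Pt n)) :=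
    fun x y hx hy => (Metric.isOpen_ball (x := (⟨Φ p, hyL⟩ : L))
      (ε := r)).is_const_of_fderiv_eq_zero (𝕜 := ℝ) (f := fun l : L => ν (Φ.symm (l : Pt n)))
      (convex_ball _ _).isPreconnected
      (fun l hl => (hder l hl).differentiableAt.differentiableWithinAt)
      (fun l hl => (hder l hl).fderiv) hx hy
  have hcont : Tendsto Φ (𝓝 p) (𝓝 (Φ p)) := (Φ.continuousAt hs).tendsto
  filter_upwards [Φ.open_source.mem_nhds hs, hcont.eventually (Metric.ball_mem_nhds _ hr)]
    with q hq hqB hqΓ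
  have := hconst ⟨Φ q, (hΦ.mem_iff _ hq).1 hqΓ⟩ ⟨Φ p, hyL⟩ hqB (Metric.mem_ball_self hr)
  simpa [Φ.left_inv hq, Φ.left_inv hs] using this

/-- Near p the link projects onto a neighbourhood in its tangent space, by the surjective form of
the inverse function theorem. Since ν is constant there, the link stays in the hyperplane orthogonal
to ν p, and a unit vector of this hyperplane near p is determined by its projection. -/
lemma eventually_mem_of_orthogonal (hΓ : IsClosedOrientedHypersurface Γ ν)
    (hTG : IsTotallyGeodesicInSphere Γ ν) {p : Pt n} (hp : p ∈ Γ) :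
    ∀ᶠ q in 𝓝 p, ‖q‖ = 1 → ⟪ν p, q⟫ = 0 → q ∈ Γ ∧ ν q = ν p := by
  obtain ⟨Φ, L, hs, hΦ⟩ := hΓ.exists_chart hp
  have hy := Φ.map_source hs
  have hyL := (hΦ.mem_iff _ hs).1 hp
  have e := Φ.left_inv hs
  set W := linkTangentSubmodule ν p with hW
  set y : L := ⟨Φ p, hyL⟩ with hydef
  have hpp : ⟪p, p⟫ = 1 := by simp [hΓ.norm_eq_one hp]
  have hsub : HasStrictFDerivAt (fun l : L => (l : Pt n)) L.subtypeL y :=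
    L.subtypeL.hasStrictFDerivAt
  have hψ : HasStrictFDerivAt Φ.symm (fderiv ℝ Φ.symm (Φ p)) (y : Pt n) :=
    (hΦ.contDiffAt_symm hy).hasStrictFDerivAt (by simp)
  have hf : HasStrictFDerivAt (W.orthogonalProjectionOnto ∘ Φ.symm ∘ fun l : L => (l : Pt n))
      (W.orthogonalProjectionOnto ∘SL (fderiv ℝ Φ.symm (Φ p) ∘SL L.subtypeL)) y :=
    (W.orthogonalProjectionOnto.hasStrictFDerivAt (x := Φ.symm y)).comp y (hψ.comp y hsub)
  have hsurj : (↑(W.orthogonalProjectionOnto ∘SL (fderiv ℝ Φ.symm (Φ p) ∘SL L.subtypeL)) :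
      L →ₗ[ℝ] W).range = ⊤ := by
    rw [LinearMap.range_eq_top]
    intro w
    obtain ⟨l, hl, hlw⟩ := hΓ.exists_fderiv_symm_eq hΦ hy hyL (v := w)
      (by rw [e]; exact mem_linkTangentSubmodule.1 w.2)
    refine ⟨⟨l, hl⟩, ?_⟩
    simp [hlw]
  have hmap := hf.map_nhds_eq_of_surj hsurj
  have hcontsymm : Tendsto (fun l : L => Φ.symm (l : Pt n)) (𝓝 y) (𝓝 p) := by
    have h1 := hψ.continuousAt.comp (f := fun l : L => (l : Pt n)) (x := y)
      continuous_subtype_val.continuousAt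
    have h2 : Tendsto (Φ.symm ∘ fun l : L => (l : Pt n)) (𝓝 y) (𝓝 (Φ.symm y)) := h1.tendsto
    rwa [show Φ.symm (y : Pt n) = p from e] at h2
  have hpos : ∀ᶠ q in 𝓝 p, 0 < ⟪q, p⟫ := by
    have : Continuous fun q : Pt n => ⟪q, p⟫ := by fun_prop
    exact this.continuousAt.eventually (lt_mem_nhds (by simp [hΓ.norm_eq_one hp]))
  have hV : ∀ᶠ l : L in 𝓝 y, (l : Pt n) ∈ Φ.target ∧
      (Φ.symm (l : Pt n) ∈ Γ → ν (Φ.symm (l : Pt n)) = ν p) ∧ 0 < ⟪Φ.symm (l : Pt n), p⟫ :=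
    (continuous_subtype_val.continuousAt.eventually (Φ.open_target.mem_nhds hy)).and
      ((hcontsymm.eventually (hΓ.eventually_normal_eq hTG hp)).and (hcontsymm.eventually hpos))
  have himg := image_mem_map (m := W.orthogonalProjectionOnto ∘ Φ.symm ∘ fun l : L => (l : Pt n)) hV
  rw [hmap] at himg
  have hπ : Tendsto W.orthogonalProjectionOnto (𝓝 p) (𝓝 (W.orthogonalProjectionOnto p)) :=
    W.orthogonalProjectionOnto.continuous.continuousAt
  have himg' : ∀ᶠ q in 𝓝 p, W.orthogonalProjectionOnto q ∈
      (W.orthogonalProjectionOnto ∘ Φ.symm ∘ fun l : L => (l : Pt n)) ''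
        {l : L | (l : Pt n) ∈ Φ.target ∧ (Φ.symm (l : Pt n) ∈ Γ → ν (Φ.symm (l : Pt n)) = ν p) ∧
          0 < ⟪Φ.symm (l : Pt n), p⟫} := by
    refine hπ.eventually ?_
    have e' : (W.orthogonalProjectionOnto ∘ Φ.symm ∘ fun l : L => (l : Pt n)) y
        = W.orthogonalProjectionOnto p := by simp [hydef, e]
    rw [e'] at himg
    exact himg
  -- The point z of the link with the same projection as q differs from q by s p + t ν p.
  -- Orthogonality of q and z to ν p gives t = 0.
  filter_upwards [himg', hpos] with q hq hqpos hq1 hqa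
  obtain ⟨l, ⟨hlt, hlν, hlp⟩, hlq⟩ := hq
  set z := Φ.symm (l : Pt n) with hz
  have hzΓ : z ∈ Γ := hΦ.symm_mem hlt l.2
  have hνz := hlν hzΓ
  have hz1 := hΓ.norm_eq_one hzΓ
  have hza : ⟪ν p, z⟫ = 0 := by
    rw [← hνz, real_inner_comm]; exact hΓ.tangent_sphere z hzΓ
  have hd : W.orthogonalProjectionOnto (q - z) = 0 := by
    rw [map_sub, sub_eq_zero]; exact hlq.symm
  have hd' : q - z ∈ Submodule.span ℝ {p, ν p} := by
    rw [Submodule.orthogonalProjectionOnto_eq_zero_iff, hW, linkTangentSubmodule,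
      Submodule.orthogonal_orthogonal] at hd
    exact hd
  obtain ⟨s, t, hst⟩ := Submodule.mem_span_pair.1 hd'
  have hpν : ⟪p, ν p⟫ = 0 := hΓ.tangent_sphere p hp
  have hνp : ⟪ν p, p⟫ = 0 := by rw [real_inner_comm]; exact hpν
  have ht : t = 0 := by
    have h1 : ⟪ν p, q - z⟫ = 0 := by rw [inner_sub_right, hqa, hza, sub_zero]
    rw [← hst, inner_add_right, inner_smul_right, inner_smul_right, hνp] at h1
    simpa [hΓ.unit p hp] using h1
  have hqz : q = z + s • p := by
    rw [ht, zero_smul, add_zero] at hst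
    rw [hst]; abel
  -- Both q and z are unit vectors, and both have positive inner product with p; the second factor
  -- is the sum of these two inner products, so s = 0.
  have hs0 : s * (2 * ⟪z, p⟫ + s) = 0 := by
    have h1 : ⟪q, q⟫ = 1 := by simp [hq1]
    have h2 : ⟪z, z⟫ = 1 := by simp [hz1]
    rw [hqz] at h1
    simp only [inner_add_left, inner_add_right, inner_smul_left, inner_smul_right, hpp, h2,
      real_inner_comm z p, RCLike.conj_to_real] at h1
    linarith
  have hs1 : 0 < ⟪z, p⟫ + s := by
    have h1 := hqpos
    rw [hqz, inner_add_left, inner_smul_left, hpp] at h1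
    simpa using h1
  have hs : s = 0 := by
    rcases mul_eq_zero.1 hs0 with h | h
    · exact h
    · nlinarith
  rw [hqz, hs, zero_smul, add_zero]
  exact ⟨hzΓ, hνz⟩

/-- On the unit sphere of (ν p)ᗮ, the points of Γ with normal ν p form a closed set by compactness
of Γ and an open set by the local statement. That sphere is connected because (ν p)ᗮ has dimension n
- 1 ≥ 2. -/
lemma mem_of_orthogonal_normal (hΓ : IsClosedOrientedHypersurface Γ ν) (hn : 3 ≤ n)
    (hTG : IsTotallyGeodesicInSphere Γ ν) {p q : Pt n} (hp : p ∈ Γ) (hq : ‖q‖ = 1)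
    (hpq : ⟪ν p, q⟫ = 0) : q ∈ Γ ∧ ν q = ν p := by
  set a := ν p with ha
  have ha0 : a ≠ 0 := by
    intro h; have := hΓ.unit p hp; rw [← ha, h] at this; simp at this
  have hfact : Fact (Module.finrank ℝ (Pt n) = (n - 1) + 1) :=
    ⟨by rw [finrank_euclideanSpace, Fintype.card_fin]; omega⟩
  have hfr : Module.finrank ℝ (ℝ ∙ a)ᗮ = n - 1 := Submodule.finrank_orthogonal_span_singleton ha0
  have hrank : 1 < Module.rank ℝ (ℝ ∙ a)ᗮ := by
    rw [← Module.finrank_eq_rank, hfr]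
    have : 1 < n - 1 := by omega
    exact_mod_cast this
  have hpre := isPreconnected_sphere hrank (0 : (ℝ ∙ a)ᗮ) 1
  have : PreconnectedSpace (Metric.sphere (0 : (ℝ ∙ a)ᗮ) 1) := Subtype.preconnectedSpace hpre
  set val : Metric.sphere (0 : (ℝ ∙ a)ᗮ) 1 → Pt n := fun x => ((x : (ℝ ∙ a)ᗮ) : Pt n) with hval
  have hvc : Continuous val := continuous_subtype_val.comp continuous_subtype_val
  have hv1 : ∀ x, ‖val x‖ = 1 := fun x => by
    exact mem_sphere_zero_iff_norm.1 x.2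
  have hva : ∀ x, ⟪a, val x⟫ = 0 := fun x =>
    Submodule.mem_orthogonal_singleton_iff_inner_right.1 (x : (ℝ ∙ a)ᗮ).2
  set T : Set (Metric.sphere (0 : (ℝ ∙ a)ᗮ) 1) := {x | val x ∈ Γ ∧ ν (val x) = a}
  have hclosed : IsClosed T :=
    (hΓ.isCompact.isClosed.preimage hvc).inter
      (isClosed_eq (hΓ.smooth.continuous.comp hvc) continuous_const)
  have hopen : IsOpen T := by
    rw [isOpen_iff_mem_nhds]
    rintro x ⟨hx, hxa⟩
    have := hvc.continuousAt.eventually (hΓ.eventually_mem_of_orthogonal hTG hx)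
    filter_upwards [this] with z hz
    have := hz (hv1 z) (by rw [hxa]; exact hva z)
    exact ⟨this.1, this.2.trans hxa⟩
  have mk : ∀ z : Pt n, ‖z‖ = 1 → ⟪a, z⟫ = 0 → ∃ x, val x = z := fun z hz hz' =>
    ⟨⟨⟨z, Submodule.mem_orthogonal_singleton_iff_inner_right.2 hz'⟩, by simpa using hz⟩, rfl⟩
  obtain ⟨x0, hx0⟩ := mk p (hΓ.norm_eq_one hp)
    (by rw [real_inner_comm]; exact hΓ.tangent_sphere p hp)
  have huniv : T = Set.univ := IsClopen.eq_univ ⟨hclosed, hopen⟩ ⟨x0, by simp [T, hx0, hp, ha]⟩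
  obtain ⟨x, hx⟩ := mk q hq hpq
  have : x ∈ T := by rw [huniv]; trivial
  rw [← hx]
  exact this

/-- A totally geodesic closed hypersurface of the sphere is a great sphere. -/
lemma eq_great_sphere (hΓ : IsClosedOrientedHypersurface Γ ν) (hn : 3 ≤ n)
    (hTG : IsTotallyGeodesicInSphere Γ ν) :
    ∃ a : Pt n, ‖a‖ = 1 ∧ (∀ p ∈ Γ, ν p = a) ∧ ∀ q, q ∈ Γ ↔ ‖q‖ = 1 ∧ ⟪a, q⟫ = 0 := by
  obtain ⟨p, hp⟩ := hΓ.nonempty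
  have hall : ∀ p' ∈ Γ, ν p' = ν p := by
    intro p' hp'
    -- For n ≥ 3 some unit vector is orthogonal to both normals. It lies in Γ by either of them, and
    -- its own normal then equals both; connectedness of Γ is therefore not an assumption.
    have hle : Module.finrank ℝ (Submodule.span ℝ {ν p, ν p'}) < Module.finrank ℝ (Pt n) := by
      have h1 : Module.finrank ℝ (Submodule.span ℝ {ν p, ν p'}) ≤ 2 := by
        classical
        have := finrank_span_finset_le_card (R := ℝ) ({ν p, ν p'} : Finset (Pt n))
        simp only [Finset.coe_insert, Finset.coe_singleton] at this
        exact this.trans Finset.card_le_two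
      rw [finrank_euclideanSpace, Fintype.card_fin]; omega
    have hne : (Submodule.span ℝ {ν p, ν p'})ᗮ ≠ ⊥ := by
      intro h
      rw [Submodule.orthogonal_eq_bot_iff] at h
      rw [h, finrank_top] at hle
      exact lt_irrefl _ hle
    obtain ⟨q, hq, hq0⟩ := Submodule.exists_mem_ne_zero_of_ne_bot hne
    have hn0 : ‖q‖ ≠ 0 := norm_ne_zero_iff.2 hq0
    have hqu : ‖‖q‖⁻¹ • q‖ = 1 := by rw [norm_smul, norm_inv, norm_norm, inv_mul_cancel₀ hn0]
    have h1 : ⟪ν p, q⟫ = 0 :=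
      Submodule.inner_right_of_mem_orthogonal (Submodule.subset_span (by simp)) hq
    have h2 : ⟪ν p', q⟫ = 0 :=
      Submodule.inner_right_of_mem_orthogonal (Submodule.subset_span (by simp)) hq
    have e1 := hΓ.mem_of_orthogonal_normal hn hTG hp hqu (by rw [inner_smul_right, h1, mul_zero])
    have e2 := hΓ.mem_of_orthogonal_normal hn hTG hp' hqu (by rw [inner_smul_right, h2, mul_zero])
    exact e2.2.symm.trans e1.2
  refine ⟨ν p, hΓ.unit p hp, hall, fun q => ⟨fun hq => ⟨hΓ.norm_eq_one hq, ?_⟩, fun hq => ?_⟩⟩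
  · rw [← hall q hq, real_inner_comm]; exact hΓ.tangent_sphere q hq
  · exact (hΓ.mem_of_orthogonal_normal hn hTG hp hq.1 hq.2).1

/-- A closed hypersurface which is a great sphere is totally geodesic. -/
lemma totallyGeodesic_of_eq_great_sphere (hΓ : IsClosedOrientedHypersurface Γ ν) {b : Pt n}
    (hb : ‖b‖ = 1) (h : ∀ q, q ∈ Γ → ⟪b, q⟫ = 0) :
    IsTotallyGeodesicInSphere Γ ν := by
  have hbb : ⟪b, b⟫ = 1 := by simp [hb]
  -- b is orthogonal to q and to T_qΓ, so it is a multiple of ν q, and both have norm 1. The sign ±1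
  -- is carried as ⟪b, ν q⟫: only ⟪ν q, w⟫ = 0 for w orthogonal to b is needed, whatever the sign.
  have hνb : ∀ q ∈ Γ, ν q = ⟪b, ν q⟫ • b := by
    intro q hq
    have hbT : ∀ v ∈ linkTangent ν q, ⟪b, v⟫ = 0 := by
      intro v hv
      have := hΓ.fderiv_eq_of_eqOn (f := innerSL ℝ b) (g := fun _ => (0 : ℝ)) hq
        (by fun_prop) (by fun_prop) (fun x hx => h x hx) hv
      rw [ContinuousLinearMap.fderiv] at this
      simpa using this
    have hbspan : b ∈ Submodule.span ℝ {q, ν q} := by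
      rw [← Submodule.orthogonal_orthogonal (Submodule.span ℝ {q, ν q}), Submodule.mem_orthogonal']
      intro v hv
      exact hbT v (mem_linkTangentSubmodule.1 hv)
    obtain ⟨s, t, hst⟩ := Submodule.mem_span_pair.1 hbspan
    have hqν := hΓ.tangent_sphere q hq
    have hs : s = 0 := by
      have := h q hq
      rw [← hst, inner_add_left, inner_smul_left, inner_smul_left, real_inner_comm q (ν q), hqν] at this
      simpa [hΓ.norm_eq_one hq] using this
    have hst' : t • ν q = b := by rw [← hst, hs, zero_smul, zero_add]
    have ht : t * t = 1 := by
      have h1 := hbb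
      rw [← hst', inner_smul_left, inner_smul_right] at h1
      simpa [hΓ.unit q hq] using h1
    have hbν : ⟪b, ν q⟫ = t := by
      rw [← hst', inner_smul_left]; simp [hΓ.unit q hq]
    rw [hbν, ← hst', smul_smul, ht, one_smul]
  intro p hp v hv w hw
  have hbw : ⟪b, w⟫ = 0 := by
    have h1 := hw.2
    rw [hνb p hp, inner_smul_left] at h1
    rcases mul_eq_zero.1 h1 with h0 | h0
    · exfalso
      have := hΓ.unit p hp
      rw [hνb p hp] at this
      simp only [RCLike.conj_to_real] at h0
      rw [h0] at this
      simp at this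
    · exact h0
  have hd := (hΓ.differentiable_normal p).hasFDerivAt.inner ℝ (hasFDerivAt_const w p)
  have := hΓ.fderiv_eq_of_eqOn (f := fun x => ⟪ν x, w⟫) (g := fun _ => (0 : ℝ)) hp
      hd.differentiableAt (by fun_prop)
      (fun x hx => by simp only; rw [hνb x hx, inner_smul_left, hbw, mul_zero]) hv
  rw [hd.fderiv] at this
  rw [linkSecondForm, neg_eq_zero]
  simpa [fderivInnerCLM_apply] using this

end IsClosedOrientedHypersurface

/-! ### Rotations and the equatorial hyperplane -/

lemma det_reflection_orthogonal_singleton {n : ℕ} {v : Pt n} (hv : v ≠ 0) :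
    LinearMap.det ((ℝ ∙ v)ᗮ.reflection.toLinearEquiv : Pt n →ₗ[ℝ] Pt n) = -1 := by
  have h := (ℝ ∙ v)ᗮ.det_reflection
  rw [Submodule.orthogonal_orthogonal, finrank_span_singleton hv, pow_one] at h
  exact h

/-- One reflection interchanges a and e but has determinant -1; composing with a reflection in a
hyperplane through e corrects the determinant and fixes e. -/
lemma exists_rotation_apply_eq {n : ℕ} (hn : 2 ≤ n) {a e : Pt n} (ha : ‖a‖ = 1) (he : ‖e‖ = 1) :
    ∃ T : Pt n ≃ₗᵢ[ℝ] Pt n, LinearMap.det (T.toLinearEquiv : Pt n →ₗ[ℝ] Pt n) = 1 ∧ T a = e := by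
  by_cases hae : a = e
  · refine ⟨LinearIsometryEquiv.refl ℝ (Pt n), ?_, hae⟩
    exact LinearMap.det_id
  have he0 : e ≠ 0 := by intro h; simp [h] at he
  have hfact : Fact (Module.finrank ℝ (Pt n) = (n - 1) + 1) :=
    ⟨by rw [finrank_euclideanSpace, Fintype.card_fin]; omega⟩
  have hne : (ℝ ∙ e)ᗮ ≠ ⊥ := by
    intro h
    have hfr : Module.finrank ℝ (ℝ ∙ e)ᗮ = n - 1 := Submodule.finrank_orthogonal_span_singleton he0
    rw [h, finrank_bot] at hfr
    omega
  obtain ⟨f, hf, hf0⟩ := Submodule.exists_mem_ne_zero_of_ne_bot hne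
  refine ⟨(ℝ ∙ (a - e))ᗮ.reflection.trans (ℝ ∙ f)ᗮ.reflection, ?_, ?_⟩
  · have h1 := det_reflection_orthogonal_singleton (sub_ne_zero.2 hae)
    have h2 := det_reflection_orthogonal_singleton hf0
    have : ((((ℝ ∙ (a - e))ᗮ.reflection.trans (ℝ ∙ f)ᗮ.reflection).toLinearEquiv) :
        Pt n →ₗ[ℝ] Pt n) = ((ℝ ∙ f)ᗮ.reflection.toLinearEquiv : Pt n →ₗ[ℝ] Pt n) ∘ₗ
        ((ℝ ∙ (a - e))ᗮ.reflection.toLinearEquiv : Pt n →ₗ[ℝ] Pt n) := rfl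
    rw [this, LinearMap.det_comp, h1, h2]
    norm_num
  · rw [LinearIsometryEquiv.trans_apply, Submodule.reflection_sub (ha.trans he.symm)]
    apply Submodule.reflection_mem_subspace_eq_self
    rw [Submodule.mem_orthogonal_singleton_iff_inner_left]
    exact Submodule.mem_orthogonal_singleton_iff_inner_right.1 hf

lemma horizonRadius_pos (n : ℕ) {m : ℝ} (hm : 0 < m) : 0 < horizonRadius n m :=
  Real.rpow_pos_of_pos (by positivity) _

lemma smul_mem_truncatedCone {n : ℕ} {m : ℝ} {Γ : Set (Pt n)} {q : Pt n} {r : ℝ} (hr0 : 0 < r)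
    (hr : horizonRadius n m ≤ r) (hΓ : Γ ⊆ Metric.sphere 0 1) (hq : ‖q‖ = 1) :
    r • q ∈ truncatedCone n m Γ ↔ q ∈ Γ := by
  constructor
  · rintro ⟨⟨c, hc, y, hy, hyq⟩, -⟩
    have h1 := congrArg norm hyq
    rw [norm_smul, norm_smul, hq, mem_sphere_zero_iff_norm.1 (hΓ hy), Real.norm_of_nonneg hr0.le,
      Real.norm_of_nonneg hc.le, mul_one, mul_one] at h1
    rw [h1] at hyq
    rwa [smul_right_injective _ hc.ne' hyq]
  · intro h
    refine ⟨⟨r, hr0, q, h, rfl⟩, ?_⟩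
    simpa [norm_smul, hq, abs_of_pos hr0] using hr

lemma truncatedHyperplane_eq {n : ℕ} (hn : 0 < n) (m : ℝ) :
    truncatedHyperplane n m = {x | ⟪(EuclideanSpace.single ⟨n - 1, by omega⟩ 1 : Pt n), x⟫ = 0 ∧
      horizonRadius n m ≤ ‖x‖} := by
  ext x
  simp only [truncatedHyperplane, Set.mem_ofPred_eq, EuclideanSpace.inner_single_left]
  refine and_congr_left fun _ => ⟨fun h => ?_, fun h i hi => ?_⟩
  · simp [h ⟨n - 1, by omega⟩ (by simp; omega)]
  · have : i = ⟨n - 1, by omega⟩ := Fin.ext (by simp; omega)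
    rw [this]
    simpa using h

theorem totallyGeodesic_iff_exists_rotation {n : ℕ} (hn : 3 ≤ n) {m : ℝ} (hm : 0 < m)
    {Γ : Set (Pt n)} {ν : Pt n → Pt n} (hΓ : IsClosedOrientedHypersurface Γ ν) :
    IsTotallyGeodesicInSphere Γ ν ↔
      ∃ T : Pt n ≃ₗᵢ[ℝ] Pt n, LinearMap.det (T.toLinearEquiv : Pt n →ₗ[ℝ] Pt n) = 1 ∧
        T '' truncatedCone n m Γ = truncatedHyperplane n m := by
  have hR := horizonRadius_pos n hm
  rw [truncatedHyperplane_eq (by omega)]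
  set e : Pt n := EuclideanSpace.single ⟨n - 1, by omega⟩ 1 with he
  have he1 : ‖e‖ = 1 := by simp [he]
  constructor
  · intro hTG
    obtain ⟨a, ha, -, hmem⟩ := hΓ.eq_great_sphere hn hTG
    obtain ⟨T, hT, hTa⟩ := exists_rotation_apply_eq (by omega) ha he1
    refine ⟨T, hT, ?_⟩
    have key : ∀ x : Pt n, x ∈ truncatedCone n m Γ ↔ ⟪a, x⟫ = 0 ∧ horizonRadius n m ≤ ‖x‖ := by
      intro x
      constructor
      · rintro ⟨⟨c, hc, y, hy, rfl⟩, h⟩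
        refine ⟨?_, h⟩
        rw [inner_smul_right, ((hmem y).1 hy).2, mul_zero]
      · rintro ⟨h1, h2⟩
        have hx : 0 < ‖x‖ := hR.trans_le h2
        have hx1 : ‖‖x‖⁻¹ • x‖ = 1 := by
          rw [norm_smul, norm_inv, norm_norm, inv_mul_cancel₀ hx.ne']
        have := (smul_mem_truncatedCone hx h2 hΓ.subset_sphere hx1).2
          ((hmem _).2 ⟨hx1, by rw [inner_smul_right, h1, mul_zero]⟩)
        rwa [smul_smul, mul_inv_cancel₀ hx.ne', one_smul] at this
    ext z
    rw [LinearIsometryEquiv.image_eq_preimage_symm, Set.mem_preimage, key, Set.mem_ofPred_eq,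
      LinearIsometryEquiv.norm_map, ← hTa, ← LinearIsometryEquiv.inner_map_map T a,
      LinearIsometryEquiv.apply_symm_apply]
  · rintro ⟨T, -, hT⟩
    refine hΓ.totallyGeodesic_of_eq_great_sphere (b := T.symm e) (by simp [he1]) ?_
    intro q hq
    -- The cross-section of the cone at the horizon radius already determines Γ.
    have h1 := (smul_mem_truncatedCone hR le_rfl hΓ.subset_sphere (hΓ.norm_eq_one hq)).2 hq
    have h2 := Set.mem_image_of_mem T h1
    rw [hT] at h2
    have h3 := h2.1
    rw [map_smul, inner_smul_right] at h3
    have h4 := (mul_eq_zero.1 h3).resolve_left hR.ne'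
    rw [← LinearIsometryEquiv.inner_map_map T]
    simpa using h4

/-! ### The Schwarzschild metric in coordinates -/

section Radial

variable {n : ℕ}

lemma hasFDerivAt_comp_norm {g : ℝ → ℝ} {g' : ℝ} {x : Pt n} (hx : x ≠ 0)
    (hg : HasDerivAt g g' ‖x‖) :
    HasFDerivAt (fun y : Pt n => g ‖y‖) ((g' / ‖x‖) • innerSL ℝ x) x := by
  have hn : ‖x‖ ≠ 0 := norm_ne_zero_iff.2 hx
  have h1 : HasFDerivAt (fun y : Pt n => ‖y‖ ^ 2) (2 • innerSL ℝ x) x :=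
    (hasStrictFDerivAt_norm_sq x).hasFDerivAt
  have h2 : HasFDerivAt (fun y : Pt n => ‖y‖) (‖x‖⁻¹ • innerSL ℝ x) x := by
    have h3 := h1.sqrt (by positivity)
    have e : (fun y : Pt n => √(‖y‖ ^ 2)) = fun y => ‖y‖ := by
      funext y; exact Real.sqrt_sq (norm_nonneg y)
    rw [e, Real.sqrt_sq (norm_nonneg x)] at h3
    refine h3.congr_fderiv ?_
    ext v
    simp
    field_simp
  refine (hg.comp_hasFDerivAt x h2).congr_fderiv ?_
  rw [smul_smul, div_eq_mul_inv]

/-- The coefficient `a` in `∇ (log φ) = a x`. -/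
def logConfCoeff (n : ℕ) (m : ℝ) (x : Pt n) : ℝ := -m / (‖x‖ ^ n + m / 2 * ‖x‖ ^ 2)

/-- The coefficient `b` in `∇ a = b x`. -/
def logConfCoeff' (n : ℕ) (m : ℝ) (x : Pt n) : ℝ :=
  m * (n * ‖x‖ ^ (n - 2) + m) / (‖x‖ ^ n + m / 2 * ‖x‖ ^ 2) ^ 2

variable {m : ℝ} {x : Pt n}

lemma confFactor_base_pos (hm : 0 < m) (x : Pt n) : 0 < 1 + m / (2 * ‖x‖ ^ (n - 2)) := by
  positivity

lemma confFactor_pos (hm : 0 < m) (x : Pt n) : 0 < confFactor n m x :=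
  Real.rpow_pos_of_pos (confFactor_base_pos hm x) _

lemma schwarzschild_eq (hm : 0 < m) (x : Pt n) :
    schwarzschild n m x = confFactor n m x ^ 2 • (1 : Matrix (Fin n) (Fin n) ℝ) := by
  rw [schwarzschild, confFactor, ← Real.rpow_mul_natCast (confFactor_base_pos hm x).le]
  congr 2
  push_cast
  ring

lemma hasFDerivAt_confFactor (hn : 3 ≤ n) (hm : 0 < m) (hx : x ≠ 0) :
    HasFDerivAt (confFactor n m) ((confFactor n m x * logConfCoeff n m x) • innerSL ℝ x) x := by
  obtain ⟨k, rfl⟩ : ∃ k, n = k + 3 := ⟨n - 3, by omega⟩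
  have hr : 0 < ‖x‖ := norm_pos_iff.2 hx
  have hb := confFactor_base_pos (n := k + 3) hm x
  have e : k + 3 - 2 = k + 1 := by omega
  have h1 : HasDerivAt (fun r : ℝ => 1 + m / (2 * r ^ (k + 3 - 2)))
      (-(m * (2 * ((k + 1 : ℕ) * ‖x‖ ^ k))) / (2 * ‖x‖ ^ (k + 1)) ^ 2) ‖x‖ := by
    rw [e]
    have h := ((hasDerivAt_const ‖x‖ m).div ((hasDerivAt_pow (k + 1) ‖x‖).const_mul 2)
      (by positivity)).const_add 1
    refine h.congr_deriv ?_
    simp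
  have h2 := h1.rpow_const (p := 2 / (((k + 3 : ℕ) : ℝ) - 2)) (Or.inl hb.ne')
  refine (hasFDerivAt_comp_norm hx h2).congr_fderiv ?_
  congr 1
  rw [Real.rpow_sub_one hb.ne', logConfCoeff, confFactor]
  have hk : (k : ℝ) + 3 - 2 ≠ 0 := by have : (0 : ℝ) ≤ k := k.cast_nonneg; linarith
  have hb' : 1 + m / (2 * ‖x‖ ^ (k + 1)) ≠ 0 := by rw [e] at hb; exact hb.ne'
  have hd : ‖x‖ ^ (k + 3) + m / 2 * ‖x‖ ^ 2 ≠ 0 := by positivity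
  rw [e]
  generalize (1 + m / (2 * ‖x‖ ^ (k + 1))) ^ (2 / (((k + 3 : ℕ) : ℝ) - 2)) = P
  have hb'' : 1 + m / (2 * ‖x‖ ^ (k + 1)) =
      (‖x‖ ^ (k + 3) + m / 2 * ‖x‖ ^ 2) / ‖x‖ ^ (k + 3) := by
    field_simp
    ring
  rw [hb'']
  push_cast
  have hk' : (k : ℝ) + 1 ≠ 0 := by positivity
  have : (k : ℝ) + 3 - 2 = k + 1 := by ring
  rw [this]
  field_simp
  ring

lemma hasFDerivAt_logConfCoeff (hn : 3 ≤ n) (hm : 0 < m) (hx : x ≠ 0) :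
    HasFDerivAt (logConfCoeff n m) (logConfCoeff' n m x • innerSL ℝ x) x := by
  obtain ⟨k, rfl⟩ : ∃ k, n = k + 3 := ⟨n - 3, by omega⟩
  have hr : 0 < ‖x‖ := norm_pos_iff.2 hx
  have hd : ‖x‖ ^ (k + 3) + m / 2 * ‖x‖ ^ 2 ≠ 0 := by positivity
  have h1 := (hasDerivAt_const ‖x‖ (-m)).div ((hasDerivAt_pow (k + 3) ‖x‖).add
    ((hasDerivAt_pow 2 ‖x‖).const_mul (m / 2))) hd
  refine (hasFDerivAt_comp_norm hx h1).congr_fderiv ?_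
  congr 1
  rw [logConfCoeff']
  simp only [Pi.add_apply]
  have e : k + 3 - 2 = k + 1 := by omega
  rw [e]
  push_cast
  field_simp
  simp
  ring

lemma partialD_eq_of_hasFDerivAt {f : Pt n → ℝ} {c : ℝ} (i : Fin n)
    (h : HasFDerivAt f (c • innerSL ℝ x) x) : partialD i f x = c * x i := by
  rw [partialD, h.fderiv]
  simp [EuclideanSpace.inner_single_right]

/-- Kronecker delta. -/
def kron (i j : Fin n) : ℝ := if i = j then 1 else 0

lemma kron_comm (i j : Fin n) : kron i j = kron j i := by simp [kron, eq_comm]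

lemma kron_self (i : Fin n) : kron i i = 1 := by simp [kron]

lemma sum_kron_mul (i : Fin n) (f : Fin n → ℝ) : ∑ k, kron i k * f k = f i := by simp [kron]

lemma matrix_one_apply_eq_kron (i j : Fin n) : (1 : Matrix (Fin n) (Fin n) ℝ) i j = kron i j := by
  simp [kron, Matrix.one_apply]

lemma single_apply_eq_kron (i j : Fin n) : (EuclideanSpace.single i (1 : ℝ) : Pt n) j = kron i j := by
  simp [kron, eq_comm]

lemma partialD_mul {f g : Pt n → ℝ} (i : Fin n) (hf : DifferentiableAt ℝ f x)
    (hg : DifferentiableAt ℝ g x) :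
    partialD i (fun y => f y * g y) x = partialD i f x * g x + f x * partialD i g x := by
  have h : (fun y => f y * g y) = f * g := rfl
  rw [partialD, h, fderiv_mul hf hg]
  simp [partialD]
  ring

/-- For a conformal metric φ²δ only ∂ log φ enters, and here ∂_i log φ = a x_i. -/
lemma christoffel_schwarzschild (hn : 3 ≤ n) (hm : 0 < m) (hx : x ≠ 0) (k i j : Fin n) :
    christoffel (schwarzschild n m) k i j x =
      logConfCoeff n m x * (x i * kron j k + x j * kron i k - x k * kron i j) := by
  have hφ := confFactor_pos (n := n) hm x
  have hd := hasFDerivAt_confFactor hn hm hx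
  have hinv : (schwarzschild n m x)⁻¹ = (confFactor n m x ^ 2)⁻¹ • (1 : Matrix (Fin n) (Fin n) ℝ) := by
    apply Matrix.inv_eq_right_inv
    rw [schwarzschild_eq hm, smul_mul_smul_comm, mul_one, mul_inv_cancel₀ (by positivity), one_smul]
  have hp : ∀ p q r : Fin n, partialD p (fun y => schwarzschild n m y q r) x =
      2 * confFactor n m x ^ 2 * logConfCoeff n m x * x p * kron q r := by
    intro p q r
    have : (fun y => schwarzschild n m y q r) = fun y => confFactor n m y ^ 2 * kron q r := by
      funext y; rw [schwarzschild_eq hm]; simp [matrix_one_apply_eq_kron]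
    rw [this]
    have h2 := ((hd.pow 2).mul_const (kron q r))
    rw [partialD, h2.fderiv]
    simp [EuclideanSpace.inner_single_right]
    ring
  rw [christoffel, hinv]
  simp only [hp, Matrix.smul_apply, smul_eq_mul, matrix_one_apply_eq_kron]
  have : ∀ l : Fin n, (confFactor n m x ^ 2)⁻¹ * kron k l *
      (2 * confFactor n m x ^ 2 * logConfCoeff n m x * x i * kron j l +
        2 * confFactor n m x ^ 2 * logConfCoeff n m x * x j * kron i l -
        2 * confFactor n m x ^ 2 * logConfCoeff n m x * x l * kron i j) =
      kron k l * (2 * logConfCoeff n m x * (x i * kron j l + x j * kron i l - x l * kron i j)) := by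
    intro l; field_simp
  simp only [this, sum_kron_mul]
  simp only [kron_comm _ k]
  ring

lemma partialD_christoffel (hn : 3 ≤ n) (hm : 0 < m) (hx : x ≠ 0) (p k i j : Fin n) :
    partialD p (christoffel (schwarzschild n m) k i j) x =
      logConfCoeff' n m x * x p * (x i * kron j k + x j * kron i k - x k * kron i j) +
      logConfCoeff n m x * (kron p i * kron j k + kron p j * kron i k - kron p k * kron i j) := by
  have hev : christoffel (schwarzschild n m) k i j =ᶠ[𝓝 x] fun y =>
      logConfCoeff n m y * (y i * kron j k + y j * kron i k - y k * kron i j) := by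
    filter_upwards [isOpen_ne.mem_nhds hx] with y hy
    exact christoffel_schwarzschild hn hm hy k i j
  have hc : ∀ q : Fin n, HasFDerivAt (fun y : Pt n => y q)
    (EuclideanSpace.proj q : Pt n →L[ℝ] ℝ) x := fun q =>
    (EuclideanSpace.proj q : Pt n →L[ℝ] ℝ).hasFDerivAt
  have h := (hasFDerivAt_logConfCoeff hn hm hx).mul ((((hc i).mul_const (kron j k)).add
    ((hc j).mul_const (kron i k))).sub ((hc k).mul_const (kron i j)))
  have h' : HasFDerivAt (fun y : Pt n =>
      logConfCoeff n m y * (y i * kron j k + y j * kron i k - y k * kron i j)) _ x := h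
  rw [partialD, hev.fderiv_eq, h'.fderiv]
  simp [-PiLp.single_apply, -PiLp.ofLp_single, EuclideanSpace.inner_single_right, single_apply_eq_kron]
  ring

/-- This is the conformal formula Ric = -(n-2)(∇²f - df ⊗ df) - (Δf + (n-2)|df|²) δ for f = log φ,
whose Euclidean Hessian is a δ + b x ⊗ x. -/
lemma ricci_schwarzschild (hn : 3 ≤ n) (hm : 0 < m) (hx : x ≠ 0) (i j : Fin n) :
    ricci (schwarzschild n m) x i j =
      (2 - n) * (logConfCoeff n m x * kron i j + logConfCoeff' n m x * x i * x j)
      - kron i j * (n * logConfCoeff n m x + logConfCoeff' n m x * ‖x‖ ^ 2)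
      + (n - 2) * logConfCoeff n m x ^ 2 * x i * x j
      - (n - 2) * logConfCoeff n m x ^ 2 * ‖x‖ ^ 2 * kron i j := by
  have hsq : ‖x‖ ^ 2 = ∑ k, x k * x k := by
    rw [EuclideanSpace.norm_sq_eq]; simp [sq]
  set a := logConfCoeff n m x with ha
  set b := logConfCoeff' n m x with hb
  have hK : ∀ k i j, christoffel (schwarzschild n m) k i j x =
      a * (x i * kron j k + x j * kron i k - x k * kron i j) :=
    fun k i j => christoffel_schwarzschild hn hm hx k i j
  have h1 : ∑ k, partialD k (christoffel (schwarzschild n m) k i j) x =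
      2 * (a * kron i j + b * x i * x j) - kron i j * (n * a + b * ‖x‖ ^ 2) := by
    have : ∀ k, partialD k (christoffel (schwarzschild n m) k i j) x =
        kron j k * (b * x i * x k + a * kron i k) + kron i k * (b * x j * x k + a * kron j k)
          - b * kron i j * (x k * x k) - a * kron i j := by
      intro k
      rw [partialD_christoffel hn hm hx, kron_self, kron_comm k i, kron_comm k j]
      ring
    simp only [this, Finset.sum_add_distrib, Finset.sum_sub_distrib, sum_kron_mul,
      ← Finset.mul_sum, ← hsq, kron_comm j i]
    simp
    ring
  have h2 : ∑ k, partialD j (christoffel (schwarzschild n m) k i k) x =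
      n * (a * kron i j + b * x i * x j) := by
    have : ∀ k, partialD j (christoffel (schwarzschild n m) k i k) x =
        a * kron i j + b * x i * x j := by
      intro k
      rw [partialD_christoffel hn hm hx, kron_self, kron_comm j i]
      ring
    simp [this]
    ring
  have h3 : ∑ k, ∑ l, christoffel (schwarzschild n m) k k l x *
      christoffel (schwarzschild n m) l i j x =
      n * (a ^ 2 * (2 * x i * x j - kron i j * ‖x‖ ^ 2)) := by
    have : ∀ k l, christoffel (schwarzschild n m) k k l x *
        christoffel (schwarzschild n m) l i j x =
        kron j l * (a ^ 2 * x i * x l) + kron i l * (a ^ 2 * x j * x l)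
          - a ^ 2 * kron i j * (x l * x l) := by
      intro k l
      rw [hK, hK, kron_self, kron_comm l k]
      ring
    simp only [this, Finset.sum_add_distrib, Finset.sum_sub_distrib, sum_kron_mul,
      ← Finset.mul_sum, ← hsq]
    simp
    ring
  have h4 : ∑ k, ∑ l, christoffel (schwarzschild n m) k j l x *
      christoffel (schwarzschild n m) l i k x =
      a ^ 2 * ((n + 2) * x i * x j - 2 * kron i j * ‖x‖ ^ 2) := by
    have : ∀ k l, christoffel (schwarzschild n m) k j l x *
        christoffel (schwarzschild n m) l i k x =
        kron k l * (a ^ 2 * x j * (x i * kron k l + x k * kron i l - x l * kron i k))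
        + kron k l * (a ^ 2 * kron j k * x l * x i) + kron i l * (a ^ 2 * kron j k * x l * x k)
        - a ^ 2 * kron j k * kron i k * (x l * x l)
        - kron j l * (a ^ 2 * x k * (x i * kron k l + x k * kron i l - x l * kron i k)) := by
      intro k l
      rw [hK, hK, kron_comm l k]
      ring
    simp only [this, Finset.sum_add_distrib, Finset.sum_sub_distrib, sum_kron_mul,
      ← Finset.mul_sum, ← hsq, kron_self]
    have h6 : ∀ k, a ^ 2 * x k * (x i * kron k j + x k * kron i j - x j * kron i k)
        = kron j k * (a ^ 2 * x k * x i) + a ^ 2 * kron i j * (x k * x k)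
          - kron i k * (a ^ 2 * x k * x j) := by
      intro k; rw [kron_comm k j]; ring
    have h8 : ∀ k, a ^ 2 * kron j k * x k * x i = kron j k * (a ^ 2 * x k * x i) := by
      intro k; ring
    have h9 : ∀ k, a ^ 2 * kron j k * x i * x k = kron j k * (a ^ 2 * x i * x k) := by
      intro k; ring
    have h10 : ∀ k, a ^ 2 * kron j k * kron i k * ‖x‖ ^ 2
        = kron j k * (a ^ 2 * ‖x‖ ^ 2 * kron i k) := by
      intro k; ring
    simp only [h6, h8, h9, h10, Finset.sum_add_distrib,
      Finset.sum_sub_distrib, sum_kron_mul, ← Finset.mul_sum, ← hsq]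
    simp
    ring
  rw [ricci, h1, h2, h3, h4]
  ring

lemma covDeriv_schwarzschild (hn : 3 ≤ n) (hm : 0 < m) (hx : x ≠ 0) (X : Pt n → Pt n)
    (k i : Fin n) : covDeriv (schwarzschild n m) X x k i = partialD i (fun y => X y k) x +
      logConfCoeff n m x * (x i * X x k + kron i k * ⟪x, X x⟫ - x k * X x i) := by
  have : ∀ j, christoffel (schwarzschild n m) k i j x * X x j =
      kron k j * (logConfCoeff n m x * x i * X x j)
        + logConfCoeff n m x * kron i k * (X x j * x j)
        - kron i j * (logConfCoeff n m x * x k * X x j) := by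
    intro j
    rw [christoffel_schwarzschild hn hm hx, kron_comm j k]
    ring
  have hin : ⟪x, X x⟫ = ∑ j, X x j * x j := by
    rw [PiLp.inner_apply]; simp
  simp only [covDeriv, this, Finset.sum_add_distrib, Finset.sum_sub_distrib, sum_kron_mul,
    ← Finset.mul_sum, hin]
  ring

lemma fderiv_apply_eq_sum (f : Pt n → ℝ) (x v : Pt n) :
    fderiv ℝ f x v = ∑ i, v i * partialD i f x := by
  have hv : v = ∑ i, v i • (EuclideanSpace.single i (1 : ℝ) : Pt n) := by
    ext j
    simp [Pi.single_apply]
  conv_lhs => rw [hv]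
  simp [partialD]

/-- The `i`-th component `∂_i f - N_i ∂_N f` of the tangential gradient of `f`. -/
def tangD (N : Pt n → Pt n) (i : Fin n) (f : Pt n → ℝ) (x : Pt n) : ℝ :=
  fderiv ℝ f x (EuclideanSpace.single i 1 - N x i • N x)

lemma tangD_eq (N : Pt n → Pt n) (i : Fin n) (f : Pt n → ℝ) (x : Pt n) :
    tangD N i f x = partialD i f x - N x i * fderiv ℝ f x (N x) := by
  simp [tangD, partialD]

lemma tangD_of_hasFDerivAt {N : Pt n → Pt n} {f : Pt n → ℝ} {c : ℝ} (i : Fin n)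
    (h : HasFDerivAt f (c • innerSL ℝ x) x) (hxN : ⟪x, N x⟫ = 0) : tangD N i f x = c * x i := by
  rw [tangD_eq, partialD_eq_of_hasFDerivAt i h, h.fderiv]
  simp [hxN]

lemma sum_mul_tangD (N : Pt n → Pt n) (f : Pt n → ℝ) (v : Pt n) (hxN : ⟪v, N x⟫ = 0) :
    ∑ i, v i * tangD N i f x = fderiv ℝ f x v := by
  have : ⟪v, N x⟫ = ∑ i, v i * N x i := by
    rw [PiLp.inner_apply]; simp [mul_comm]
  rw [this] at hxN
  simp only [tangD_eq, mul_sub, Finset.sum_sub_distrib, ← mul_assoc, ← Finset.sum_mul, hxN]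
  rw [fderiv_apply_eq_sum f x v]
  ring

lemma tangD_mul {N : Pt n → Pt n} {f g : Pt n → ℝ} (i : Fin n) (hf : DifferentiableAt ℝ f x)
    (hg : DifferentiableAt ℝ g x) :
    tangD N i (fun y => f y * g y) x = tangD N i f x * g x + f x * tangD N i g x := by
  have h : (fun y => f y * g y) = f * g := rfl
  rw [tangD, h, fderiv_mul hf hg]
  simp [tangD]
  ring

/-- The vector field `φ⁻¹ N`. -/
def confNormal (n : ℕ) (m : ℝ) (N : Pt n → Pt n) (x : Pt n) : Pt n := (confFactor n m x)⁻¹ • N x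

variable {N : Pt n → Pt n}

lemma tangentProj_confNormal (hm : 0 < m) (k i : Fin n) :
    tangentProj (schwarzschild n m) (confNormal n m N) x k i = kron k i - N x k * N x i := by
  have hφ := confFactor_pos (n := n) hm x
  have : ∀ j, schwarzschild n m x i j * confNormal n m N x j =
      kron i j * (confFactor n m x * N x j) := by
    intro j
    rw [schwarzschild_eq hm, confNormal]
    simp [matrix_one_apply_eq_kron]
    field_simp
  simp only [tangentProj, this, sum_kron_mul]
  simp only [confNormal, kron, PiLp.smul_apply, smul_eq_mul]
  field_simp

lemma tangentGrad_confNormal (hm : 0 < m) (u : Pt n → ℝ) (k : Fin n) :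
    tangentGrad (schwarzschild n m) (confNormal n m N) u x k =
      (confFactor n m x ^ 2)⁻¹ * tangD N k u x := by
  have hφ := confFactor_pos (n := n) hm x
  have hinv : (schwarzschild n m x)⁻¹ = (confFactor n m x ^ 2)⁻¹ • (1 : Matrix (Fin n) (Fin n) ℝ) := by
    apply Matrix.inv_eq_right_inv
    rw [schwarzschild_eq hm, smul_mul_smul_comm, mul_one, mul_inv_cancel₀ (by positivity), one_smul]
  have : ∀ l, (confFactor n m x ^ 2)⁻¹ * kron k l * partialD l u x =
      kron k l * ((confFactor n m x ^ 2)⁻¹ * partialD l u x) := by intro l; ring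
  simp only [tangentGrad, gradG, hinv, Matrix.smul_apply, smul_eq_mul, matrix_one_apply_eq_kron,
    PiLp.sub_apply, this, sum_kron_mul, tangD_eq, confNormal, PiLp.smul_apply, map_smul]
  field_simp

/-- The Laplacian of the hypersurface in terms of the Euclidean tangential derivatives. -/
lemma surfaceLaplacian_schwarzschild (hn : 3 ≤ n) (hm : 0 < m) (hx : x ≠ 0) (hN : ‖N x‖ = 1)
    (hxN : ⟪x, N x⟫ = 0) {u : Pt n → ℝ} (hu : ∀ i, DifferentiableAt ℝ (tangD N i u) x) :
    surfaceLaplacian (schwarzschild n m) (confNormal n m N) u x =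
      (confFactor n m x ^ 2)⁻¹ * (∑ i, tangD N i (tangD N i u) x +
        (n - 3) * logConfCoeff n m x * fderiv ℝ u x x) := by
  have hφ := confFactor_pos (n := n) hm x
  have hNN : ∑ k, N x k * N x k = 1 := by
    have : ‖N x‖ ^ 2 = ∑ k, N x k * N x k := by rw [EuclideanSpace.norm_sq_eq]; simp [sq]
    rw [← this, hN, one_pow]
  have hXN : ∑ k, x k * N x k = 0 := by
    rw [← hxN, PiLp.inner_apply]; simp [mul_comm]
  set X : Pt n → Pt n := tangentGrad (schwarzschild n m) (confNormal n m N) u with hX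
  have hXk : ∀ k, (fun y => X y k) = fun y => (confFactor n m y ^ 2)⁻¹ * tangD N k u y := by
    intro k; funext y; exact tangentGrad_confNormal hm u k
  have hψ : HasFDerivAt (fun y => (confFactor n m y ^ 2)⁻¹)
      ((-2 * (confFactor n m x ^ 2)⁻¹ * logConfCoeff n m x) • innerSL ℝ x) x := by
    have h := (hasDerivAt_inv (by positivity)).comp_hasFDerivAt x
      ((hasFDerivAt_confFactor hn hm hx).pow 2)
    refine h.congr_fderiv ?_
    ext v
    simp
    field_simp
  have hXin : ⟪x, X x⟫ = (confFactor n m x ^ 2)⁻¹ * fderiv ℝ u x x := by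
    rw [PiLp.inner_apply, ← sum_mul_tangD N u x hxN, Finset.mul_sum]
    refine Finset.sum_congr rfl fun k _ => ?_
    rw [show X x k = _ from congrFun (hXk k) x]
    simp
    ring
  have hXtd : ∀ k, tangD N k (fun y => X y k) x = (confFactor n m x ^ 2)⁻¹ *
      tangD N k (tangD N k u) x
      - 2 * (confFactor n m x ^ 2)⁻¹ * logConfCoeff n m x * (x k * tangD N k u x) := by
    intro k
    rw [hXk, tangD_mul k hψ.differentiableAt (hu k), tangD_of_hasFDerivAt k hψ hxN]
    ring
  rw [surfaceLaplacian, ← hX, Matrix.trace]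
  simp only [Matrix.diag_apply, Matrix.mul_apply, tangentProj_confNormal hm,
    covDeriv_schwarzschild hn hm hx]
  -- The terms are grouped so that a Kronecker contraction, Σ x_k N_k = 0 or Σ N_k N_k = 1 applies
  -- to each; the last group is antisymmetric and vanishes on the diagonal.
  have hterm : ∀ k i, (kron k i - N x k * N x i) * (partialD k (fun y => X y i) x +
      logConfCoeff n m x * (x k * X x i + kron k i * ⟪x, X x⟫ - x i * X x k)) =
      kron k i * partialD k (fun y => X y i) x - N x i * (N x k * partialD k (fun y => X y i) x)
      + logConfCoeff n m x * ⟪x, X x⟫ * (kron k i * (kron k i - N x k * N x i))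
      - logConfCoeff n m x * (x k * N x k) * (N x i * X x i)
      + logConfCoeff n m x * (N x k * X x k) * (x i * N x i)
      + kron k i * (logConfCoeff n m x * (x k * X x i - x i * X x k)) := by
    intro k i; ring
  simp only [hterm, Finset.sum_add_distrib, Finset.sum_sub_distrib, sum_kron_mul, ← Finset.mul_sum,
    ← Finset.sum_mul, hXN, kron_self]
  rw [Finset.sum_comm (f := fun k i => N x i * (N x k * partialD k (fun y => X y i) x))]
  simp only [← Finset.mul_sum, ← fderiv_apply_eq_sum, hNN, Finset.sum_const, Finset.card_univ]
  have h1 : ∑ i, partialD i (fun y => X y i) x - ∑ i, N x i * fderiv ℝ (fun y => X y i) x (N x) =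
      (confFactor n m x ^ 2)⁻¹ * ∑ i, tangD N i (tangD N i u) x
      - 2 * (confFactor n m x ^ 2)⁻¹ * logConfCoeff n m x * fderiv ℝ u x x := by
    rw [← Finset.sum_sub_distrib, ← sum_mul_tangD N u x hxN, Finset.mul_sum, Finset.mul_sum,
      ← Finset.sum_sub_distrib]
    refine Finset.sum_congr rfl fun k _ => ?_
    rw [← hXtd, tangD_eq]
  rw [h1, hXin]
  simp
  ring

/-- The squared norm of the second fundamental form in terms of the Euclidean one. -/
lemma normSqSecondForm_schwarzschild (hn : 3 ≤ n) (hm : 0 < m) (hx : x ≠ 0)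
    (hxN : ⟪x, N x⟫ = 0) (hNd : ∀ k, DifferentiableAt ℝ (fun y => N y k) x)
    (hN : ‖N x‖ = 1) (hNB : ∀ i, ∑ k, N x k * tangD N i (fun y => N y k) x = 0) :
    normSqSecondForm (schwarzschild n m) (confNormal n m N) x =
      (confFactor n m x ^ 2)⁻¹ * ∑ i, ∑ k, tangD N i (fun y => N y k) x *
        tangD N k (fun y => N y i) x := by
  have hφ := confFactor_pos (n := n) hm x
  have hNN : ∑ k, N x k * N x k = 1 := by
    have : ‖N x‖ ^ 2 = ∑ k, N x k * N x k := by rw [EuclideanSpace.norm_sq_eq]; simp [sq]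
    rw [← this, hN, one_pow]
  set a := logConfCoeff n m x
  have hψ : HasFDerivAt (fun y => (confFactor n m y)⁻¹)
      ((-(confFactor n m x)⁻¹ * a) • innerSL ℝ x) x := by
    have h := (hasDerivAt_inv hφ.ne').comp_hasFDerivAt x (hasFDerivAt_confFactor hn hm hx)
    refine h.congr_fderiv ?_
    ext v
    simp
    field_simp
    ring
  have hcov : ∀ k i, covDeriv (schwarzschild n m) (confNormal n m N) x k i =
      (confFactor n m x)⁻¹ * (partialD i (fun y => N y k) x - a * x k * N x i) := by
    intro k i
    rw [covDeriv_schwarzschild hn hm hx]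
    have h1 : (fun y => confNormal n m N y k) = fun y => (confFactor n m y)⁻¹ * N y k := by
      funext y; simp [confNormal]
    have h2 : ⟪x, confNormal n m N x⟫ = 0 := by rw [confNormal, inner_smul_right, hxN, mul_zero]
    rw [h1, partialD_mul i hψ.differentiableAt (hNd k), partialD_eq_of_hasFDerivAt i hψ, h2]
    simp only [confNormal, PiLp.smul_apply, smul_eq_mul]
    ring
  have hMP : ∀ k l, (covDeriv (schwarzschild n m) (confNormal n m N) x *
      tangentProj (schwarzschild n m) (confNormal n m N) x) k l =
      (confFactor n m x)⁻¹ * tangD N l (fun y => N y k) x := by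
    intro k l
    simp only [Matrix.mul_apply, hcov, tangentProj_confNormal hm]
    have : ∀ i, (confFactor n m x)⁻¹ * (partialD i (fun y => N y k) x - a * x k * N x i) *
        (kron i l - N x i * N x l) =
        kron l i * ((confFactor n m x)⁻¹ * (partialD i (fun y => N y k) x - a * x k * N x i))
        - (confFactor n m x)⁻¹ * N x l * (N x i * partialD i (fun y => N y k) x)
        + (confFactor n m x)⁻¹ * N x l * a * x k * (N x i * N x i) := by
      intro i; rw [kron_comm i l]; ring
    simp only [this, Finset.sum_add_distrib, Finset.sum_sub_distrib, sum_kron_mul,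
      ← Finset.mul_sum, hNN, ← fderiv_apply_eq_sum, tangD_eq]
    ring
  have hS : ∀ k l, shapeOp (schwarzschild n m) (confNormal n m N) x k l =
      -((confFactor n m x)⁻¹ * tangD N l (fun y => N y k) x) := by
    intro k l
    rw [shapeOp, mul_assoc, Matrix.neg_apply, Matrix.mul_apply]
    simp only [hMP, tangentProj_confNormal hm]
    have : ∀ i, (kron k i - N x k * N x i) * ((confFactor n m x)⁻¹ * tangD N l (fun y => N y i) x)
        = kron k i * ((confFactor n m x)⁻¹ * tangD N l (fun y => N y i) x)
        - N x k * (confFactor n m x)⁻¹ * (N x i * tangD N l (fun y => N y i) x) := by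
      intro i; ring
    simp only [this, Finset.sum_sub_distrib, sum_kron_mul, ← Finset.mul_sum, hNB]
    ring
  rw [normSqSecondForm, Matrix.trace]
  simp only [Matrix.diag_apply, Matrix.mul_apply, hS, Finset.mul_sum]
  refine Finset.sum_congr rfl fun i _ => Finset.sum_congr rfl fun k _ => ?_
  field_simp

/-- `φ² |x|² Ric(ξ, ξ)` for unit vectors `ξ` orthogonal to `x`. -/
lemma ricci_confNormal (hn : 3 ≤ n) (hm : 0 < m) (hx : x ≠ 0) (hxN : ⟪x, N x⟫ = 0)
    (hN : ‖N x‖ = 1) :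
    metricInner (ricci (schwarzschild n m)) x (confNormal n m N x) (confNormal n m N x) =
      -(confFactor n m x ^ 2)⁻¹ * ((2 * n - 2) * logConfCoeff n m x +
        logConfCoeff' n m x * ‖x‖ ^ 2 + (n - 2) * logConfCoeff n m x ^ 2 * ‖x‖ ^ 2) := by
  have hφ := confFactor_pos (n := n) hm x
  have hNN : ∑ k, N x k * N x k = 1 := by
    have : ‖N x‖ ^ 2 = ∑ k, N x k * N x k := by rw [EuclideanSpace.norm_sq_eq]; simp [sq]
    rw [← this, hN, one_pow]
  have hXN : ∑ k, x k * N x k = 0 := by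
    rw [← hxN, PiLp.inner_apply]; simp [mul_comm]
  rw [metricInner]
  simp only [ricci_schwarzschild hn hm hx]
  set a := logConfCoeff n m x
  set b := logConfCoeff' n m x
  set c := (confFactor n m x ^ 2)⁻¹ with hc
  have : ∀ i j, ((2 - n) * (a * kron i j + b * x i * x j)
      - kron i j * (n * a + b * ‖x‖ ^ 2) + (n - 2) * a ^ 2 * x i * x j
      - (n - 2) * a ^ 2 * ‖x‖ ^ 2 * kron i j) * (confNormal n m N x) i * (confNormal n m N x) j =
      kron i j * (c * ((2 - n) * a - (n * a + b * ‖x‖ ^ 2) - (n - 2) * a ^ 2 * ‖x‖ ^ 2)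
        * (N x i * N x j)) +
      c * ((2 - n) * b + (n - 2) * a ^ 2) * (x i * N x i) * (x j * N x j) := by
    intro i j
    simp only [confNormal, PiLp.smul_apply, smul_eq_mul, hc]
    field_simp
    ring
  simp only [this, Finset.sum_add_distrib, sum_kron_mul, ← Finset.mul_sum, hXN, hNN]
  simp
  ring

/-- For z = a|x|² one has b|x|⁴ = z' - 2z, with ' = d/d(log |x|). The identity is thus the Riccati
equation z' = -(n-2)(z + z²/2), which expresses that 1 + m/(2|x|^{n-2}) is harmonic. -/
lemma logConfCoeff_identity (hn : 3 ≤ n) (hm : 0 < m) (hx : x ≠ 0) :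
    2 * logConfCoeff' n m x * ‖x‖ ^ 4 = -2 * n * (logConfCoeff n m x * ‖x‖ ^ 2)
      + (2 - n) * (logConfCoeff n m x * ‖x‖ ^ 2) ^ 2 := by
  obtain ⟨k, rfl⟩ : ∃ k, n = k + 3 := ⟨n - 3, by omega⟩
  have hr : 0 < ‖x‖ := norm_pos_iff.2 hx
  rw [logConfCoeff, logConfCoeff']
  have e : k + 3 - 2 = k + 1 := by omega
  rw [e]
  have hd : ‖x‖ ^ (k + 3) + m / 2 * ‖x‖ ^ 2 ≠ 0 := by positivity
  field_simp
  push_cast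
  ring

lemma logConfCoeff_mem (hm : 0 < m) (hx : x ≠ 0) :
    -2 < logConfCoeff n m x * ‖x‖ ^ 2 ∧ logConfCoeff n m x * ‖x‖ ^ 2 < 0 := by
  have hr : 0 < ‖x‖ := norm_pos_iff.2 hx
  have hd : 0 < ‖x‖ ^ n + m / 2 * ‖x‖ ^ 2 := by positivity
  have e : logConfCoeff n m x * ‖x‖ ^ 2 = -(m * ‖x‖ ^ 2 / (‖x‖ ^ n + m / 2 * ‖x‖ ^ 2)) := by
    rw [logConfCoeff]; ring
  rw [e]
  constructor
  · rw [neg_lt_neg_iff, div_lt_iff₀ hd]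
    have : 0 < ‖x‖ ^ n := by positivity
    linarith
  · rw [neg_lt_zero]; positivity

/-- With z = a|x|², the Riccati identity reduces 2φ²|x|² Ric(ξ, ξ) to (n-2)(-z)(2+z), and -2 < z <
0. -/
lemma ricci_confNormal_nonneg (hn : 3 ≤ n) (hm : 0 < m) (hx : x ≠ 0) (hxN : ⟪x, N x⟫ = 0)
    (hN : ‖N x‖ = 1) :
    0 ≤ metricInner (ricci (schwarzschild n m)) x (confNormal n m N x) (confNormal n m N x) := by
  have hφ := confFactor_pos (n := n) hm x
  have hr : 0 < ‖x‖ := norm_pos_iff.2 hx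
  have hn' : (3 : ℝ) ≤ n := by exact_mod_cast hn
  rw [ricci_confNormal hn hm hx hxN hN]
  obtain ⟨h1, h2⟩ := logConfCoeff_mem hm hx
  have h3 := logConfCoeff_identity hn hm hx
  rw [neg_mul, ← mul_neg]
  refine mul_nonneg (by positivity) ?_
  rw [← mul_nonneg_iff_of_pos_right (c := 2 * ‖x‖ ^ 2) (by positivity)]
  set z := logConfCoeff n m x * ‖x‖ ^ 2
  have : -((2 * n - 2) * logConfCoeff n m x + logConfCoeff' n m x * ‖x‖ ^ 2 +
      (n - 2) * logConfCoeff n m x ^ 2 * ‖x‖ ^ 2) * (2 * ‖x‖ ^ 2) = (n - 2) * (-z) * (2 + z) := by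
    have : -((2 * n - 2) * logConfCoeff n m x + logConfCoeff' n m x * ‖x‖ ^ 2 +
      (n - 2) * logConfCoeff n m x ^ 2 * ‖x‖ ^ 2) * (2 * ‖x‖ ^ 2) = -(2 * (2 * n - 2) * z +
        2 * logConfCoeff' n m x * ‖x‖ ^ 4 + 2 * (n - 2) * z ^ 2) := by
      simp only [z]; ring
    rw [this, h3]; ring
  rw [this]
  have : 0 < 2 + z := by linarith
  exact mul_nonneg (mul_nonneg (by linarith) (by linarith)) this.le

end Radial

/-! ### Simons' identity for cones -/

section Tensor

variable {n : ℕ}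

/-- This and the next two lemmas pair a three-index array with a product having X in one slot; they
evaluate the inner products in `cone_kato`. -/
lemma sum_contract_first {X : Fin n → ℝ} {T : Fin n → Fin n → Fin n → ℝ} {B R : Fin n → Fin n → ℝ}
    (h : ∀ i j, ∑ k, X k * T k i j = R i j) :
    ∑ k, ∑ i, ∑ j, T k i j * (X k * B i j) = ∑ i, ∑ j, R i j * B i j := by
  rw [Finset.sum_comm]
  refine Finset.sum_congr rfl fun i _ => ?_
  rw [Finset.sum_comm]
  refine Finset.sum_congr rfl fun j _ => ?_
  rw [← h, Finset.sum_mul]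
  exact Finset.sum_congr rfl fun k _ => by ring

lemma sum_contract_second {X : Fin n → ℝ} {T : Fin n → Fin n → Fin n → ℝ} {B R : Fin n → Fin n → ℝ}
    (h : ∀ k j, ∑ i, X i * T k i j = R k j) :
    ∑ k, ∑ i, ∑ j, T k i j * (X i * B k j) = ∑ k, ∑ j, R k j * B k j := by
  refine Finset.sum_congr rfl fun k _ => ?_
  rw [Finset.sum_comm]
  refine Finset.sum_congr rfl fun j _ => ?_
  rw [← h, Finset.sum_mul]
  exact Finset.sum_congr rfl fun i _ => by ring

lemma sum_contract_third {X : Fin n → ℝ} {T : Fin n → Fin n → Fin n → ℝ} {B R : Fin n → Fin n → ℝ}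
    (h : ∀ k i, ∑ j, X j * T k i j = R k i) :
    ∑ k, ∑ i, ∑ j, T k i j * (X j * B k i) = ∑ k, ∑ i, R k i * B k i := by
  refine Finset.sum_congr rfl fun k _ => Finset.sum_congr rfl fun i _ => ?_
  rw [← h, Finset.sum_mul]
  exact Finset.sum_congr rfl fun j _ => by ring

/-- The refined Kato inequality for the second fundamental form of a cone, at one point. -/
lemma cone_kato {ρ : ℝ} (hρ : 0 < ρ) {X N : Fin n → ℝ} {B C : Fin n → Fin n → ℝ}
    {T : Fin n → Fin n → Fin n → ℝ}
    (hXX : ∑ i, X i * X i = ρ) (hNN : ∑ i, N i * N i = 1) (hXN : ∑ i, X i * N i = 0)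
    (hB : ∀ i j, B i j = B j i) (hC : ∀ i j, C i j = C j i)
    (hXB : ∀ j, ∑ i, X i * B i j = 0) (hNB : ∀ j, ∑ i, N i * B i j = 0)
    (hXC : ∀ j, ∑ i, X i * C i j = 0) (hNC : ∀ j, ∑ i, N i * C i j = 0)
    (hX1 : ∀ i j, ∑ k, X k * T k i j = -B i j) (hX2 : ∀ k j, ∑ i, X i * T k i j = -B k j)
    (hX3 : ∀ k i, ∑ j, X j * T k i j = -B k i) (hN2 : ∀ k j, ∑ i, N i * T k i j = -C k j)
    (hN3 : ∀ k i, ∑ j, N j * T k i j = -C k i) :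
    0 ≤ ρ * (∑ k, ∑ i, ∑ j, T k i j * T k i j)
        - 3 * (∑ i, ∑ j, B i j * B i j) - 2 * ρ * (∑ i, ∑ j, C i j * C i j) ∧
    ∑ k, (2 * ρ * (∑ i, ∑ j, B i j * T k i j) + 2 * X k * ∑ i, ∑ j, B i j * B i j) ^ 2 ≤
      4 * ρ * (∑ i, ∑ j, B i j * B i j) * (ρ * (∑ k, ∑ i, ∑ j, T k i j * T k i j)
        - 3 * (∑ i, ∑ j, B i j * B i j) - 2 * ρ * ∑ i, ∑ j, C i j * C i j) := by
  have hNX : ∑ i, N i * X i = 0 := by simpa only [mul_comm] using hXN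
  have hXB' : ∀ j, ∑ i, X i * B j i = 0 := fun j => by simpa only [hB j] using hXB j
  have hNB' : ∀ j, ∑ i, N i * B j i = 0 := fun j => by simpa only [hB j] using hNB j
  have hXC' : ∀ j, ∑ i, X i * C j i = 0 := fun j => by simpa only [hC j] using hXC j
  have hNC' : ∀ j, ∑ i, N i * C j i = 0 := fun j => by simpa only [hC j] using hNC j
  set h := ∑ i, ∑ j, B i j * B i j with hh
  -- -V is the part of T forced by its prescribed contractions with X (in all three slots) and with
  -- N (in the last two). S = T + V is what remains.
  set V : Fin n → Fin n → Fin n → ℝ := fun k i j =>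
    ρ⁻¹ * (X k * B i j) + ρ⁻¹ * (X i * B k j) + ρ⁻¹ * (X j * B k i) + N i * C k j + N j * C k i
    with hV
  set S : Fin n → Fin n → Fin n → ℝ := fun k i j => T k i j + V k i j with hS
  have expand : ∀ (Y : Fin n → Fin n → Fin n → ℝ), ∑ k, ∑ i, ∑ j, Y k i j * V k i j =
      ρ⁻¹ * (∑ k, ∑ i, ∑ j, Y k i j * (X k * B i j)) +
      ρ⁻¹ * (∑ k, ∑ i, ∑ j, Y k i j * (X i * B k j)) +
      ρ⁻¹ * (∑ k, ∑ i, ∑ j, Y k i j * (X j * B k i)) +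
      (∑ k, ∑ i, ∑ j, Y k i j * (N i * C k j)) + ∑ k, ∑ i, ∑ j, Y k i j * (N j * C k i) := by
    intro Y
    simp only [Finset.mul_sum, ← Finset.sum_add_distrib, hV]
    refine Finset.sum_congr rfl fun k _ => Finset.sum_congr rfl fun i _ =>
      Finset.sum_congr rfl fun j _ => ?_
    ring
  have hTV : ∑ k, ∑ i, ∑ j, T k i j * V k i j = -(3 * ρ⁻¹ * h) - 2 * ∑ i, ∑ j, C i j * C i j := by
    rw [expand, sum_contract_first hX1, sum_contract_second hX2, sum_contract_third hX3,
      sum_contract_second hN2, sum_contract_third hN3]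
    simp only [neg_mul, Finset.sum_neg_distrib, ← hh]
    ring
  have s1 : ∀ i j, ∑ k, X k * S k i j = 0 := by
    intro i j
    have : ∀ k, X k * S k i j = X k * T k i j + ρ⁻¹ * B i j * (X k * X k) +
        ρ⁻¹ * X i * (X k * B k j) + ρ⁻¹ * X j * (X k * B k i) + N i * (X k * C k j) +
        N j * (X k * C k i) := by intro k; simp only [hS, hV]; ring
    simp only [this, Finset.sum_add_distrib, ← Finset.mul_sum, hX1, hXX, hXB, hXC]
    field_simp
    ring
  have s2 : ∀ k j, ∑ i, X i * S k i j = 0 := by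
    intro k j
    have : ∀ i, X i * S k i j = X i * T k i j + ρ⁻¹ * B k j * (X i * X i) +
        ρ⁻¹ * X k * (X i * B i j) + ρ⁻¹ * X j * (X i * B k i) + C k j * (X i * N i) +
        N j * (X i * C k i) := by intro i; simp only [hS, hV]; ring
    simp only [this, Finset.sum_add_distrib, ← Finset.mul_sum, hX2, hXX, hXB, hXC', hXN, hXB']
    field_simp
    ring
  have s3 : ∀ k i, ∑ j, X j * S k i j = 0 := by
    intro k i
    have : ∀ j, X j * S k i j = X j * T k i j + ρ⁻¹ * B k i * (X j * X j) +
        ρ⁻¹ * X k * (X j * B i j) + ρ⁻¹ * X i * (X j * B k j) + C k i * (X j * N j) +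
        N i * (X j * C k j) := by intro j; simp only [hS, hV]; ring
    simp only [this, Finset.sum_add_distrib, ← Finset.mul_sum, hX3, hXX, hXC', hXN, hXB']
    field_simp
    ring
  have s4 : ∀ k j, ∑ i, N i * S k i j = 0 := by
    intro k j
    have : ∀ i, N i * S k i j = N i * T k i j + ρ⁻¹ * B k j * (N i * X i) +
        ρ⁻¹ * X k * (N i * B i j) + ρ⁻¹ * X j * (N i * B k i) + C k j * (N i * N i) +
        N j * (N i * C k i) := by intro i; simp only [hS, hV]; ring
    simp only [this, Finset.sum_add_distrib, ← Finset.mul_sum, hN2, hNN, hNB, hNC', hNX, hNB']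
    ring
  have s5 : ∀ k i, ∑ j, N j * S k i j = 0 := by
    intro k i
    have : ∀ j, N j * S k i j = N j * T k i j + ρ⁻¹ * B k i * (N j * X j) +
        ρ⁻¹ * X k * (N j * B i j) + ρ⁻¹ * X i * (N j * B k j) + C k i * (N j * N j) +
        N i * (N j * C k j) := by intro j; simp only [hS, hV]; ring
    simp only [this, Finset.sum_add_distrib, ← Finset.mul_sum, hN3, hNN, hNC', hNX, hNB']
    ring
  -- Each term of V carries an X or an N in a slot where S contracts to zero. Hence |S|² = |T|² -
  -- 3|B|²/ρ - 2|C|².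
  have hSV : ∑ k, ∑ i, ∑ j, S k i j * V k i j = 0 := by
    rw [expand, sum_contract_first (R := fun _ _ => 0) s1,
      sum_contract_second (R := fun _ _ => 0) s2, sum_contract_third (R := fun _ _ => 0) s3,
      sum_contract_second (R := fun _ _ => 0) s4, sum_contract_third (R := fun _ _ => 0) s5]
    simp
  have hSS : ∑ k, ∑ i, ∑ j, S k i j * S k i j =
      (∑ k, ∑ i, ∑ j, T k i j * T k i j) - 3 * ρ⁻¹ * h - 2 * ∑ i, ∑ j, C i j * C i j := by
    have : ∀ k i j, S k i j * S k i j = T k i j * T k i j + T k i j * V k i j + S k i j * V k i j := by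
      intro k i j; simp only [hS]; ring
    simp only [this, Finset.sum_add_distrib, hTV, hSV]
    ring
  -- Of the five terms of V only X_k B_ij pairs nontrivially with B_ij, so the vector on the left is
  -- 2ρ ⟨B, S_k⟩. The Kato inequality is then Cauchy–Schwarz for each k.
  have hBS : ∀ k, 2 * ρ * (∑ i, ∑ j, B i j * T k i j) + 2 * X k * h =
      2 * ρ * ∑ i, ∑ j, B i j * S k i j := by
    intro k
    have h1 : ∑ i, ∑ j, B i j * (X i * B k j) = 0 := by
      rw [Finset.sum_comm]
      refine Finset.sum_eq_zero fun j _ => ?_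
      have : ∀ i, B i j * (X i * B k j) = B k j * (X i * B i j) := fun i => by ring
      simp only [this, ← Finset.mul_sum, hXB, mul_zero]
    have h2 : ∑ i, ∑ j, B i j * (X j * B k i) = 0 := by
      refine Finset.sum_eq_zero fun i _ => ?_
      have : ∀ j, B i j * (X j * B k i) = B k i * (X j * B i j) := fun i => by ring
      simp only [this, ← Finset.mul_sum, hXB', mul_zero]
    have h3 : ∑ i, ∑ j, B i j * (N i * C k j) = 0 := by
      rw [Finset.sum_comm]
      refine Finset.sum_eq_zero fun j _ => ?_
      have : ∀ i, B i j * (N i * C k j) = C k j * (N i * B i j) := fun i => by ring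
      simp only [this, ← Finset.mul_sum, hNB, mul_zero]
    have h4 : ∑ i, ∑ j, B i j * (N j * C k i) = 0 := by
      refine Finset.sum_eq_zero fun i _ => ?_
      have : ∀ j, B i j * (N j * C k i) = C k i * (N j * B i j) := fun i => by ring
      simp only [this, ← Finset.mul_sum, hNB', mul_zero]
    have h5 : ∀ i j, B i j * S k i j = B i j * T k i j + ρ⁻¹ * X k * (B i j * B i j) +
        ρ⁻¹ * (B i j * (X i * B k j)) + ρ⁻¹ * (B i j * (X j * B k i)) +
        B i j * (N i * C k j) + B i j * (N j * C k i) := by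
      intro i j; simp only [hS, hV]; ring
    simp only [h5, Finset.sum_add_distrib, ← Finset.mul_sum, h1, h2, h3, h4, ← hh]
    field_simp
    ring
  have hCS : ∀ k, (∑ i, ∑ j, B i j * S k i j) ^ 2 ≤ h * ∑ i, ∑ j, S k i j * S k i j := by
    intro k
    have := Finset.sum_mul_sq_le_sq_mul_sq Finset.univ (fun p : Fin n × Fin n => B p.1 p.2)
      (fun p => S k p.1 p.2)
    simpa only [Fintype.sum_prod_type, sq] using this
  have hW : ρ * (∑ k, ∑ i, ∑ j, T k i j * T k i j) - 3 * h - 2 * ρ * (∑ i, ∑ j, C i j * C i j) =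
      ρ * ∑ k, ∑ i, ∑ j, S k i j * S k i j := by
    rw [hSS]
    field_simp
  refine ⟨?_, ?_⟩
  · rw [hW]
    exact mul_nonneg hρ.le (Finset.sum_nonneg fun k _ => Finset.sum_nonneg fun i _ =>
      Finset.sum_nonneg fun j _ => mul_self_nonneg _)
  simp only [hBS, mul_pow]
  rw [← Finset.mul_sum]
  calc (2 : ℝ) ^ 2 * ρ ^ 2 * ∑ k, (∑ i, ∑ j, B i j * S k i j) ^ 2
      ≤ 2 ^ 2 * ρ ^ 2 * ∑ k, h * ∑ i, ∑ j, S k i j * S k i j := by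
        gcongr with k _
        exact hCS k
    _ = _ := by
        rw [← Finset.mul_sum, hSS]
        field_simp
        ring

end Tensor

/-- The tangential calculus on a minimal cone: an algebra `A` of functions on the cone, the
tangential derivatives `D i`, the components `N i` of the unit normal field and the coordinate
functions `X i`. -/
structure MinimalConeCalculus (n : ℕ) (A : Type*) [CommRing A] [Algebra ℝ A]
    (D : Fin n → Derivation ℝ A A) (N X : Fin n → A) : Prop where
  normal_sq : ∑ i, N i * N i = 1
  normal_D : ∀ f, ∑ i, N i * D i f = 0
  symm : ∀ i j, D i (N j) = D j (N i)
  comm : ∀ i j f, D i (D j f) - D j (D i f) =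
    ∑ k, (N i * D j (N k) - N j * D i (N k)) * D k f
  minimal : ∑ i, D i (N i) = 0
  D_coord : ∀ i j, D i (X j) = (if i = j then 1 else 0) - N i * N j
  coord_normal : ∑ i, X i * N i = 0
  radial_normal : ∀ j, ∑ i, X i * D i (N j) = 0

namespace MinimalConeCalculus

variable {n : ℕ} {A : Type*} [CommRing A] [Algebra ℝ A]
  {D : Fin n → Derivation ℝ A A} {N X : Fin n → A}

/-- `|A|²` of the cone. -/
def normSq (D : Fin n → Derivation ℝ A A) (N : Fin n → A) : A :=
  ∑ i, ∑ j, D i (N j) * D i (N j)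

/-- The square of the second fundamental form. -/
def formSq (D : Fin n → Derivation ℝ A A) (N : Fin n → A) (i j : Fin n) : A :=
  ∑ l, D i (N l) * D l (N j)

lemma sum_normal_mul (h : MinimalConeCalculus n A D N X) (j : Fin n) :
    ∑ i, N i * D j (N i) = 0 := by
  simp only [h.symm j]
  exact h.normal_D _

lemma formSq_symm (h : MinimalConeCalculus n A D N X) (i j : Fin n) :
    formSq D N i j = formSq D N j i := by
  refine Finset.sum_congr rfl fun l _ => ?_
  rw [h.symm i l, h.symm l j, mul_comm]

lemma sum_normal_mul_formSq (h : MinimalConeCalculus n A D N X) (j : Fin n) :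
    ∑ i, N i * formSq D N i j = 0 := by
  simp only [formSq, Finset.mul_sum]
  rw [Finset.sum_comm]
  refine Finset.sum_eq_zero fun l _ => ?_
  simp only [← mul_assoc, ← Finset.sum_mul, h.normal_D, zero_mul]

lemma sum_coord_mul_formSq (h : MinimalConeCalculus n A D N X) (j : Fin n) :
    ∑ i, X i * formSq D N i j = 0 := by
  simp only [formSq, Finset.mul_sum]
  rw [Finset.sum_comm]
  refine Finset.sum_eq_zero fun l _ => ?_
  simp only [← mul_assoc, ← Finset.sum_mul, h.radial_normal, zero_mul]

/-- The commutator relation applied to N_j. The terms with a bare factor N appear because the D_i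
are components of the Euclidean tangential gradient rather than covariant derivatives. -/
lemma codazzi (h : MinimalConeCalculus n A D N X) (k i j : Fin n) :
    D k (D i (N j)) = D i (D k (N j)) + N k * formSq D N i j - N i * formSq D N k j := by
  have := h.comm k i (N j)
  simp only [sub_mul, Finset.sum_sub_distrib, mul_assoc, ← Finset.mul_sum] at this
  simp only [formSq]
  linear_combination this

lemma trace_formSq (h : MinimalConeCalculus n A D N X) :
    ∑ k, formSq D N k k = normSq D N := by
  refine Finset.sum_congr rfl fun k _ => Finset.sum_congr rfl fun l _ => ?_
  rw [h.symm l k]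

/-- The trace of the Codazzi equation: minimality removes the gradient of the mean curvature,
leaving only a multiple of the normal. -/
lemma divergence_form (h : MinimalConeCalculus n A D N X) (j : Fin n) :
    ∑ k, D k (D k (N j)) = -(N j * normSq D N) := by
  have h1 : ∀ k, D k (D k (N j)) =
      D j (D k (N k)) + N k * formSq D N k j - N j * formSq D N k k := by
    intro k
    rw [h.symm k j, h.codazzi k j k, h.formSq_symm j k]
  simp only [h1, Finset.sum_add_distrib, Finset.sum_sub_distrib, ← Finset.mul_sum,
    h.sum_normal_mul_formSq, h.trace_formSq]
  rw [← map_sum, h.minimal, map_zero]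
  ring

/-- Differentiation of Σ N_k D_k N_j = 0. The normal components of the derivative of the form are
thus quadratic in the form; they account for the |C|² terms in Simons' identity and in `cone_kato`.
-/
lemma normal_D_form (h : MinimalConeCalculus n A D N X) (l j : Fin n) :
    ∑ k, N k * D l (D k (N j)) = -formSq D N l j := by
  have := congrArg (D l) (h.normal_D (N j))
  simp only [map_sum, Derivation.leibniz, smul_eq_mul, Finset.sum_add_distrib, map_zero] at this
  have e : ∑ k, D k (N j) * D l (N k) = formSq D N l j :=
    Finset.sum_congr rfl fun k _ => mul_comm _ _
  rw [e] at this
  linear_combination this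

lemma coord_D_form (h : MinimalConeCalculus n A D N X) (l j : Fin n) :
    ∑ k, X k * D l (D k (N j)) = -D l (N j) := by
  have := congrArg (D l) (h.radial_normal j)
  simp only [map_sum, Derivation.leibniz, smul_eq_mul, Finset.sum_add_distrib, map_zero,
    h.D_coord, mul_sub, Finset.sum_sub_distrib, mul_ite, mul_one, mul_zero] at this
  have e : ∑ k, D k (N j) * (N l * N k) = 0 := by
    have e' : ∀ k, D k (N j) * (N l * N k) = N l * (N k * D k (N j)) := fun k => by ring
    simp only [e', ← Finset.mul_sum, h.normal_D, mul_zero]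
  rw [e] at this
  simp at this
  linear_combination this

/-- The second fundamental form of a cone is homogeneous of degree -1. Algebraically, Codazzi
reduces this to the derivative of Σ X_k D_k N_j = 0. -/
lemma radial_D_form (h : MinimalConeCalculus n A D N X) (i j : Fin n) :
    ∑ k, X k * D k (D i (N j)) = -D i (N j) := by
  have e : ∀ k, X k * D k (D i (N j)) = X k * D i (D k (N j)) + formSq D N i j * (X k * N k)
      - N i * (X k * formSq D N k j) := by
    intro k; rw [h.codazzi k i j]; ring
  simp only [e, Finset.sum_add_distrib, Finset.sum_sub_distrib, ← Finset.mul_sum, h.coord_D_form,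
    h.coord_normal, h.sum_coord_mul_formSq]
  ring

/-- D_i is moved to the front with Codazzi and the commutator relation. Terms with a bare factor N_i
or N_j are left unsimplified because they disappear on contraction with D_i N_j. -/
lemma laplacian_form (h : MinimalConeCalculus n A D N X) (i j : Fin n) :
    ∑ k, D k (D k (D i (N j))) = -(normSq D N * D i (N j)) - 2 * (∑ l, D i (N l) * formSq D N l j)
      - N j * D i (normSq D N)
      - N i * (∑ k, ∑ l, D k (N l) * D l (D k (N j)) + ∑ k, D k (formSq D N k j)) := by
  have h1 : ∀ k, D k (D k (D i (N j))) = D i (D k (D k (N j)))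
      + (N k * ∑ l, D i (N l) * D l (D k (N j)) - N i * ∑ l, D k (N l) * D l (D k (N j)))
      + (formSq D N i j * D k (N k) + N k * D k (formSq D N i j))
      - (D i (N k) * formSq D N k j + N i * D k (formSq D N k j)) := by
    intro k
    have h2 := h.comm k i (D k (N j))
    simp only [sub_mul, Finset.sum_sub_distrib, mul_assoc, ← Finset.mul_sum] at h2
    rw [h.codazzi k i j]
    simp only [map_add, map_sub, Derivation.leibniz, smul_eq_mul]
    rw [h.symm i k]
    linear_combination h2
  have h3 : ∑ k, N k * ∑ l, D i (N l) * D l (D k (N j)) = -∑ l, D i (N l) * formSq D N l j := by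
    simp only [Finset.mul_sum]
    rw [Finset.sum_comm, ← Finset.sum_neg_distrib]
    refine Finset.sum_congr rfl fun l _ => ?_
    have : ∀ k, N k * (D i (N l) * D l (D k (N j))) = D i (N l) * (N k * D l (D k (N j))) :=
      fun k => by ring
    simp only [this, ← Finset.mul_sum, h.normal_D_form]
    ring
  simp only [h1, Finset.sum_add_distrib, Finset.sum_sub_distrib, h3, ← Finset.mul_sum,
    h.minimal, h.normal_D]
  rw [← map_sum, h.divergence_form, map_neg, Derivation.leibniz]
  simp only [smul_eq_mul]
  ring

/-- Simons' identity. -/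
theorem simons (h : MinimalConeCalculus n A D N X) :
    ∑ k, D k (D k (normSq D N)) = 2 * (∑ k, ∑ i, ∑ j, D k (D i (N j)) * D k (D i (N j)))
      - 2 * normSq D N ^ 2 - 4 * ∑ i, ∑ j, formSq D N i j * formSq D N i j := by
  have h1 : ∀ k, D k (D k (normSq D N)) = 2 * (∑ i, ∑ j, D k (D i (N j)) * D k (D i (N j))) +
      2 * ∑ i, ∑ j, D i (N j) * D k (D k (D i (N j))) := by
    intro k
    simp only [normSq, map_sum, Derivation.leibniz, smul_eq_mul, map_add, Finset.mul_sum,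
      ← Finset.sum_add_distrib]
    exact Finset.sum_congr rfl fun i _ => Finset.sum_congr rfl fun j _ => by ring
  have h2 : ∑ k, ∑ i, ∑ j, D i (N j) * D k (D k (D i (N j))) =
      -normSq D N ^ 2 - 2 * ∑ i, ∑ j, formSq D N i j * formSq D N i j := by
    rw [Finset.sum_comm]
    have h3 : ∀ i, ∑ k, ∑ j, D i (N j) * D k (D k (D i (N j))) =
        ∑ j, (-(normSq D N * (D i (N j) * D i (N j)))
          - 2 * (∑ l, D i (N j) * (D i (N l) * formSq D N l j))
          - D i (normSq D N) * (N j * D i (N j))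
          - N i * D i (N j) * (∑ k, ∑ l, D k (N l) * D l (D k (N j)) +
            ∑ k, D k (formSq D N k j))) := by
      intro i
      rw [Finset.sum_comm]
      refine Finset.sum_congr rfl fun j _ => ?_
      rw [← Finset.mul_sum, h.laplacian_form i j, ← Finset.mul_sum]
      ring
    have h4 : ∑ i, ∑ j, N i * D i (N j) * (∑ k, ∑ l, D k (N l) * D l (D k (N j)) +
            ∑ k, D k (formSq D N k j)) = 0 := by
      rw [Finset.sum_comm]
      simp only [← Finset.sum_mul, h.normal_D, zero_mul, Finset.sum_const_zero]
    have h5 : ∑ i, ∑ j, D i (N j) * ∑ l, D i (N l) * formSq D N l j =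
        ∑ i, ∑ j, formSq D N i j * formSq D N i j := by
      simp only [Finset.mul_sum]
      have : ∀ i j l, D i (N j) * (D i (N l) * formSq D N l j) =
          D j (N i) * D i (N l) * formSq D N l j := by
        intro i j l; rw [h.symm i j]; ring
      simp only [this]
      rw [Finset.sum_comm]
      refine Finset.sum_congr rfl fun j _ => ?_
      rw [Finset.sum_comm]
      refine Finset.sum_congr rfl fun l _ => ?_
      rw [← Finset.sum_mul, h.formSq_symm l j, formSq]
    simp only [h3, Finset.sum_sub_distrib, Finset.sum_neg_distrib, ← Finset.mul_sum, h4, h5,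
      h.sum_normal_mul, mul_zero, Finset.sum_const_zero]
    rw [← normSq]
    ring
  simp only [h1, Finset.sum_add_distrib, ← Finset.mul_sum, h2]
  ring

lemma D_sqNorm (h : MinimalConeCalculus n A D N X) (k : Fin n) :
    D k (∑ i, X i * X i) = 2 * X k := by
  simp only [map_sum, Derivation.leibniz, smul_eq_mul, h.D_coord]
  have : ∀ i, X i * ((if k = i then 1 else 0) - N k * N i) +
      X i * ((if k = i then 1 else 0) - N k * N i) =
      2 * (if k = i then X i else 0) - 2 * N k * (X i * N i) := by
    intro i; split_ifs <;> ring
  simp only [this, Finset.sum_sub_distrib, ← Finset.mul_sum, h.coord_normal]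
  simp

lemma sum_D_coord (h : MinimalConeCalculus n A D N X) : ∑ k, D k (X k) = (n : A) - 1 := by
  simp only [h.D_coord, Finset.sum_sub_distrib, h.normal_sq]
  simp

lemma radial_normSq (h : MinimalConeCalculus n A D N X) :
    ∑ k, X k * D k (normSq D N) = -2 * normSq D N := by
  have : ∀ k, X k * D k (normSq D N) = ∑ i, ∑ j, 2 * D i (N j) * (X k * D k (D i (N j))) := by
    intro k
    simp only [normSq, map_sum, Derivation.leibniz, smul_eq_mul, Finset.mul_sum]
    exact Finset.sum_congr rfl fun i _ => Finset.sum_congr rfl fun j _ => by ring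
  simp only [this]
  rw [Finset.sum_comm, normSq, Finset.mul_sum]
  refine Finset.sum_congr rfl fun i _ => ?_
  rw [Finset.sum_comm, Finset.mul_sum]
  refine Finset.sum_congr rfl fun j _ => ?_
  rw [← Finset.mul_sum, h.radial_D_form]
  ring

lemma radial_sqNorm_mul_normSq (h : MinimalConeCalculus n A D N X) :
    ∑ k, X k * D k ((∑ i, X i * X i) * normSq D N) = 0 := by
  simp only [Derivation.leibniz, smul_eq_mul, h.D_sqNorm]
  have : ∀ k, X k * ((∑ i, X i * X i) * D k (normSq D N) + normSq D N * (2 * X k)) =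
      (∑ i, X i * X i) * (X k * D k (normSq D N)) + 2 * normSq D N * (X k * X k) := by
    intro k; ring
  simp only [this, Finset.sum_add_distrib, ← Finset.mul_sum, h.radial_normSq]
  ring

/-- In the Leibniz rule the cross term is 4 Σ X_k D_k |A|² = -8|A|² by homogeneity, and |A|² Δ|x|² =
2(n-1)|A|²; together they give 2n - 10. -/
lemma laplacian_sqNorm_mul_normSq (h : MinimalConeCalculus n A D N X) :
    ∑ k, D k (D k ((∑ i, X i * X i) * normSq D N)) =
      (∑ i, X i * X i) * (∑ k, D k (D k (normSq D N))) + (2 * n - 10) * normSq D N := by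
  have : ∀ k, D k (D k ((∑ i, X i * X i) * normSq D N)) =
      (∑ i, X i * X i) * D k (D k (normSq D N)) + 4 * (X k * D k (normSq D N)) +
        2 * normSq D N * D k (X k) := by
    intro k
    have h2 : D k (2 : A) = 0 := by
      have := (D k).map_natCast 2
      simpa using this
    simp only [Derivation.leibniz, smul_eq_mul, h.D_sqNorm, map_add, h2]
    ring
  simp only [this, Finset.sum_add_distrib, ← Finset.mul_sum, h.radial_normSq, h.sum_D_coord]
  ring

/-- The pointwise form of Simons' stability inequality, for the homogeneous function
`g = (|x|² |A|² + ε)^{1/2}` on the cone. -/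
theorem simons_inequality (h : MinimalConeCalculus n A D N X) (ev : A →ₐ[ℝ] ℝ) {g : A} {ε : ℝ}
    (hε : 0 < ε) (hg : g * g = (∑ i, X i * X i) * normSq D N + algebraMap ℝ A ε)
    (hρ : 0 < ev (∑ i, X i * X i)) :
    ((n : ℝ) - 2) * ev (normSq D N) ≤ ev (g * (∑ k, D k (D k g)) + normSq D N * (g * g)) := by
  set ρA : A := ∑ i, X i * X i with hρA
  set ρ := ev ρA with hρdef
  set H := ev (normSq D N) with hH
  have hDq : ∀ k, 2 * g * D k g = D k (ρA * normSq D N) := by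
    intro k
    have := congrArg (D k) hg
    simp only [Derivation.leibniz, smul_eq_mul, map_add, Derivation.map_algebraMap, add_zero] at this
    rw [Derivation.leibniz, smul_eq_mul, smul_eq_mul]
    linear_combination this
  have hDDq : ∀ k, 2 * g * D k (D k g) = D k (D k (ρA * normSq D N)) - 2 * (D k g * D k g) := by
    intro k
    have := congrArg (D k) (hDq k)
    have h2 : D k (2 : A) = 0 := by
      have := (D k).map_natCast 2
      simpa using this
    simp only [Derivation.leibniz, smul_eq_mul, h2] at this
    simp only [Derivation.leibniz, smul_eq_mul]
    linear_combination this
  have hlap : 2 * (g * ∑ k, D k (D k g)) =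
      ρA * (∑ k, D k (D k (normSq D N))) + (2 * n - 10) * normSq D N
        - 2 * ∑ k, D k g * D k g := by
    rw [← h.laplacian_sqNorm_mul_normSq, Finset.mul_sum, Finset.mul_sum, Finset.mul_sum,
      ← Finset.sum_sub_distrib]
    refine Finset.sum_congr rfl fun k _ => ?_
    rw [← hDDq]; ring
  set T2 : ℝ := ∑ k, ∑ i, ∑ j, ev (D k (D i (N j))) * ev (D k (D i (N j))) with hT2
  set C2 : ℝ := ∑ i, ∑ j, ev (formSq D N i j) * ev (formSq D N i j) with hC2
  set G2 : ℝ := ∑ k, ev (D k g) * ev (D k g) with hG2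
  have hH' : ∑ i, ∑ j, ev (D i (N j)) * ev (D i (N j)) = H := by
    rw [hH, normSq]; simp only [map_sum, map_mul]
  -- Simons' identity inserted into 2g Δg = Δ(g²) - 2|Dg|².
  have e1 : 2 * ev (g * ∑ k, D k (D k g)) =
      ρ * (2 * T2 - 2 * H ^ 2 - 4 * C2) + (2 * n - 10) * H - 2 * G2 := by
    have := congrArg ev hlap
    rw [h.simons] at this
    simp only [map_mul, map_sub, map_add, map_sum, map_pow, map_ofNat, map_natCast] at this
    rw [map_mul, map_sum]
    simp only [hT2, hC2, hG2, hH, hρdef, hρA, map_mul, map_sum] at this ⊢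
    linarith
  have e2 : ev g * ev g = ρ * H + ε := by
    have := congrArg ev hg
    simpa only [map_mul, map_add, AlgHom.commutes, Algebra.algebraMap_self, RingHom.id_apply]
      using this
  have hHnn : 0 ≤ H := by
    rw [← hH']
    exact Finset.sum_nonneg fun i _ => Finset.sum_nonneg fun j _ => mul_self_nonneg _
  have kato := cone_kato (ρ := ρ) hρ (X := fun i => ev (X i)) (N := fun i => ev (N i))
    (B := fun i j => ev (D i (N j))) (C := fun i j => ev (formSq D N i j))
    (T := fun k i j => ev (D k (D i (N j))))
    (by rw [hρdef, hρA]; simp only [map_sum, map_mul])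
    (by simpa using congrArg ev h.normal_sq) (by simpa using congrArg ev h.coord_normal)
    (fun i j => by simp only [h.symm i j]) (fun i j => by simp only [h.formSq_symm i j])
    (fun j => by simpa using congrArg ev (h.radial_normal j))
    (fun j => by simpa using congrArg ev (h.normal_D (N j)))
    (fun j => by simpa using congrArg ev (h.sum_coord_mul_formSq j))
    (fun j => by simpa using congrArg ev (h.sum_normal_mul_formSq j))
    (fun i j => by simpa using congrArg ev (h.radial_D_form i j))
    (fun k j => by simpa using congrArg ev (h.coord_D_form k j))
    (fun k i => by
      have := congrArg ev (h.coord_D_form k i)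
      simp only [h.symm i]
      simpa using this)
    (fun k j => by simpa using congrArg ev (h.normal_D_form k j))
    (fun k i => by
      have := congrArg ev (h.normal_D_form k i)
      simp only [h.symm i]
      simpa using this)
  simp only [hH', ← hT2, ← hC2] at kato
  have e3 : ∀ k, 2 * ρ * (∑ i, ∑ j, ev (D i (N j)) * ev (D k (D i (N j)))) + 2 * ev (X k) * H =
      2 * ev g * ev (D k g) := by
    intro k
    have h1 := congrArg ev (hDq k)
    have h2 : D k (normSq D N) = 2 * ∑ i, ∑ j, D i (N j) * D k (D i (N j)) := by
      simp only [normSq, map_sum, Derivation.leibniz, smul_eq_mul, Finset.mul_sum]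
      exact Finset.sum_congr rfl fun i _ => Finset.sum_congr rfl fun j _ => by ring
    rw [Derivation.leibniz, smul_eq_mul, smul_eq_mul, h.D_sqNorm, h2] at h1
    simp only [map_mul, map_add, map_sum, map_ofNat] at h1
    simp only [hρdef, hρA, hH, map_sum, map_mul] at h1 ⊢
    linarith
  have e4 : ∑ k, (2 * ev g * ev (D k g)) ^ 2 = 4 * (ρ * H + ε) * G2 := by
    rw [hG2, ← e2, Finset.mul_sum]
    exact Finset.sum_congr rfl fun k _ => by ring
  simp only [e3, e4] at kato
  obtain ⟨hW0, kato⟩ := kato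
  set W := ρ * T2 - 3 * H - 2 * ρ * C2 with hWdef
  -- Kato gives (ρH + ε) G2 ≤ ρH W, and ε W ≥ 0 can be added on the right. The positive ε permits
  -- division at zeros of A as well. In the end g Δg + |A|² g² equals W - G2 + (n-2)H + εH.
  have hW : G2 ≤ W := by
    have hq : 0 < ρ * H + ε := by positivity
    have h5 : 0 ≤ ε * W := mul_nonneg hε.le hW0
    have h6 : (ρ * H + ε) * G2 ≤ (ρ * H + ε) * W := by linarith
    exact le_of_mul_le_mul_left h6 hq
  rw [map_add, map_mul (f := ev) (normSq D N), map_mul (f := ev) g g, e2, ← hH]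
  linarith [mul_nonneg hε.le hHnn]

end MinimalConeCalculus

/-! ### The tangential calculus on the cone over a minimal link -/

section SmoothOffZero

variable {n : ℕ}

/-- Smoothness on `ℝⁿ ∖ {0}`. -/
def SmoothOffZero (f : Pt n → ℝ) : Prop := ∀ x, x ≠ 0 → ContDiffAt ℝ ∞ f x

namespace SmoothOffZero

variable {f g : Pt n → ℝ}

lemma add (hf : SmoothOffZero f) (hg : SmoothOffZero g) : SmoothOffZero fun x => f x + g x :=
  fun x hx => (hf x hx).add (hg x hx)

lemma mul (hf : SmoothOffZero f) (hg : SmoothOffZero g) : SmoothOffZero fun x => f x * g x :=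
  fun x hx => (hf x hx).mul (hg x hx)

lemma const (c : ℝ) : SmoothOffZero fun _ : Pt n => c := fun _ _ => contDiffAt_const

lemma sum {ι : Type*} {s : Finset ι} {f : ι → Pt n → ℝ} (hf : ∀ i ∈ s, SmoothOffZero (f i)) :
    SmoothOffZero fun x => ∑ i ∈ s, f i x :=
  fun x hx => ContDiffAt.sum fun i hi => hf i hi x hx

lemma coord (i : Fin n) : SmoothOffZero fun x : Pt n => x i := fun _ _ => by fun_prop

lemma normSq : SmoothOffZero fun x : Pt n => ‖x‖ ^ 2 :=
  fun _ _ => (contDiff_norm_sq ℝ).contDiffAt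

lemma comp_log_norm {θ : ℝ → ℝ} (hθ : ContDiff ℝ ∞ θ) :
    SmoothOffZero fun x : Pt n => θ (Real.log ‖x‖) := fun _ hx =>
  hθ.contDiffAt.comp _ ((contDiffAt_norm ℝ hx).log (norm_ne_zero_iff.2 hx))

lemma differentiableAt (hf : SmoothOffZero f) {x : Pt n} (hx : x ≠ 0) : DifferentiableAt ℝ f x :=
  (hf x hx).differentiableAt (by simp)

lemma continuousOn (hf : SmoothOffZero f) : ContinuousOn f {0}ᶜ :=
  fun x hx => (hf x hx).continuousAt.continuousWithinAt

lemma tangD {N : Pt n → Pt n} (hN : ∀ x, x ≠ 0 → ContDiffAt ℝ ∞ N x) (hf : SmoothOffZero f)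
    (i : Fin n) : SmoothOffZero (tangD N i f) := by
  intro x hx
  have h1 : ContDiffAt ℝ ∞ (fun y => fderiv ℝ f y) x := (hf x hx).fderiv_right (by simp)
  have h2 : ContDiffAt ℝ ∞ (fun y => N y i) x := by
    have := hN x hx
    fun_prop
  exact h1.clm_apply (contDiffAt_const.sub (h2.smul (hN x hx)))

end SmoothOffZero

/-- Commutation of the tangential derivatives. -/
lemma tangD_tangD {N : Pt n → Pt n} (hN : ∀ x, x ≠ 0 → ContDiffAt ℝ ∞ N x)
    {f : Pt n → ℝ} (hf : SmoothOffZero f) {x : Pt n} (hx : x ≠ 0) (i j : Fin n) :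
    tangD N i (tangD N j f) x =
      fderiv ℝ (fderiv ℝ f) x (EuclideanSpace.single i 1 - N x i • N x)
        (EuclideanSpace.single j 1 - N x j • N x)
      - tangD N i (fun y => N y j) x * fderiv ℝ f x (N x)
      - N x j * fderiv ℝ f x (fderiv ℝ N x (EuclideanSpace.single i 1 - N x i • N x)) := by
  have h1 : HasFDerivAt (fderiv ℝ f) (fderiv ℝ (fderiv ℝ f) x) x :=
    (((hf x hx).fderiv_right (m := ∞) (by simp)).differentiableAt (by simp)).hasFDerivAt
  have h2 : HasFDerivAt N (fderiv ℝ N x) x := ((hN x hx).differentiableAt (by simp)).hasFDerivAt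
  have h3 : HasFDerivAt (fun y => N y j) (fderiv ℝ (fun y => N y j) x) x := by
    have := (hN x hx).differentiableAt (by simp)
    exact DifferentiableAt.hasFDerivAt (by fun_prop)
  have h4 := h1.clm_apply ((h3.smul h2).const_sub (EuclideanSpace.single j (1 : ℝ)))
  have h6 : HasFDerivAt (tangD N j f) _ x := h4
  rw [tangD, h6.fderiv]
  simp only [tangD, _root_.add_apply, ContinuousLinearMap.comp_apply,
    ContinuousLinearMap.flip_apply, _root_.neg_apply, _root_.smul_apply, Pi.smul_apply',
    ContinuousLinearMap.smulRight_apply, map_neg, map_add, map_smul, smul_eq_mul]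
  ring

lemma fderiv_coord {N : Pt n → Pt n} {x : Pt n} (hN : DifferentiableAt ℝ N x) (v : Pt n)
    (j : Fin n) : fderiv ℝ (fun y => N y j) x v = fderiv ℝ N x v j := by
  have h : HasFDerivAt (fun y => N y j) _ x :=
    (EuclideanSpace.proj (𝕜 := ℝ) j : Pt n →L[ℝ] ℝ).hasFDerivAt.comp x hN.hasFDerivAt
  rw [h.fderiv]
  rfl

end SmoothOffZero

section Cone

variable {n : ℕ} {Γ : Set (Pt n)} {ν : Pt n → Pt n}

/-- The `0`-homogeneous extension of the normal field of the link. -/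
def coneField (ν : Pt n → Pt n) (x : Pt n) : Pt n := ν (‖x‖⁻¹ • x)

lemma coneField_smul {c : ℝ} (hc : 0 < c) (x : Pt n) : coneField ν (c • x) = coneField ν x := by
  rw [coneField, coneField, norm_smul, Real.norm_of_nonneg hc.le, smul_smul, mul_inv,
    mul_assoc, mul_comm ‖x‖⁻¹ c, ← mul_assoc, inv_mul_cancel₀ hc.ne', one_mul]

namespace IsClosedOrientedHypersurface

lemma contDiffAt_coneField (hΓ : IsClosedOrientedHypersurface Γ ν) {x : Pt n} (hx : x ≠ 0) :
    ContDiffAt ℝ ∞ (coneField ν) x := by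
  refine hΓ.smooth.contDiffAt.comp x ?_
  exact ((contDiffAt_norm ℝ hx).inv (norm_ne_zero_iff.2 hx)).smul contDiffAt_id

lemma smoothOffZero_coneField (hΓ : IsClosedOrientedHypersurface Γ ν) (j : Fin n) :
    SmoothOffZero fun x => coneField ν x j := by
  intro x hx
  have := hΓ.contDiffAt_coneField hx
  fun_prop

lemma ne_zero_of_mem_cone (hΓ : IsClosedOrientedHypersurface Γ ν) {x : Pt n}
    (hx : x ∈ coneOver Γ) : x ≠ 0 := by
  obtain ⟨c, hc, p, hp, rfl⟩ := hx
  have := hΓ.norm_eq_one hp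
  intro h
  rcases smul_eq_zero.1 h with h | h
  · exact hc.ne' h
  · rw [h] at this; simp at this

lemma direction_mem (hΓ : IsClosedOrientedHypersurface Γ ν) {x : Pt n}
    (hx : x ∈ coneOver Γ) : ‖x‖⁻¹ • x ∈ Γ := by
  obtain ⟨c, hc, p, hp, rfl⟩ := hx
  rw [norm_smul, hΓ.norm_eq_one hp, mul_one, Real.norm_of_nonneg hc.le, smul_smul,
    inv_mul_cancel₀ hc.ne', one_smul]
  exact hp

lemma norm_coneField (hΓ : IsClosedOrientedHypersurface Γ ν) {x : Pt n} (hx : x ∈ coneOver Γ) :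
    ‖coneField ν x‖ = 1 := hΓ.unit _ (hΓ.direction_mem hx)

lemma inner_coneField (hΓ : IsClosedOrientedHypersurface Γ ν) {x : Pt n} (hx : x ∈ coneOver Γ) :
    ⟪x, coneField ν x⟫ = 0 := by
  have h := hΓ.tangent_sphere _ (hΓ.direction_mem hx)
  have h0 := norm_ne_zero_iff.2 (hΓ.ne_zero_of_mem_cone hx)
  rw [inner_smul_left] at h
  simpa [h0, coneField] using h

lemma eq_smul_direction (hΓ : IsClosedOrientedHypersurface Γ ν) {x : Pt n}
    (hx : x ∈ coneOver Γ) : x = ‖x‖ • (‖x‖⁻¹ • x) := by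
  rw [smul_smul, mul_inv_cancel₀ (norm_ne_zero_iff.2 (hΓ.ne_zero_of_mem_cone hx)), one_smul]

lemma sub_smul_direction_mem (hΓ : IsClosedOrientedHypersurface Γ ν) {x v : Pt n}
    (hx : x ∈ coneOver Γ) (hv : ⟪coneField ν x, v⟫ = 0) :
    v - ⟪‖x‖⁻¹ • x, v⟫ • (‖x‖⁻¹ • x) ∈ linkTangent ν (‖x‖⁻¹ • x) := by
  have hp := hΓ.direction_mem hx
  have h4 : ⟪ν (‖x‖⁻¹ • x), v⟫ = 0 := hv
  generalize ‖x‖⁻¹ • x = p at *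
  refine ⟨?_, ?_⟩
  · rw [inner_sub_right, inner_smul_right, real_inner_self_eq_norm_sq, hΓ.norm_eq_one hp]; ring
  · have h5 := hΓ.tangent_sphere p hp
    rw [real_inner_comm] at h5
    rw [inner_sub_right, inner_smul_right, h5, h4]; ring

/-- Tangential derivatives along the cone only depend on the restriction to the cone. -/
lemma fderiv_eq_of_eqOn_cone (hΓ : IsClosedOrientedHypersurface Γ ν) {F : Type*}
    [NormedAddCommGroup F] [NormedSpace ℝ F] {f g : Pt n → F} {x v : Pt n} (hx : x ∈ coneOver Γ)
    (hf : DifferentiableAt ℝ f x) (hg : DifferentiableAt ℝ g x)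
    (hfg : ∀ y ∈ coneOver Γ, f y = g y) (hv : ⟪coneField ν x, v⟫ = 0) :
    fderiv ℝ f x v = fderiv ℝ g x v := by
  set p := ‖x‖⁻¹ • x with hp
  set c := ‖x‖ with hc
  have hpΓ : p ∈ Γ := hΓ.direction_mem hx
  have hc0 : 0 < c := norm_pos_iff.2 (hΓ.ne_zero_of_mem_cone hx)
  have hxp : x = c • p := hΓ.eq_smul_direction hx
  have hpn := hΓ.norm_eq_one hpΓ
  have hline : ∀ h : Pt n → F, DifferentiableAt ℝ h x →
      HasDerivAt (fun t : ℝ => h (x + t • p)) (fderiv ℝ h x p) 0 :=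
    fun h hh => hh.hasFDerivAt.hasLineDerivAt p
  -- A tangent vector of the cone is a radial vector plus a vector tangent to the link. The radial
  -- derivative is read off along the ray, the other one after rescaling x to the unit sphere.
  have h1 : fderiv ℝ f x p = fderiv ℝ g x p := by
    refine (hline f hf).unique ((hline g hg).congr_of_eventuallyEq ?_)
    filter_upwards [Ioi_mem_nhds (a := -c) (b := (0 : ℝ)) (by linarith)] with t ht
    refine hfg _ ⟨c + t, by have : -c < t := ht; linarith, p, hpΓ, ?_⟩
    rw [add_smul, ← hxp]
  have hscale : ∀ h : Pt n → F, DifferentiableAt ℝ h x →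
      HasFDerivAt (fun q => h (c • q)) (c • fderiv ℝ h x) p := by
    intro h hh
    have h2 : HasFDerivAt h (fderiv ℝ h x) (c • p) := by rw [← hxp]; exact hh.hasFDerivAt
    refine (h2.comp p ((hasFDerivAt_id p).const_smul c)).congr_fderiv ?_
    ext w
    simp
  have h2 : ∀ w ∈ linkTangent ν p, fderiv ℝ f x w = fderiv ℝ g x w := by
    intro w hw
    have := hΓ.fderiv_eq_of_eqOn hpΓ (hscale f hf).differentiableAt (hscale g hg).differentiableAt
      (fun q hq => hfg _ ⟨c, hc0, q, hq, rfl⟩) hw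
    rw [(hscale f hf).fderiv, (hscale g hg).fderiv] at this
    exact smul_right_injective F hc0.ne' this
  have h3 : v - ⟪p, v⟫ • p ∈ linkTangent ν p := hΓ.sub_smul_direction_mem hx hv
  have h4 := h2 _ h3
  have h5 : ∀ T : Pt n →L[ℝ] F, T (v - ⟪p, v⟫ • p) = T v - ⟪p, v⟫ • T p := fun T => by
    rw [T.map_sub, T.map_smul]
  rw [h5, h5, h1] at h4
  exact sub_left_injective h4

lemma inner_coneField_proj (hΓ : IsClosedOrientedHypersurface Γ ν) {x : Pt n}
    (hx : x ∈ coneOver Γ) (i : Fin n) :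
    ⟪coneField ν x, EuclideanSpace.single i (1 : ℝ) - coneField ν x i • coneField ν x⟫ = 0 := by
  rw [inner_sub_right, inner_smul_right, real_inner_self_eq_norm_sq, hΓ.norm_coneField hx,
    EuclideanSpace.inner_single_right]
  simp

lemma tangD_eq_of_eqOn_cone (hΓ : IsClosedOrientedHypersurface Γ ν) {f g : Pt n → ℝ} {x : Pt n}
    (hx : x ∈ coneOver Γ) (hf : SmoothOffZero f) (hg : SmoothOffZero g)
    (hfg : ∀ y ∈ coneOver Γ, f y = g y) (i : Fin n) :
    tangD (coneField ν) i f x = tangD (coneField ν) i g x :=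
  hΓ.fderiv_eq_of_eqOn_cone hx (hf.differentiableAt (hΓ.ne_zero_of_mem_cone hx))
    (hg.differentiableAt (hΓ.ne_zero_of_mem_cone hx)) hfg (hΓ.inner_coneField_proj hx i)

/-- The derivative of the normal of the cone in terms of that of the link. -/
lemma fderiv_coneField (hΓ : IsClosedOrientedHypersurface Γ ν) {x : Pt n} (hx : x ≠ 0) (v : Pt n) :
    fderiv ℝ (coneField ν) x v =
      ‖x‖⁻¹ • fderiv ℝ ν (‖x‖⁻¹ • x) (v - ⟪‖x‖⁻¹ • x, v⟫ • (‖x‖⁻¹ • x)) := by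
  have hr : ‖x‖ ≠ 0 := norm_ne_zero_iff.2 hx
  have h1 := hasFDerivAt_comp_norm hx (hasDerivAt_inv hr)
  have h2 := h1.smul (hasFDerivAt_id x)
  have h3 : HasFDerivAt (coneField ν) _ x :=
    HasFDerivAt.comp (g := ν) (f := (fun y : Pt n => ‖y‖⁻¹) • id) x
      (hΓ.differentiable_normal (‖x‖⁻¹ • x)).hasFDerivAt h2
  rw [h3.fderiv, ← map_smul]
  simp only [ContinuousLinearMap.comp_apply]
  simp [inner_smul_left, smul_smul, smul_sub]
  rw [sub_eq_add_neg, ← neg_smul]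
  congr 2
  field_simp

end IsClosedOrientedHypersurface
end Cone

section ConeCalculus

variable {n : ℕ} {Γ : Set (Pt n)} {ν : Pt n → Pt n}

/-- The algebra of restrictions to the cone of the smooth functions on `ℝⁿ ∖ {0}`. -/
def coneAlgebra (Γ : Set (Pt n)) : Subalgebra ℝ (coneOver Γ → ℝ) where
  carrier := {f | ∃ F : Pt n → ℝ, SmoothOffZero F ∧ ∀ x : coneOver Γ, f x = F x}
  mul_mem' := by
    rintro _ _ ⟨F, hF, hf⟩ ⟨G, hG, hg⟩
    exact ⟨_, hF.mul hG, fun x => by rw [Pi.mul_apply, hf, hg]⟩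
  add_mem' := by
    rintro _ _ ⟨F, hF, hf⟩ ⟨G, hG, hg⟩
    exact ⟨_, hF.add hG, fun x => by rw [Pi.add_apply, hf, hg]⟩
  algebraMap_mem' c := ⟨_, .const c, fun _ => rfl⟩

/-- The restriction of a smooth function to the cone. -/
def coneRestrict (Γ : Set (Pt n)) {F : Pt n → ℝ} (hF : SmoothOffZero F) : coneAlgebra Γ :=
  ⟨fun x => F x, F, hF, fun _ => rfl⟩

/-- A smooth extension of an element of the algebra. -/
def coneExtend (f : coneAlgebra Γ) : Pt n → ℝ := f.2.choose

lemma smoothOffZero_coneExtend (f : coneAlgebra Γ) : SmoothOffZero (coneExtend f) :=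
  f.2.choose_spec.1

lemma coneExtend_apply (f : coneAlgebra Γ) (x : coneOver Γ) : coneExtend f x = f.1 x :=
  (f.2.choose_spec.2 x).symm

/-- Evaluation at a point of the cone. -/
def coneEval {x : Pt n} (hx : x ∈ coneOver Γ) : coneAlgebra Γ →ₐ[ℝ] ℝ :=
  (Pi.evalAlgHom ℝ (fun _ : coneOver Γ => ℝ) ⟨x, hx⟩).comp (coneAlgebra Γ).val

lemma coneEval_apply {x : Pt n} (hx : x ∈ coneOver Γ) (f : coneAlgebra Γ) :
    coneEval hx f = f.1 ⟨x, hx⟩ := rfl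

lemma coneAlgebra_ext {f g : coneAlgebra Γ}
    (h : ∀ (x : Pt n) (hx : x ∈ coneOver Γ), coneEval hx f = coneEval hx g) : f = g :=
  Subtype.ext (funext fun x => h x.1 x.2)

lemma coneEval_restrict {x : Pt n} (hx : x ∈ coneOver Γ) {F : Pt n → ℝ} (hF : SmoothOffZero F) :
    coneEval hx (coneRestrict Γ hF) = F x := rfl

lemma coneRestrict_extend (f : coneAlgebra Γ) :
    coneRestrict Γ (smoothOffZero_coneExtend f) = f :=
  Subtype.ext (funext fun x => coneExtend_apply f x)

namespace IsClosedOrientedHypersurface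

/-- Tangential differentiation on the cone. -/
def coneDerivFun (hΓ : IsClosedOrientedHypersurface Γ ν) (i : Fin n) (f : coneAlgebra Γ) :
    coneAlgebra Γ :=
  coneRestrict Γ ((smoothOffZero_coneExtend f).tangD (fun _ h => hΓ.contDiffAt_coneField h) i)

/-- The definition chooses an extension off the cone. Any other extension gives the same value,
because only derivatives along the cone enter. -/
lemma coneEval_coneDerivFun (hΓ : IsClosedOrientedHypersurface Γ ν) (i : Fin n)
    {f : coneAlgebra Γ} {F : Pt n → ℝ} (hF : SmoothOffZero F)
    (hfF : ∀ x (hx : x ∈ coneOver Γ), coneEval hx f = F x) {x : Pt n} (hx : x ∈ coneOver Γ) :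
    coneEval hx (hΓ.coneDerivFun i f) = tangD (coneField ν) i F x :=
  hΓ.tangD_eq_of_eqOn_cone hx (smoothOffZero_coneExtend f) hF
    (fun y hy => (coneExtend_apply f ⟨y, hy⟩).trans (hfF y hy)) i

lemma tangD_add {N : Pt n → Pt n} {f g : Pt n → ℝ} {x : Pt n} (i : Fin n)
    (hf : DifferentiableAt ℝ f x) (hg : DifferentiableAt ℝ g x) :
    tangD N i (fun y => f y + g y) x = tangD N i f x + tangD N i g x := by
  rw [tangD, fderiv_fun_add hf hg]
  rfl

/-- Tangential differentiation on the cone, as a derivation. -/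
def coneDeriv (hΓ : IsClosedOrientedHypersurface Γ ν) (i : Fin n) :
    Derivation ℝ (coneAlgebra Γ) (coneAlgebra Γ) :=
  Derivation.mk'
    { toFun := hΓ.coneDerivFun i
      map_add' := fun f g => coneAlgebra_ext fun x hx => by
        have hf := smoothOffZero_coneExtend f
        have hg := smoothOffZero_coneExtend g
        have h0 := hΓ.ne_zero_of_mem_cone hx
        rw [hΓ.coneEval_coneDerivFun i (hf.add hg) (fun y hy => by
          rw [map_add, coneEval_apply, coneEval_apply, coneExtend_apply f ⟨y, hy⟩,
            coneExtend_apply g ⟨y, hy⟩]) hx,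
          tangD_add i (hf.differentiableAt h0) (hg.differentiableAt h0), map_add]
        rfl
      map_smul' := fun c f => coneAlgebra_ext fun x hx => by
        have hf := smoothOffZero_coneExtend f
        have h0 := hΓ.ne_zero_of_mem_cone hx
        rw [hΓ.coneEval_coneDerivFun i ((SmoothOffZero.const c).mul hf) (fun y hy => by
          rw [map_smul, coneEval_apply, smul_eq_mul, coneExtend_apply f ⟨y, hy⟩]) hx,
          tangD_mul i (by fun_prop) (hf.differentiableAt h0)]
        have : tangD (coneField ν) i (fun _ => c) x = 0 := by simp [tangD]
        rw [this, zero_mul, zero_add, RingHom.id_apply, map_smul]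
        rfl }
    (fun f g => coneAlgebra_ext fun x hx => by
      have hf := smoothOffZero_coneExtend f
      have hg := smoothOffZero_coneExtend g
      have h0 := hΓ.ne_zero_of_mem_cone hx
      refine (hΓ.coneEval_coneDerivFun i (hf.mul hg) (fun y hy => ?_) hx).trans ?_
      · rw [map_mul, coneEval_apply, coneEval_apply, coneExtend_apply f ⟨y, hy⟩,
          coneExtend_apply g ⟨y, hy⟩]
      · rw [tangD_mul i (hf.differentiableAt h0) (hg.differentiableAt h0), map_add, smul_eq_mul,
          smul_eq_mul, map_mul, map_mul, coneEval_apply hx f, coneEval_apply hx g,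
          ← coneExtend_apply f, ← coneExtend_apply g]
        change _ = _ * tangD _ i _ x + _ * tangD _ i _ x
        ring)

lemma coneEval_coneDeriv (hΓ : IsClosedOrientedHypersurface Γ ν) (i : Fin n)
    {f : coneAlgebra Γ} {F : Pt n → ℝ} (hF : SmoothOffZero F)
    (hfF : ∀ x (hx : x ∈ coneOver Γ), coneEval hx f = F x) {x : Pt n} (hx : x ∈ coneOver Γ) :
    coneEval hx (hΓ.coneDeriv i f) = tangD (coneField ν) i F x :=
  hΓ.coneEval_coneDerivFun i hF hfF hx

lemma coneDeriv_restrict (hΓ : IsClosedOrientedHypersurface Γ ν) (i : Fin n)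
    {F : Pt n → ℝ} (hF : SmoothOffZero F) : hΓ.coneDeriv i (coneRestrict Γ hF) =
      coneRestrict Γ (hF.tangD (fun _ h => hΓ.contDiffAt_coneField h) i) :=
  coneAlgebra_ext fun _ hx => hΓ.coneEval_coneDeriv i hF (fun _ _ => rfl) hx

/-- The components of the normal, as elements of the algebra. -/
def coneNormalCoord (hΓ : IsClosedOrientedHypersurface Γ ν) (i : Fin n) : coneAlgebra Γ :=
  coneRestrict Γ (hΓ.smoothOffZero_coneField i)

/-- The coordinates, as elements of the algebra. -/
def coneCoord (Γ : Set (Pt n)) (i : Fin n) : coneAlgebra Γ := coneRestrict Γ (.coord i)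

/-- The tangential derivatives of the normal are the entries of a symmetric matrix. -/
lemma inner_fderiv_coneField_comm (hΓ : IsClosedOrientedHypersurface Γ ν) {x v w : Pt n}
    (hx : x ∈ coneOver Γ) (hv : ⟪coneField ν x, v⟫ = 0) (hw : ⟪coneField ν x, w⟫ = 0) :
    ⟪fderiv ℝ (coneField ν) x v, w⟫ = ⟪fderiv ℝ (coneField ν) x w, v⟫ := by
  have h0 := hΓ.ne_zero_of_mem_cone hx
  have hp := hΓ.direction_mem hx
  have hv' := hΓ.sub_smul_direction_mem hx hv
  have hw' := hΓ.sub_smul_direction_mem hx hw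
  rw [hΓ.fderiv_coneField h0, hΓ.fderiv_coneField h0]
  generalize ‖x‖⁻¹ • x = p at *
  rw [inner_smul_left, inner_smul_left]
  have h1 := hΓ.inner_fderiv_normal_comm hp hv' hw'
  have h2 : ∀ y ∈ linkTangent ν p, ⟪fderiv ℝ ν p y, p⟫ = 0 := fun y hy => by
    rw [real_inner_comm]; exact hΓ.inner_fderiv_normal_self hp hy
  rw [inner_sub_right, inner_sub_right, inner_smul_right, inner_smul_right, h2 _ hv',
    h2 _ hw', mul_zero, mul_zero, sub_zero, sub_zero] at h1
  rw [h1]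

lemma inner_coneField_fderiv (hΓ : IsClosedOrientedHypersurface Γ ν) {x v : Pt n}
    (hx : x ∈ coneOver Γ) (hv : ⟪coneField ν x, v⟫ = 0) :
    ⟪coneField ν x, fderiv ℝ (coneField ν) x v⟫ = 0 := by
  have h0 := hΓ.ne_zero_of_mem_cone hx
  have hp := hΓ.direction_mem hx
  rw [hΓ.fderiv_coneField h0, inner_smul_right]
  have hmem := hΓ.sub_smul_direction_mem hx hv
  have := hΓ.inner_fderiv_normal_normal hp hmem
  change ‖x‖⁻¹ * ⟪ν (‖x‖⁻¹ • x), _⟫ = 0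
  rw [this, mul_zero]

lemma fderiv_coneField_self (hΓ : IsClosedOrientedHypersurface Γ ν) {x : Pt n} (hx : x ≠ 0) :
    fderiv ℝ (coneField ν) x x = 0 := by
  rw [hΓ.fderiv_coneField hx, inner_smul_left, real_inner_self_eq_norm_sq]
  have hr : ‖x‖ ≠ 0 := norm_ne_zero_iff.2 hx
  have : x - ((starRingEnd ℝ) ‖x‖⁻¹ * ‖x‖ ^ 2) • (‖x‖⁻¹ • x) = 0 := by
    rw [smul_smul, sub_eq_zero]
    simp
    field_simp
    rw [one_smul]
  rw [this, map_zero, smul_zero]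

/-- `P_i = e_i - N_i N`. -/
lemma tangD_coneField_apply (hΓ : IsClosedOrientedHypersurface Γ ν) {x : Pt n} (hx : x ≠ 0)
    (i j : Fin n) : tangD (coneField ν) i (fun y => coneField ν y j) x =
      fderiv ℝ (coneField ν) x (EuclideanSpace.single i 1 - coneField ν x i • coneField ν x) j :=
  fderiv_coord ((hΓ.contDiffAt_coneField hx).differentiableAt (by simp)) _ j

lemma tangD_coneField_comm (hΓ : IsClosedOrientedHypersurface Γ ν) {x : Pt n}
    (hx : x ∈ coneOver Γ) (i j : Fin n) : tangD (coneField ν) i (fun y => coneField ν y j) x =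
      tangD (coneField ν) j (fun y => coneField ν y i) x := by
  have h0 := hΓ.ne_zero_of_mem_cone hx
  rw [hΓ.tangD_coneField_apply h0, hΓ.tangD_coneField_apply h0]
  have h := hΓ.inner_fderiv_coneField_comm hx (hΓ.inner_coneField_proj hx i)
    (hΓ.inner_coneField_proj hx j)
  have h1 := fun k => (real_inner_comm _ _).trans
    (hΓ.inner_coneField_fderiv hx (hΓ.inner_coneField_proj hx k))
  rw [inner_sub_right, inner_smul_right, inner_sub_right, inner_smul_right, h1, h1, mul_zero, mul_zero,
    sub_zero, sub_zero, EuclideanSpace.inner_single_right, EuclideanSpace.inner_single_right] at h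
  simpa using h

/-- Minimality of the link is minimality of the cone. -/
lemma sum_tangD_coneField (hΓ : IsClosedOrientedHypersurface Γ ν) (hmin : IsMinimalInSphere Γ ν)
    {x : Pt n} (hx : x ∈ coneOver Γ) :
    ∑ i, tangD (coneField ν) i (fun y => coneField ν y i) x = 0 := by
  have h0 := hΓ.ne_zero_of_mem_cone hx
  have hp := hΓ.direction_mem hx
  -- The sum is the trace of DN composed with the projection onto the complement of N. The range
  -- lies in the tangent space of the link, so the trace may be taken on that (n-2)-dimensional
  -- space, where minimality of Γ applies.
  set M : Pt n →ₗ[ℝ] Pt n := (fderiv ℝ (coneField ν) x : Pt n →ₗ[ℝ] Pt n) ∘ₗ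
    (LinearMap.id - (innerSL ℝ (coneField ν x) : Pt n →ₗ[ℝ] ℝ).smulRight (coneField ν x)) with hM
  have hMv : ∀ v, M v = fderiv ℝ (coneField ν) x (v - ⟪coneField ν x, v⟫ • coneField ν x) :=
    fun v => rfl
  have hperp : ∀ v, ⟪coneField ν x, v - ⟪coneField ν x, v⟫ • coneField ν x⟫ = 0 := by
    intro v
    rw [inner_sub_right, inner_smul_right, real_inner_self_eq_norm_sq, hΓ.norm_coneField hx]
    ring
  have hmem : ∀ v, M v ∈ linkTangentSubmodule ν (‖x‖⁻¹ • x) := by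
    intro v
    rw [hMv, hΓ.fderiv_coneField h0]
    refine Submodule.smul_mem _ _ (mem_linkTangentSubmodule.2 ?_)
    exact hΓ.fderiv_normal_mem_linkTangent hp (hΓ.sub_smul_direction_mem hx (hperp v))
  have h1 : ∑ i, tangD (coneField ν) i (fun y => coneField ν y i) x = LinearMap.trace ℝ _ M := by
    rw [LinearMap.trace_eq_sum_inner M (EuclideanSpace.basisFun (Fin n) ℝ)]
    refine Finset.sum_congr rfl fun i _ => ?_
    rw [hΓ.tangD_coneField_apply h0, hMv]
    simp [EuclideanSpace.inner_single_left, EuclideanSpace.inner_single_right]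
  rw [h1, ← LinearMap.trace_restrict_eq_of_forall_mem _ M hmem]
  set e := (stdOrthonormalBasis ℝ (linkTangentSubmodule ν (‖x‖⁻¹ • x))).reindex
    (finCongr (hΓ.finrank_linkTangentSubmodule hp)) with he
  rw [LinearMap.trace_eq_sum_inner _ e]
  have hmem' : ∀ i, (e i : Pt n) ∈ linkTangent ν (‖x‖⁻¹ • x) :=
    fun i => mem_linkTangentSubmodule.1 (e i).2
  have h2 := hmin _ hp (fun i => (e i : Pt n))
    (e.orthonormal.comp_linearIsometry (Submodule.subtypeₗᵢ _)) hmem'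
  have h3 : ∀ i, ⟪e i, M.restrict (fun v _ => hmem v) (e i)⟫ =
      -(‖x‖⁻¹ * linkSecondForm ν (‖x‖⁻¹ • x) (e i) (e i)) := by
    intro i
    have h4 : ⟪coneField ν x, (e i : Pt n)⟫ = 0 := (hmem' i).2
    have h5 : ⟪‖x‖⁻¹ • x, (e i : Pt n)⟫ = 0 := (hmem' i).1
    rw [Submodule.coe_inner, LinearMap.coe_restrict_apply, hMv, h4, zero_smul, sub_zero,
      hΓ.fderiv_coneField h0, h5, zero_smul, sub_zero, inner_smul_right, linkSecondForm,
      real_inner_comm]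
    ring
  rw [Finset.sum_congr rfl fun i _ => h3 i, Finset.sum_neg_distrib, ← Finset.mul_sum, h2]
  simp

lemma sum_coneField_mul_self (hΓ : IsClosedOrientedHypersurface Γ ν) {x : Pt n}
    (hx : x ∈ coneOver Γ) : ∑ i, coneField ν x i * coneField ν x i = 1 := by
  have : ‖coneField ν x‖ ^ 2 = ∑ i, coneField ν x i * coneField ν x i := by
    rw [EuclideanSpace.norm_sq_eq]; simp [sq]
  rw [← this, hΓ.norm_coneField hx, one_pow]

lemma sum_coneField_mul_tangD (hΓ : IsClosedOrientedHypersurface Γ ν) {x : Pt n}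
    (hx : x ∈ coneOver Γ) (f : Pt n → ℝ) :
    ∑ i, coneField ν x i * tangD (coneField ν) i f x = 0 := by
  simp only [tangD_eq, mul_sub, Finset.sum_sub_distrib, ← mul_assoc, ← Finset.sum_mul,
    hΓ.sum_coneField_mul_self hx, ← fderiv_apply_eq_sum]
  ring

/-- The tangential calculus on the cone over a minimal link. -/
theorem minimalConeCalculus (hΓ : IsClosedOrientedHypersurface Γ ν)
    (hmin : IsMinimalInSphere Γ ν) : MinimalConeCalculus n (coneAlgebra Γ) hΓ.coneDeriv
      hΓ.coneNormalCoord (coneCoord Γ) where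
  normal_sq := coneAlgebra_ext fun x hx => by
    simp only [map_sum, map_mul, map_one]
    exact hΓ.sum_coneField_mul_self hx
  normal_D f := coneAlgebra_ext fun x hx => by
    simp only [map_sum, map_mul, map_zero]
    exact hΓ.sum_coneField_mul_tangD hx _
  symm i j := by
    rw [coneNormalCoord, coneNormalCoord, coneDeriv_restrict, coneDeriv_restrict]
    exact coneAlgebra_ext fun x hx => hΓ.tangD_coneField_comm hx i j
  comm i j f := by
    obtain ⟨F, hF, rfl⟩ : ∃ F, ∃ hF : SmoothOffZero F, coneRestrict Γ hF = f :=
      ⟨_, _, coneRestrict_extend f⟩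
    refine coneAlgebra_ext fun x hx => ?_
    have h0 := hΓ.ne_zero_of_mem_cone hx
    simp only [coneNormalCoord, coneDeriv_restrict, map_sub, map_sum, map_mul, coneEval_restrict]
    rw [tangD_tangD (fun _ h => hΓ.contDiffAt_coneField h) hF h0,
      tangD_tangD (fun _ h => hΓ.contDiffAt_coneField h) hF h0]
    have hs : ∀ i, fderiv ℝ F x (fderiv ℝ (coneField ν) x
        (EuclideanSpace.single i 1 - coneField ν x i • coneField ν x)) =
        ∑ k, tangD (coneField ν) i (fun y => coneField ν y k) x * tangD (coneField ν) k F x := by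
      intro i
      rw [← sum_mul_tangD (coneField ν) F _ (by
        rw [real_inner_comm]
        exact hΓ.inner_coneField_fderiv hx (hΓ.inner_coneField_proj hx i))]
      exact Finset.sum_congr rfl fun k _ => by rw [hΓ.tangD_coneField_apply h0]
    -- In the difference of the two second derivatives the Hessian terms cancel by symmetry, and the
    -- terms with ∂_N F cancel because D_i N_j is symmetric.
    have hsymm : IsSymmSndFDerivAt ℝ F x := (hF x h0).isSymmSndFDerivAt (by simp; norm_cast)
    rw [hs, hs, hsymm.eq, hΓ.tangD_coneField_comm hx i j]
    simp only [sub_mul, Finset.sum_sub_distrib, mul_assoc, ← Finset.mul_sum]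
    ring
  minimal := coneAlgebra_ext fun x hx => by
    simp only [coneNormalCoord, coneDeriv_restrict, map_sum, map_zero, coneEval_restrict]
    exact hΓ.sum_tangD_coneField hmin hx
  D_coord i j := coneAlgebra_ext fun x hx => by
    rw [coneCoord, coneDeriv_restrict, coneEval_restrict]
    have h1 : coneEval hx (if i = j then (1 : coneAlgebra Γ) else 0) = if i = j then 1 else 0 := by
      split_ifs <;> simp
    rw [map_sub, map_mul, h1, coneNormalCoord, coneNormalCoord, coneEval_restrict,
      coneEval_restrict, tangD, fderiv_coord (N := fun y => y) differentiableAt_id]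
    simp [eq_comm]
  coord_normal := coneAlgebra_ext fun x hx => by
    simp only [map_sum, map_mul, map_zero]
    have h := hΓ.inner_coneField hx
    rw [PiLp.inner_apply] at h
    simp only [RCLike.inner_apply, conj_trivial] at h
    rw [← h]
    exact Finset.sum_congr rfl fun i _ => mul_comm _ _
  radial_normal j := coneAlgebra_ext fun x hx => by
    have h0 := hΓ.ne_zero_of_mem_cone hx
    simp only [coneNormalCoord, coneDeriv_restrict, map_sum, map_mul, map_zero, coneEval_restrict,
      coneCoord]
    rw [sum_mul_tangD _ _ _ (hΓ.inner_coneField hx),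
      fderiv_coord ((hΓ.contDiffAt_coneField h0).differentiableAt (by simp)),
      hΓ.fderiv_coneField_self h0]
    simp

end IsClosedOrientedHypersurface
end ConeCalculus

/-! ### The area measure of the cone -/

lemma euclideanHausdorffMeasure_image_le {X Y : Type*} [EMetricSpace X] [MeasurableSpace X]
    [BorelSpace X] [EMetricSpace Y] [MeasurableSpace Y] [BorelSpace Y] {f : X → Y} {s : Set X}
    {K : NNReal} (hf : LipschitzOnWith K f s) (d : ℕ) :
    μHE[d] (f '' s) ≤ (K : ENNReal) ^ d * μHE[d] s := by
  simp only [Measure.euclideanHausdorffMeasure_def, Measure.smul_apply]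
  have h := hf.hausdorffMeasure_image_le (d := d) (by positivity)
  rw [ENNReal.rpow_natCast] at h
  rw [ENNReal.smul_def, ENNReal.smul_def, smul_eq_mul, smul_eq_mul, mul_left_comm]
  gcongr

namespace IsClosedOrientedHypersurface

variable {n : ℕ} {Γ : Set (Pt n)} {ν : Pt n → Pt n}

lemma mem_cone_iff (hΓ : IsClosedOrientedHypersurface Γ ν) {x : Pt n} :
    x ∈ coneOver Γ ↔ x ≠ 0 ∧ ‖x‖⁻¹ • x ∈ Γ := by
  refine ⟨fun h => ⟨hΓ.ne_zero_of_mem_cone h, hΓ.direction_mem h⟩, fun ⟨h0, h⟩ => ?_⟩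
  refine ⟨‖x‖, norm_pos_iff.2 h0, _, h, ?_⟩
  rw [smul_smul, mul_inv_cancel₀ (norm_ne_zero_iff.2 h0), one_smul]

lemma measurableSet_cone (hΓ : IsClosedOrientedHypersurface Γ ν) :
    MeasurableSet (coneOver Γ) := by
  have h : coneOver Γ = {0}ᶜ ∩ (fun x : Pt n => ‖x‖⁻¹ • x) ⁻¹' Γ := by
    ext x
    rw [hΓ.mem_cone_iff]
    rfl
  rw [h]
  refine (measurableSet_singleton _).compl.inter ?_
  have hm : Measurable fun x : Pt n => ‖x‖⁻¹ • x := by fun_prop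
  exact hm hΓ.isCompact.isClosed.measurableSet

lemma isCompact_cone_annulus (hΓ : IsClosedOrientedHypersurface Γ ν) {a b : ℝ} (ha : 0 < a) :
    IsCompact (coneOver Γ ∩ {x | a ≤ ‖x‖ ∧ ‖x‖ ≤ b}) := by
  have h : coneOver Γ ∩ {x | a ≤ ‖x‖ ∧ ‖x‖ ≤ b} =
      (fun q : ℝ × Pt n => q.1 • q.2) '' (Set.Icc a b ×ˢ Γ) := by
    ext x
    constructor
    · rintro ⟨hx, h1, h2⟩
      exact ⟨(‖x‖, ‖x‖⁻¹ • x), ⟨⟨h1, h2⟩, hΓ.direction_mem hx⟩, (hΓ.eq_smul_direction hx).symm⟩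
    · rintro ⟨⟨t, p⟩, ⟨⟨h1, h2⟩, hp⟩, rfl⟩
      have ht : 0 < t := ha.trans_le h1
      have : ‖t • p‖ = t := by rw [norm_smul, hΓ.norm_eq_one hp, mul_one, Real.norm_of_nonneg ht.le]
      refine ⟨⟨t, ht, p, hp, rfl⟩, ?_⟩
      simp only [Set.mem_ofPred_eq, this]
      exact ⟨h1, h2⟩
  rw [h]
  exact (isCompact_Icc.prod hΓ.isCompact).image (by fun_prop)

/-- Local charts of the cone: two mutually inverse smooth maps. -/
lemma exists_cone_chart (hΓ : IsClosedOrientedHypersurface Γ ν) (hn : 2 ≤ n) {x : Pt n}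
    (hx : x ∈ coneOver Γ) : ∃ (L : Submodule ℝ (Pt n)) (Θ : Pt n → L × ℝ) (Ψ : L × ℝ → Pt n),
      Module.finrank ℝ (L × ℝ) = n - 1 ∧ ContDiffAt ℝ 1 Θ x ∧ ContDiffAt ℝ 1 Ψ (Θ x) ∧
      Ψ (Θ x) = x ∧ (∀ᶠ y in 𝓝[coneOver Γ] x, Ψ (Θ y) = y) ∧
      ∀ᶠ q in 𝓝 (Θ x), Ψ q ∈ coneOver Γ ∧ Θ (Ψ q) = q := by
  have h0 := hΓ.ne_zero_of_mem_cone hx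
  have hp := hΓ.direction_mem hx
  obtain ⟨Φ, L, hs, hΦ⟩ := hΓ.exists_chart hp
  have hr : ‖x‖ ≠ 0 := norm_ne_zero_iff.2 h0
  set d : Pt n → Pt n := fun y => ‖y‖⁻¹ • y with hd
  have hdx : ContDiffAt ℝ ∞ d x := ((contDiffAt_norm ℝ h0).inv hr).smul contDiffAt_id
  have hΦx : ContDiffAt ℝ ∞ (fun y => Φ (d y)) x := 
    ContDiffAt.comp (g := Φ) (f := d) x (hΦ.contDiffAt hs) hdx
  have hLmem : Φ (d x) ∈ L := (hΦ.mem_iff _ hs).1 hp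
  have hproj : ∀ y, y ∈ L → (L.orthogonalProjectionOnto y : Pt n) = y := fun y hy =>
    Submodule.starProjection_eq_self_iff.2 hy
  set Θ : Pt n → L × ℝ := fun y => (L.orthogonalProjectionOnto (Φ (d y)), ‖y‖) with hΘ
  set Ψ : L × ℝ → Pt n := fun q => q.2 • Φ.symm (q.1 : Pt n) with hΨ
  have hΘx : ContDiffAt ℝ ∞ Θ x :=
    (L.orthogonalProjectionOnto.contDiff.contDiffAt.comp x hΦx).prodMk (contDiffAt_norm ℝ h0)
  have hΘ1 : ((Θ x).1 : Pt n) = Φ (d x) := hproj _ hLmem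
  have hΨx : ContDiffAt ℝ ∞ Ψ (Θ x) := by
    refine contDiffAt_snd.smul (ContDiffAt.comp (g := Φ.symm) (f := fun q : L × ℝ => (q.1 : Pt n)) (Θ x) ?_ ?_)
    · rw [hΘ1]
      exact hΦ.contDiffAt_symm (Φ.map_source hs)
    · exact (L.subtypeL.contDiff.contDiffAt).comp _ contDiffAt_fst
  have hdc : ∀ y ∈ coneOver Γ, d y ∈ Φ.source → Ψ (Θ y) = y := by
    intro y hy hys
    have h1 : ((Θ y).1 : Pt n) = Φ (d y) := hproj _ ((hΦ.mem_iff _ hys).1 (hΓ.direction_mem hy))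
    simp only [hΨ, h1]
    rw [Φ.left_inv hys]
    exact (hΓ.eq_smul_direction hy).symm
  refine ⟨L, Θ, Ψ, ?_, hΘx.of_le (by simp), hΨx.of_le (by simp), hdc x hx hs, ?_, ?_⟩
  · rw [Module.finrank_prod, hΦ.finrank, Module.finrank_self]
    omega
  · have h1 : ∀ᶠ y in 𝓝 x, d y ∈ Φ.source :=
      hdx.continuousAt.eventually (Φ.open_source.mem_nhds hs)
    filter_upwards [self_mem_nhdsWithin, nhdsWithin_le_nhds h1] with y hy hys
    exact hdc y hy hys
  · have h1 : ∀ᶠ q : L × ℝ in 𝓝 (Θ x), (q.1 : Pt n) ∈ Φ.target := by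
      have hc : ContinuousAt (fun q : L × ℝ => (q.1 : Pt n)) (Θ x) := by fun_prop
      refine hc.eventually (Φ.open_target.mem_nhds ?_)
      change ((Θ x).1 : Pt n) ∈ Φ.target
      rw [hΘ1]
      exact Φ.map_source hs
    have h2 : ∀ᶠ q : L × ℝ in 𝓝 (Θ x), 0 < q.2 := by
      have hc : ContinuousAt (fun q : L × ℝ => q.2) (Θ x) := by fun_prop
      exact hc.eventually (lt_mem_nhds (norm_pos_iff.2 h0))
    filter_upwards [h1, h2] with q hq1 hq2
    have hm : Φ.symm (q.1 : Pt n) ∈ Γ := hΦ.symm_mem hq1 q.1.2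
    have hnorm : ‖Ψ q‖ = q.2 := by
      simp only [hΨ]
      rw [norm_smul, hΓ.norm_eq_one hm, mul_one, Real.norm_of_nonneg hq2.le]
    refine ⟨⟨q.2, hq2, _, hm, rfl⟩, ?_⟩
    have hdq : d (Ψ q) = Φ.symm (q.1 : Pt n) := by
      simp only [hd, hnorm]
      rw [smul_smul, inv_mul_cancel₀ hq2.ne', one_smul]
    refine Prod.ext ?_ hnorm
    simp only [hΘ, hdq, Φ.right_inv hq1]
    exact Subtype.ext (hproj _ q.1.2)

/-- The inverse chart is locally Lipschitz, so near x the cone lies in the Lipschitz image of a set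
of finite measure in the (n-1)-dimensional space L × ℝ. -/
lemma finiteAtFilter_cone (hΓ : IsClosedOrientedHypersurface Γ ν) (hn : 2 ≤ n) {x : Pt n}
    (hx : x ∈ coneOver Γ) :
    (μHE[n - 1] : Measure (Pt n)).FiniteAtFilter (𝓝[coneOver Γ] x) := by
  obtain ⟨L, Θ, Ψ, hfr, hΘ, hΨ, -, h1, -⟩ := hΓ.exists_cone_chart hn hx
  obtain ⟨K, t, ht, hK⟩ := hΨ.exists_lipschitzOnWith
  have hfin : ∃ s ∈ 𝓝 (Θ x), (μHE[n - 1] : Measure (L × ℝ)) s < ⊤ := by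
    rw [← hfr]
    exact (μHE[Module.finrank ℝ (L × ℝ)] : Measure (L × ℝ)).finiteAt_nhds _
  obtain ⟨s, hs, hsf⟩ := hfin
  refine ⟨Ψ '' (s ∩ t), ?_, ?_⟩
  · filter_upwards [h1, nhdsWithin_le_nhds (hΘ.continuousAt.eventually (inter_mem hs ht))]
      with y hy hy2
    exact ⟨Θ y, hy2, hy⟩
  · refine (euclideanHausdorffMeasure_image_le (hK.mono Set.inter_subset_right) _).trans_lt ?_
    exact ENNReal.mul_lt_top (ENNReal.pow_lt_top ENNReal.coe_lt_top)
      ((measure_mono Set.inter_subset_left).trans_lt hsf)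

/-- The chart is locally Lipschitz and maps the piece of the cone onto a neighbourhood in L × ℝ,
which has positive measure; a Lipschitz image of a null set would be null. -/
lemma measure_cone_inter_pos (hΓ : IsClosedOrientedHypersurface Γ ν) (hn : 2 ≤ n) {x : Pt n}
    (hx : x ∈ coneOver Γ) {U : Set (Pt n)} (hU : U ∈ 𝓝 x) :
    0 < μHE[n - 1] (coneOver Γ ∩ U) := by
  obtain ⟨L, Θ, Ψ, hfr, hΘ, hΨ, hΨΘ, -, h2⟩ := hΓ.exists_cone_chart hn hx
  obtain ⟨K, t, ht, hK⟩ := hΘ.exists_lipschitzOnWith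
  have hsub : Θ '' (coneOver Γ ∩ U ∩ t) ∈ 𝓝 (Θ x) := by
    have hc := hΨ.continuousAt
    rw [ContinuousAt, hΨΘ] at hc
    filter_upwards [h2, hc (inter_mem hU ht)] with q hq hq2
    exact ⟨Ψ q, ⟨⟨hq.1, hq2.1⟩, hq2.2⟩, hq.2⟩
  have hpos : 0 < (μHE[n - 1] : Measure (L × ℝ)) (Θ '' (coneOver Γ ∩ U ∩ t)) := by
    rw [← hfr]
    exact Measure.measure_pos_of_mem_nhds _ hsub
  have hle := euclideanHausdorffMeasure_image_le (hK.mono Set.inter_subset_right) (n - 1)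
    (s := coneOver Γ ∩ U ∩ t)
  have h3 := hpos.trans_le hle
  have h4 : 0 < μHE[n - 1] (coneOver Γ ∩ U ∩ t) := by
    rw [pos_iff_ne_zero] at h3 ⊢
    intro h
    rw [h, mul_zero] at h3
    exact h3 rfl
  exact h4.trans_le (measure_mono Set.inter_subset_left)

lemma measure_cone_annulus_lt_top (hΓ : IsClosedOrientedHypersurface Γ ν) (hn : 2 ≤ n) {a b : ℝ}
    (ha : 0 < a) : μHE[n - 1] (coneOver Γ ∩ {x | a ≤ ‖x‖ ∧ ‖x‖ ≤ b}) < ⊤ :=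
  (hΓ.isCompact_cone_annulus ha).measure_lt_top_of_nhdsWithin fun _ hx =>
    (hΓ.finiteAtFilter_cone hn hx.1).filter_mono (nhdsWithin_mono _ Set.inter_subset_left)

end IsClosedOrientedHypersurface

lemma map_smul_euclideanHausdorffMeasure {n : ℕ} (d : ℕ) {c : ℝ} (hc : 0 < c) :
    (μHE[d] : Measure (Pt n)) =
      ENNReal.ofReal (c ^ d) • (μHE[d] : Measure (Pt n)).map fun x => c • x := by
  refine Measure.ext fun A hA => ?_
  have hm : Measurable fun x : Pt n => c • x := by fun_prop
  rw [Measure.smul_apply, Measure.map_apply hm hA, Set.preimage_smul₀ hc.ne',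
    Measure.euclideanHausdorffMeasure_smul₀ d (inv_ne_zero hc.ne'), smul_eq_mul,
    ENNReal.smul_def, smul_eq_mul, ← mul_assoc]
  have : ENNReal.ofReal (c ^ d) * ((‖c⁻¹‖₊ ^ d : NNReal) : ENNReal) = 1 := by
    rw [← ENNReal.ofReal_coe_nnreal, ← ENNReal.ofReal_mul (by positivity)]
    push_cast
    rw [Real.norm_of_nonneg (by positivity), ← mul_pow, mul_inv_cancel₀ hc.ne', one_pow,
      ENNReal.ofReal_one]
  rw [this, one_mul]

namespace IsClosedOrientedHypersurface

variable {n : ℕ} {Γ : Set (Pt n)} {ν : Pt n → Pt n}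

lemma integrableOn_cone_annulus (hΓ : IsClosedOrientedHypersurface Γ ν) (hn : 2 ≤ n) {a b : ℝ}
    (ha : 0 < a) {f : Pt n → ℝ} (hf : ContinuousOn f {0}ᶜ) :
    IntegrableOn f (coneOver Γ ∩ {x | a ≤ ‖x‖ ∧ ‖x‖ ≤ b}) μHE[n - 1] := by
  set S := coneOver Γ ∩ {x : Pt n | a ≤ ‖x‖ ∧ ‖x‖ ≤ b} with hS
  have hc : IsCompact S := hΓ.isCompact_cone_annulus ha
  have : IsFiniteMeasure ((μHE[n - 1] : Measure (Pt n)).restrict S) :=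
    ⟨by simpa using hΓ.measure_cone_annulus_lt_top hn ha⟩
  have h1 : ContinuousOn f S := hf.mono fun x hx => hΓ.ne_zero_of_mem_cone hx.1
  have h2 := h1.integrableOn_compact (μ := (μHE[n - 1] : Measure (Pt n)).restrict S) hc
  rwa [IntegrableOn, Measure.restrict_restrict hc.measurableSet, Set.inter_self] at h2

/-- The push-forward under `log |x|` of `G |x|^{1-n}` times the area of the cone. -/
def radialMeasure (Γ : Set (Pt n)) (G : Pt n → ℝ) : Measure ℝ :=
  (((μHE[n - 1] : Measure (Pt n)).restrict (coneOver Γ)).withDensity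
    fun x => ENNReal.ofReal (G x * (‖x‖ ^ (n - 1))⁻¹)).map fun x => Real.log ‖x‖

lemma measurable_log_norm : Measurable fun x : Pt n => Real.log ‖x‖ := by fun_prop

lemma radialMeasure_apply (G : Pt n → ℝ) {A : Set ℝ}
    (hA : MeasurableSet A) : radialMeasure Γ G A =
      ∫⁻ x in coneOver Γ ∩ {x | Real.log ‖x‖ ∈ A}, ENNReal.ofReal (G x * (‖x‖ ^ (n - 1))⁻¹)
        ∂μHE[n - 1] := by
  have hpre : MeasurableSet ((fun x : Pt n => Real.log ‖x‖) ⁻¹' A) := measurable_log_norm hA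
  rw [radialMeasure, Measure.map_apply measurable_log_norm hA, withDensity_apply _ hpre,
    Measure.restrict_restrict hpre, Set.inter_comm]
  rfl

/-- The dilation by eˢ preserves the cone and acts on log |x| as the translation by s. The factor
|x|^{1-n} compensates the scaling of the area, and G is invariant by homogeneity. -/
lemma radialMeasure_preimage_add (hΓ : IsClosedOrientedHypersurface Γ ν) {G : Pt n → ℝ}
    (hG : ∀ c : ℝ, 0 < c → ∀ x, G (c • x) = G x) (s : ℝ) {A : Set ℝ} (hA : MeasurableSet A) :
    radialMeasure Γ G ((fun t => s + t) ⁻¹' A) = radialMeasure Γ G A := by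
  have hA' : MeasurableSet ((fun t => s + t) ⁻¹' A) := measurable_const_add s hA
  set c := Real.exp s with hc
  have hc0 : 0 < c := Real.exp_pos s
  have hms : ∀ {B : Set ℝ}, MeasurableSet B →
      MeasurableSet (coneOver Γ ∩ {x : Pt n | Real.log ‖x‖ ∈ B}) :=
    fun hB => hΓ.measurableSet_cone.inter (measurable_log_norm hB)
  rw [radialMeasure_apply G hA, radialMeasure_apply G hA',
    ← lintegral_indicator (hms hA), ← lintegral_indicator (hms hA')]
  conv_rhs => rw [map_smul_euclideanHausdorffMeasure (n := n) (n - 1) hc0]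
  have hme : MeasurableEmbedding fun x : Pt n => c • x :=
    (Homeomorph.smulOfNeZero c hc0.ne').measurableEmbedding
  rw [lintegral_smul_measure, hme.lintegral_map, smul_eq_mul, ← lintegral_const_mul' _ _ (by simp)]
  refine lintegral_congr fun x => ?_
  by_cases hx : x ∈ coneOver Γ
  · have h0 : 0 < ‖x‖ := norm_pos_iff.2 (hΓ.ne_zero_of_mem_cone hx)
    have hcx : c • x ∈ coneOver Γ := by
      obtain ⟨r, hr, p, hp, rfl⟩ := hx
      exact ⟨c * r, by positivity, p, hp, by rw [smul_smul]⟩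
    have hnorm : ‖c • x‖ = c * ‖x‖ := by rw [norm_smul, Real.norm_of_nonneg hc0.le]
    have hlog : Real.log ‖c • x‖ = s + Real.log ‖x‖ := by
      rw [hnorm, Real.log_mul hc0.ne' h0.ne', hc, Real.log_exp]
    by_cases hxA : s + Real.log ‖x‖ ∈ A
    · rw [Set.indicator_of_mem (show x ∈ coneOver Γ ∩ {x | Real.log ‖x‖ ∈ (fun t => s + t) ⁻¹' A} from ⟨hx, hxA⟩), Set.indicator_of_mem
        (show c • x ∈ coneOver Γ ∩ {x | Real.log ‖x‖ ∈ A} from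
          ⟨hcx, by simpa [hlog] using hxA⟩), hG c hc0, hnorm,
        ← ENNReal.ofReal_mul (by positivity)]
      congr 1
      rw [mul_pow]
      field_simp
    · rw [Set.indicator_of_notMem (fun h => hxA h.2), Set.indicator_of_notMem
        (fun h => hxA (by have := h.2; simpa [hlog] using this)), mul_zero]
  · have hcx : c • x ∉ coneOver Γ := by
      rintro ⟨r, hr, p, hp, h⟩
      refine hx ⟨c⁻¹ * r, by positivity, p, hp, ?_⟩
      rw [mul_smul, ← h, smul_smul, inv_mul_cancel₀ hc0.ne', one_smul]
    rw [Set.indicator_of_notMem (fun h => hx h.1), Set.indicator_of_notMem (fun h => hcx h.1),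
      mul_zero]

lemma continuousOn_density {G : Pt n → ℝ} (hGc : ContinuousOn G {0}ᶜ) :
    ContinuousOn (fun x : Pt n => G x * (‖x‖ ^ (n - 1))⁻¹) {0}ᶜ :=
  hGc.mul (ContinuousOn.inv₀ (by fun_prop) fun x hx => pow_ne_zero _ (norm_ne_zero_iff.2 hx))

/-- Integration in polar coordinates on the cone. -/
theorem exists_polar_integral (hΓ : IsClosedOrientedHypersurface Γ ν) (hn : 2 ≤ n)
    {G : Pt n → ℝ} (hGc : ContinuousOn G {0}ᶜ) (hG : ∀ c : ℝ, 0 < c → ∀ x, G (c • x) = G x)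
    (hG0 : ∀ x, 0 ≤ G x) : ∃ κ : ℝ, 0 ≤ κ ∧
      (∀ w : ℝ → ℝ, Continuous w → ∫ x in coneOver Γ, G x * (‖x‖ ^ (n - 1))⁻¹ * w (Real.log ‖x‖)
        ∂μHE[n - 1] = κ * ∫ t, w t) ∧ ((∃ x ∈ coneOver Γ, 0 < G x) → 0 < κ) := by
  have hdc := continuousOn_density hGc
  have hdm : Measurable (fun x : Pt n => G x * (‖x‖ ^ (n - 1))⁻¹) :=
    measurable_of_continuousOn_compl_singleton 0 hdc
  have inv : (radialMeasure Γ G).IsAddLeftInvariant := ⟨fun s => Measure.ext fun A hA => by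
    rw [Measure.map_apply (measurable_const_add s) hA, hΓ.radialMeasure_preimage_add hG s hA]⟩
  have fin : IsFiniteMeasureOnCompacts (radialMeasure Γ G) := by
    refine ⟨fun K hK => ?_⟩
    obtain ⟨b, hb⟩ := hK.isBounded.subset_closedBall 0
    refine (measure_mono hb).trans_lt ?_
    rw [radialMeasure_apply G measurableSet_closedBall]
    have hi := (hΓ.integrableOn_cone_annulus hn (Real.exp_pos (-b)) (b := Real.exp b) hdc)
    refine lt_of_le_of_lt (lintegral_mono_set ?_) hi.lintegral_lt_top
    rintro x ⟨hx, hxb⟩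
    have h0 : 0 < ‖x‖ := norm_pos_iff.2 (hΓ.ne_zero_of_mem_cone hx)
    have h1 : |Real.log ‖x‖| ≤ b := by simpa using hxb
    exact ⟨hx, (Real.le_log_iff_exp_le h0).1 (neg_le_of_abs_le h1),
      (Real.log_le_iff_le_exp h0).1 (le_of_abs_le h1)⟩
  -- A translation-invariant locally finite measure on ℝ is a multiple of Lebesgue measure. This
  -- replaces a coarea formula on the cone; κ is the integral of G over the link, without the
  -- measure of the link having to appear.
  have hsm := Measure.isAddLeftInvariant_eq_smul (radialMeasure Γ G) (volume : Measure ℝ)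
  set κ := Measure.addHaarScalarFactor (radialMeasure Γ G) (volume : Measure ℝ)
  refine ⟨κ, κ.2, fun w hw => ?_, ?_⟩
  · have h1 : ∫ t, w t ∂(radialMeasure Γ G) = κ * ∫ t, w t := by
      rw [hsm, integral_smul_nnreal_measure]
      rfl
    rw [← h1, radialMeasure, integral_map measurable_log_norm.aemeasurable
      hw.aestronglyMeasurable, integral_withDensity_eq_integral_toReal_smul (by fun_prop)
      (by simp)]
    refine integral_congr_ae (Eventually.of_forall fun x => ?_)
    have : 0 ≤ G x * (‖x‖ ^ (n - 1))⁻¹ := mul_nonneg (hG0 x) (by positivity)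
    simp only [ENNReal.toReal_ofReal this, smul_eq_mul]
  · rintro ⟨x, hx, hGx⟩
    have hx0 := hΓ.ne_zero_of_mem_cone hx
    by_contra hκ
    have hκ0 : κ = 0 := by
      have : ¬ (0 : NNReal) < κ := fun h => hκ (by exact_mod_cast h)
      simpa using this
    rw [hκ0, zero_smul] at hsm
    have h0 : radialMeasure Γ G Set.univ = 0 := by rw [hsm]; rfl
    rw [radialMeasure_apply G MeasurableSet.univ] at h0
    have hset : coneOver Γ ∩ {x : Pt n | Real.log ‖x‖ ∈ Set.univ} = coneOver Γ := by simp
    rw [hset, lintegral_eq_zero_iff (by fun_prop)] at h0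
    -- If κ were 0, the density would vanish almost everywhere on the cone, but it is positive near
    -- x and the cone has positive area there.
    have hU : {y : Pt n | 0 < G y * (‖y‖ ^ (n - 1))⁻¹} ∈ 𝓝 x := by
      have hca : ContinuousAt (fun x : Pt n => G x * (‖x‖ ^ (n - 1))⁻¹) x :=
        hdc.continuousAt (isOpen_compl_singleton.mem_nhds hx0)
      exact hca.eventually (lt_mem_nhds
        (mul_pos hGx (inv_pos.2 (pow_pos (norm_pos_iff.2 hx0) _))))
    have hpos := hΓ.measure_cone_inter_pos hn hx hU
    have h2 : μHE[n - 1] (coneOver Γ ∩ {y : Pt n | 0 < G y * (‖y‖ ^ (n - 1))⁻¹}) = 0 := by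
      have h3 := ae_iff.1 h0
      rw [Measure.restrict_apply' hΓ.measurableSet_cone] at h3
      refine measure_mono_null ?_ h3
      rintro y ⟨hy1, hy2⟩
      refine ⟨?_, hy1⟩
      have : ENNReal.ofReal (G y * (‖y‖ ^ (n - 1))⁻¹) ≠ 0 := by
        simpa using hy2
      exact this
    exact hpos.ne' h2

end IsClosedOrientedHypersurface

/-! ### Instability of the cones which are not totally geodesic -/

namespace MinimalConeCalculus

variable {n : ℕ} {A : Type*} [CommRing A] [Algebra ℝ A]
  {D : Fin n → Derivation ℝ A A} {N X : Fin n → A}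

/-- g² is homogeneous of degree 0 up to the constant ε, so 2g Σ X_k D_k g = 0; then the inverse g'
of g is used. -/
lemma radial_weight (h : MinimalConeCalculus n A D N X) {g g' : A} {ε : ℝ}
    (hg : g * g = (∑ i, X i * X i) * normSq D N + algebraMap ℝ A ε) (hg' : g * g' = 1) :
    ∑ k, X k * D k g = 0 := by
  have h2 : ∀ k, 2 * (g * (X k * D k g)) = X k * D k ((∑ i, X i * X i) * normSq D N) := by
    intro k
    have h3 := congrArg (D k) hg
    rw [map_add, Derivation.map_algebraMap, add_zero] at h3
    rw [← h3, Derivation.leibniz, smul_eq_mul]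
    ring
  have h4 : 2 * (g * ∑ k, X k * D k g) = 0 := by
    rw [Finset.mul_sum, Finset.mul_sum, Finset.sum_congr rfl fun k _ => h2 k]
    exact h.radial_sqNorm_mul_normSq
  have h5 : algebraMap ℝ A (1 / 2) * 2 = 1 := by
    rw [show (2 : A) = algebraMap ℝ A 2 from (map_ofNat _ 2).symm, ← map_mul]
    norm_num
  linear_combination algebraMap ℝ A (1 / 2) * g' * h4 - g * g' * (∑ k, X k * D k g) * h5
    - (∑ k, X k * D k g) * hg'

variable {F F₁ F₂ r g : A}

lemma D_inv_sqNorm (h : MinimalConeCalculus n A D N X) (hr : r * ∑ i, X i * X i = 1) (k : Fin n) : D k r = -2 * X k * r * r := by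
  have h1 := congrArg (D k) hr
  rw [Derivation.leibniz, h.D_sqNorm, Derivation.map_one_eq_zero, smul_eq_mul, smul_eq_mul] at h1
  linear_combination r * h1 - D k r * hr

/-- Here r stands for |x|⁻², F for a function of t = log |x|, and F₁, F₂ for its t-derivatives. The
coefficient n - 3 is the n - 2 of the radial Laplacian on a cone of dimension n - 1, lowered by one
by the logarithmic variable. -/
lemma laplacian_radial (h : MinimalConeCalculus n A D N X) (hr : r * ∑ i, X i * X i = 1)
    (hF : ∀ k, D k F = F₁ * (X k * r)) (hF₁ : ∀ k, D k F₁ = F₂ * (X k * r)) :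
    ∑ k, D k (D k F) = r * (F₂ + (n - 3) * F₁) := by
  have : ∀ k, D k (D k F) = (F₂ * r * r - 2 * F₁ * r * r) * (X k * X k) + F₁ * r * D k (X k) := by
    intro k
    rw [hF, Derivation.leibniz, Derivation.leibniz, hF₁, h.D_inv_sqNorm hr]
    simp only [smul_eq_mul]
    ring
  simp only [this, Finset.sum_add_distrib, ← Finset.mul_sum, h.sum_D_coord]
  linear_combination (F₂ * r - 2 * F₁ * r) * hr

/-- The gradient of F is radial and g is constant along rays, so there is no cross term. -/
lemma laplacian_test (h : MinimalConeCalculus n A D N X) (hr : r * ∑ i, X i * X i = 1)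
    (hF : ∀ k, D k F = F₁ * (X k * r)) (hF₁ : ∀ k, D k F₁ = F₂ * (X k * r))
    (hg : ∑ k, X k * D k g = 0) : ∑ k, D k (D k (F * g)) =
      F * (∑ k, D k (D k g)) + g * (r * (F₂ + (n - 3) * F₁)) := by
  have : ∀ k, D k (D k (F * g)) = F * D k (D k g) + g * D k (D k F) +
      2 * F₁ * r * (X k * D k g) := by
    intro k
    simp only [Derivation.leibniz, smul_eq_mul, map_add, hF]
    ring
  simp only [this, Finset.sum_add_distrib, ← Finset.mul_sum, hg, h.laplacian_radial hr hF hF₁]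
  ring

lemma radial_test (hr : r * ∑ i, X i * X i = 1) (hF : ∀ k, D k F = F₁ * (X k * r))
    (hg : ∑ k, X k * D k g = 0) : ∑ k, X k * D k (F * g) = g * F₁ := by
  have : ∀ k, X k * D k (F * g) = F * (X k * D k g) + g * F₁ * r * (X k * X k) := by
    intro k
    simp only [Derivation.leibniz, smul_eq_mul, hF]
    ring
  simp only [this, Finset.sum_add_distrib, ← Finset.mul_sum, hg]
  linear_combination g * F₁ * hr

end MinimalConeCalculus

/-! ### The homogeneous weight and the Jacobi operator of the cone -/

section TestFunctions

variable {n : ℕ} {Γ : Set (Pt n)} {ν : Pt n → Pt n}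

/-- `|A|²` of the cone. -/
def coneNormSq (ν : Pt n → Pt n) (x : Pt n) : ℝ :=
  ∑ i, ∑ j, tangD (coneField ν) i (fun y => coneField ν y j) x *
    tangD (coneField ν) i (fun y => coneField ν y j) x

/-- The homogeneous function `|x|² |A|²`. -/
def coneEnergy (ν : Pt n → Pt n) (x : Pt n) : ℝ := ‖x‖ ^ 2 * coneNormSq ν x

/-- The homogeneous weight `(|x|² |A|² + ε)^{1/2}`. -/
def coneWeight (ν : Pt n → Pt n) (ε : ℝ) (x : Pt n) : ℝ := √(coneEnergy ν x + ε)

/-- The test function `θ(log |x|) (|x|² |A|² + ε)^{1/2}`. -/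
def coneTest (ν : Pt n → Pt n) (ε : ℝ) (θ : ℝ → ℝ) (x : Pt n) : ℝ :=
  θ (Real.log ‖x‖) * coneWeight ν ε x

lemma coneNormSq_nonneg (x : Pt n) : 0 ≤ coneNormSq ν x :=
  Finset.sum_nonneg fun _ _ => Finset.sum_nonneg fun _ _ => mul_self_nonneg _

lemma coneEnergy_nonneg (x : Pt n) : 0 ≤ coneEnergy ν x :=
  mul_nonneg (by positivity) (coneNormSq_nonneg x)

lemma coneWeight_mul_self {ε : ℝ} (hε : 0 < ε) (x : Pt n) :
    coneWeight ν ε x * coneWeight ν ε x = coneEnergy ν x + ε :=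
  Real.mul_self_sqrt (add_nonneg (coneEnergy_nonneg x) hε.le)

lemma tangD_coneField_smul {c : ℝ} (hc : 0 < c) (x : Pt n) (i j : Fin n) :
    tangD (coneField ν) i (fun y => coneField ν y j) (c • x) =
      c⁻¹ * tangD (coneField ν) i (fun y => coneField ν y j) x := by
  have h : (fun y => coneField ν y j) = fun y => (fun y => coneField ν y j) (c • y) := by
    funext y
    simp only [coneField_smul hc]
  have h2 : fderiv ℝ (fun y => coneField ν y j) x =
      c • fderiv ℝ (fun y => coneField ν y j) (c • x) := by
    conv_lhs => rw [h]
    exact fderiv_comp_smul (f := fun y => coneField ν y j) c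
  rw [tangD, tangD, coneField_smul hc, h2]
  simp only [_root_.smul_apply, smul_eq_mul]
  rw [← mul_assoc, inv_mul_cancel₀ hc.ne', one_mul]

lemma coneEnergy_smul {c : ℝ} (hc : 0 < c) (x : Pt n) :
    coneEnergy ν (c • x) = coneEnergy ν x := by
  rw [coneEnergy, coneEnergy, coneNormSq, coneNormSq, norm_smul, Real.norm_of_nonneg hc.le,
    mul_pow, Finset.mul_sum, Finset.mul_sum]
  refine Finset.sum_congr rfl fun i _ => ?_
  rw [Finset.mul_sum, Finset.mul_sum]
  refine Finset.sum_congr rfl fun j _ => ?_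
  rw [tangD_coneField_smul hc]
  field_simp

namespace IsClosedOrientedHypersurface

lemma smoothOffZero_tangD (hΓ : IsClosedOrientedHypersurface Γ ν) {f : Pt n → ℝ}
    (hf : SmoothOffZero f) (i : Fin n) : SmoothOffZero (tangD (coneField ν) i f) :=
  hf.tangD (fun _ h => hΓ.contDiffAt_coneField h) i

lemma smoothOffZero_coneNormSq (hΓ : IsClosedOrientedHypersurface Γ ν) :
    SmoothOffZero (coneNormSq ν) :=
  .sum fun i _ => .sum fun j _ =>
    (hΓ.smoothOffZero_tangD (hΓ.smoothOffZero_coneField j) i).mul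
      (hΓ.smoothOffZero_tangD (hΓ.smoothOffZero_coneField j) i)

lemma smoothOffZero_coneEnergy (hΓ : IsClosedOrientedHypersurface Γ ν) :
    SmoothOffZero (coneEnergy ν) := SmoothOffZero.normSq.mul hΓ.smoothOffZero_coneNormSq

lemma smoothOffZero_coneWeight (hΓ : IsClosedOrientedHypersurface Γ ν) {ε : ℝ} (hε : 0 < ε) :
    SmoothOffZero (coneWeight ν ε) := fun x hx =>
  ((hΓ.smoothOffZero_coneEnergy x hx).add contDiffAt_const).sqrt
    (add_pos_of_nonneg_of_pos (coneEnergy_nonneg x) hε).ne'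

lemma smoothOffZero_coneTest (hΓ : IsClosedOrientedHypersurface Γ ν) {ε : ℝ} (hε : 0 < ε)
    {θ : ℝ → ℝ} (hθ : ContDiff ℝ ∞ θ) : SmoothOffZero (coneTest ν ε θ) :=
  (SmoothOffZero.comp_log_norm hθ).mul (hΓ.smoothOffZero_coneWeight hε)

/-- The Jacobi operator of the cone in terms of the Euclidean tangential derivatives. -/
lemma jacobiOp_cone (hΓ : IsClosedOrientedHypersurface Γ ν) (hn : 3 ≤ n) {m : ℝ} (hm : 0 < m)
    {x : Pt n} (hx : x ∈ coneOver Γ) {u : Pt n → ℝ} (hu : SmoothOffZero u) :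
    jacobiOp (schwarzschild n m) (coneNormal n m ν) u x =
      (confFactor n m x ^ 2)⁻¹ * (∑ i, tangD (coneField ν) i (tangD (coneField ν) i u) x +
        (n - 3) * logConfCoeff n m x * fderiv ℝ u x x)
      + (metricInner (ricci (schwarzschild n m)) x (confNormal n m (coneField ν) x)
          (confNormal n m (coneField ν) x)
        + (confFactor n m x ^ 2)⁻¹ * coneNormSq ν x) * u x := by
  have h0 := hΓ.ne_zero_of_mem_cone hx
  have hnorm := hΓ.norm_coneField hx
  have hin := hΓ.inner_coneField hx
  have e : coneNormal n m ν = confNormal n m (coneField ν) := rfl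
  rw [e, jacobiOp, surfaceLaplacian_schwarzschild hn hm h0 hnorm hin fun i =>
    (hΓ.smoothOffZero_tangD hu i).differentiableAt h0,
    normSqSecondForm_schwarzschild hn hm h0 hin
      (fun k => (hΓ.smoothOffZero_coneField k).differentiableAt h0) hnorm ?_]
  · congr 4
    refine Finset.sum_congr rfl fun i _ => Finset.sum_congr rfl fun j _ => ?_
    rw [hΓ.tangD_coneField_comm hx j i]
  · intro i
    rw [Finset.sum_congr rfl fun k _ => by rw [hΓ.tangD_coneField_comm hx i k]]
    exact hΓ.sum_coneField_mul_tangD hx _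

/-- On the cone the Jacobi operator agrees with an explicit expression that is continuous off the
origin. This serves only to make the integrand of the index form integrable. -/
lemma exists_continuousOn_jacobiOp (hΓ : IsClosedOrientedHypersurface Γ ν) (hn : 3 ≤ n) {m : ℝ}
    (hm : 0 < m) {u : Pt n → ℝ} (hu : SmoothOffZero u) : ∃ J : Pt n → ℝ, ContinuousOn J {0}ᶜ ∧
      ∀ x ∈ coneOver Γ, jacobiOp (schwarzschild n m) (coneNormal n m ν) u x = J x := by
  have hφ : ContinuousOn (confFactor n m) {0}ᶜ := fun x hx =>
    (hasFDerivAt_confFactor hn hm hx).continuousAt.continuousWithinAt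
  have ha : ContinuousOn (logConfCoeff n m) {0}ᶜ := fun x hx =>
    (hasFDerivAt_logConfCoeff hn hm hx).continuousAt.continuousWithinAt
  have hb : ContinuousOn (logConfCoeff' n m) {0}ᶜ := by
    refine ContinuousOn.div (by fun_prop) (by fun_prop) fun x hx => ?_
    have : 0 < ‖x‖ := norm_pos_iff.2 hx
    positivity
  have hφi : ContinuousOn (fun x => (confFactor n m x ^ 2)⁻¹) {0}ᶜ :=
    (hφ.pow 2).inv₀ fun x _ => pow_ne_zero _ (confFactor_pos hm x).ne'
  have hD : ContinuousOn (fun x => fderiv ℝ u x x) {0}ᶜ := fun x hx =>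
    (((hu x hx).fderiv_right (m := 0) (by simp)).continuousAt.clm_apply
      continuousAt_id).continuousWithinAt
  refine ⟨fun x => (confFactor n m x ^ 2)⁻¹ *
      (∑ i, tangD (coneField ν) i (tangD (coneField ν) i u) x +
        (n - 3) * logConfCoeff n m x * fderiv ℝ u x x)
      + (-(confFactor n m x ^ 2)⁻¹ * ((2 * n - 2) * logConfCoeff n m x +
        logConfCoeff' n m x * ‖x‖ ^ 2 + (n - 2) * logConfCoeff n m x ^ 2 * ‖x‖ ^ 2)
        + (confFactor n m x ^ 2)⁻¹ * coneNormSq ν x) * u x, ?_, fun x hx => ?_⟩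
  · have h1 : ContinuousOn (fun x => ∑ i, tangD (coneField ν) i (tangD (coneField ν) i u) x) {0}ᶜ :=
      continuousOn_finsetSum _ fun i _ =>
        (hΓ.smoothOffZero_tangD (hΓ.smoothOffZero_tangD hu i) i).continuousOn
    have h2 := hΓ.smoothOffZero_coneNormSq.continuousOn
    have h3 := hu.continuousOn
    fun_prop
  · have h0 := hΓ.ne_zero_of_mem_cone hx
    rw [hΓ.jacobiOp_cone hn hm hx hu,
      ricci_confNormal hn hm h0 (hΓ.inner_coneField hx) (hΓ.norm_coneField hx)]

end IsClosedOrientedHypersurface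
end TestFunctions

namespace IsClosedOrientedHypersurface

variable {n : ℕ} {Γ : Set (Pt n)} {ν : Pt n → Pt n}

lemma coneEval_sqNorm {x : Pt n} (hx : x ∈ coneOver Γ) :
    coneEval hx (∑ i, coneCoord Γ i * coneCoord Γ i) = ‖x‖ ^ 2 := by
  rw [EuclideanSpace.norm_sq_eq, map_sum]
  refine Finset.sum_congr rfl fun i _ => ?_
  rw [Real.norm_eq_abs, sq_abs, map_mul]
  exact (sq (x i)).symm

lemma coneEval_normSq (hΓ : IsClosedOrientedHypersurface Γ ν) {x : Pt n} (hx : x ∈ coneOver Γ) :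
    coneEval hx (MinimalConeCalculus.normSq hΓ.coneDeriv hΓ.coneNormalCoord) = coneNormSq ν x := by
  rw [MinimalConeCalculus.normSq, map_sum]
  refine Finset.sum_congr rfl fun i _ => ?_
  rw [map_sum]
  refine Finset.sum_congr rfl fun j _ => ?_
  rw [map_mul, coneNormalCoord, coneDeriv_restrict]
  rfl

lemma coneDeriv_comp_log_norm (hΓ : IsClosedOrientedHypersurface Γ ν) {η : ℝ → ℝ}
    (hη : ContDiff ℝ ∞ η) (hη1 : ContDiff ℝ ∞ (deriv η))
    (hsR : SmoothOffZero fun y : Pt n => (‖y‖ ^ 2)⁻¹) (k : Fin n) :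
    hΓ.coneDeriv k (coneRestrict Γ (SmoothOffZero.comp_log_norm hη)) =
      coneRestrict Γ (SmoothOffZero.comp_log_norm hη1) * (coneCoord Γ k * coneRestrict Γ hsR) := by
  rw [coneDeriv_restrict]
  refine coneAlgebra_ext fun y hy => ?_
  have hy0 := hΓ.ne_zero_of_mem_cone hy
  have hyr : 0 < ‖y‖ := norm_pos_iff.2 hy0
  rw [map_mul, map_mul, coneEval_restrict, coneEval_restrict, coneEval_restrict,
    coneCoord, coneEval_restrict]
  have h1 : HasDerivAt (fun r => η (Real.log r)) (deriv η (Real.log ‖y‖) * ‖y‖⁻¹) ‖y‖ :=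
    ((hη.differentiable (by simp)) _).hasDerivAt.comp _ (Real.hasDerivAt_log hyr.ne')
  rw [tangD_of_hasFDerivAt k (hasFDerivAt_comp_norm hy0 h1) (hΓ.inner_coneField hy)]
  field_simp

/-- Simons' inequality for the test functions, in terms of tangential derivatives. -/
lemma coneTest_laplacian (hΓ : IsClosedOrientedHypersurface Γ ν)
    (hmin : IsMinimalInSphere Γ ν) {ε : ℝ} (hε : 0 < ε)
    {θ : ℝ → ℝ} (hθ : ContDiff ℝ ∞ θ) {x : Pt n} (hx : x ∈ coneOver Γ) :
    ∃ G : ℝ, ((n : ℝ) - 2) * coneNormSq ν x ≤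
        coneWeight ν ε x * G + coneNormSq ν x * (coneWeight ν ε x * coneWeight ν ε x) ∧
      ∑ k, tangD (coneField ν) k (tangD (coneField ν) k (coneTest ν ε θ)) x =
        θ (Real.log ‖x‖) * G + coneWeight ν ε x * ((‖x‖ ^ 2)⁻¹ *
          (deriv (deriv θ) (Real.log ‖x‖) + (n - 3) * deriv θ (Real.log ‖x‖))) ∧
      fderiv ℝ (coneTest ν ε θ) x x = coneWeight ν ε x * deriv θ (Real.log ‖x‖) := by
  have h0 := hΓ.ne_zero_of_mem_cone hx
  have hr : 0 < ‖x‖ := norm_pos_iff.2 h0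
  have hcalc := hΓ.minimalConeCalculus hmin
  have hθ1 : ContDiff ℝ ∞ (deriv θ) := by fun_prop
  have hθ2 : ContDiff ℝ ∞ (deriv (deriv θ)) := by fun_prop
  have hsR : SmoothOffZero fun y : Pt n => (‖y‖ ^ 2)⁻¹ := fun y hy =>
    (SmoothOffZero.normSq y hy).inv (pow_ne_zero _ (norm_ne_zero_iff.2 hy))
  have hsg := hΓ.smoothOffZero_coneWeight hε
  have hgpos : ∀ y : Pt n, coneWeight ν ε y ≠ 0 := fun y =>
    (Real.sqrt_pos.2 (add_pos_of_nonneg_of_pos (coneEnergy_nonneg y) hε)).ne'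
  have hsg' : SmoothOffZero fun y : Pt n => (coneWeight ν ε y)⁻¹ := fun y hy =>
    (hsg y hy).inv (hgpos y)
  have hr2ρ : coneRestrict Γ hsR * ∑ i, coneCoord Γ i * coneCoord Γ i = 1 :=
    coneAlgebra_ext fun y hy => by
      rw [map_mul, coneEval_sqNorm, map_one]
      exact inv_mul_cancel₀ (pow_ne_zero _ (norm_ne_zero_iff.2 (hΓ.ne_zero_of_mem_cone hy)))
  have hgg : coneRestrict Γ hsg * coneRestrict Γ hsg = (∑ i, coneCoord Γ i * coneCoord Γ i) *
      MinimalConeCalculus.normSq hΓ.coneDeriv hΓ.coneNormalCoord +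
      algebraMap ℝ (coneAlgebra Γ) ε := coneAlgebra_ext fun y hy => by
    rw [map_mul, map_add, map_mul, coneEval_sqNorm, hΓ.coneEval_normSq, AlgHom.commutes]
    exact coneWeight_mul_self hε y
  have hgg' : coneRestrict Γ hsg * coneRestrict Γ hsg' = 1 := coneAlgebra_ext fun y hy => by
    rw [map_mul, map_one]
    exact mul_inv_cancel₀ (hgpos y)
  have hXg := hcalc.radial_weight hgg hgg'
  have hDF := hΓ.coneDeriv_comp_log_norm hθ hθ1 hsR
  have hDF1 := hΓ.coneDeriv_comp_log_norm hθ1 hθ2 hsR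
  have hLu := congrArg (coneEval hx) (hcalc.laplacian_test hr2ρ hDF hDF1 hXg)
  have hRu := congrArg (coneEval hx) (MinimalConeCalculus.radial_test hr2ρ hDF hXg)
  have hsim := hcalc.simons_inequality (coneEval hx) hε hgg
    (by rw [coneEval_sqNorm]; positivity)
  have hFg : coneRestrict Γ (SmoothOffZero.comp_log_norm hθ) * coneRestrict Γ hsg =
    coneRestrict Γ (hΓ.smoothOffZero_coneTest hε hθ) := rfl
  have hn3 : coneEval hx ((n : coneAlgebra Γ) - 3) = (n : ℝ) - 3 := by
    rw [map_sub, map_natCast, map_ofNat]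
  rw [map_add, map_mul (coneEval hx) (coneRestrict Γ hsg), hΓ.coneEval_normSq,
    map_mul (coneEval hx) (MinimalConeCalculus.normSq _ _),
    map_mul (coneEval hx) (coneRestrict Γ hsg) (coneRestrict Γ hsg), hΓ.coneEval_normSq] at hsim
  refine ⟨_, hsim, ?_, ?_⟩
  · rw [map_add, map_mul (coneEval hx) (coneRestrict Γ (SmoothOffZero.comp_log_norm hθ)),
      map_mul (coneEval hx) (coneRestrict Γ hsg), map_mul (coneEval hx) (coneRestrict Γ hsR),
      map_add (coneEval hx) (coneRestrict Γ (SmoothOffZero.comp_log_norm hθ2)),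
      map_mul (coneEval hx) ((n : coneAlgebra Γ) - 3), hn3] at hLu
    refine Eq.trans ?_ hLu
    rw [hFg, map_sum]
    refine Finset.sum_congr rfl fun k _ => ?_
    rw [coneDeriv_restrict, coneDeriv_restrict, coneEval_restrict]
  · rw [map_mul (coneEval hx) (coneRestrict Γ hsg)] at hRu
    refine Eq.trans ?_ hRu
    rw [← sum_mul_tangD (coneField ν) _ _ (hΓ.inner_coneField hx), hFg, map_sum]
    refine Finset.sum_congr rfl fun k _ => ?_
    rw [coneDeriv_restrict, map_mul, coneEval_restrict, coneCoord, coneEval_restrict]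

/-- The pointwise lower bound given by Simons' inequality. -/
lemma le_coneTest_mul_jacobiOp (hΓ : IsClosedOrientedHypersurface Γ ν)
    (hmin : IsMinimalInSphere Γ ν) (hn : 3 ≤ n) {m : ℝ} (hm : 0 < m) {ε : ℝ} (hε : 0 < ε)
    {θ : ℝ → ℝ} (hθ : ContDiff ℝ ∞ θ) {x : Pt n} (hx : x ∈ coneOver Γ) :
    (confFactor n m x ^ 2)⁻¹ * (‖x‖ ^ 2)⁻¹ * ((coneEnergy ν x + ε) * (θ (Real.log ‖x‖) *
      (deriv (deriv θ) (Real.log ‖x‖) + (n - 3) * (1 + logConfCoeff n m x * ‖x‖ ^ 2) *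
        deriv θ (Real.log ‖x‖))) + (n - 2) * coneEnergy ν x * θ (Real.log ‖x‖) ^ 2) ≤
    coneTest ν ε θ x * jacobiOp (schwarzschild n m) (coneNormal n m ν) (coneTest ν ε θ) x := by
  have h0 := hΓ.ne_zero_of_mem_cone hx
  have hr : 0 < ‖x‖ := norm_pos_iff.2 h0
  obtain ⟨G, hsim, hL, hR⟩ := hΓ.coneTest_laplacian hmin hε hθ hx
  rw [hΓ.jacobiOp_cone hn hm hx (hΓ.smoothOffZero_coneTest hε hθ), hL, hR]
  have eu : coneTest ν ε θ x = θ (Real.log ‖x‖) * coneWeight ν ε x := rfl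
  rw [eu, ← coneWeight_mul_self hε x, show coneEnergy ν x = ‖x‖ ^ 2 * coneNormSq ν x from rfl]
  have hric := ricci_confNormal_nonneg hn hm h0 (hΓ.inner_coneField hx) (hΓ.norm_coneField hx)
  have hφ : 0 < (confFactor n m x ^ 2)⁻¹ := by
    have := confFactor_pos (n := n) hm x
    positivity
  generalize metricInner (ricci (schwarzschild n m)) x (confNormal n m (coneField ν) x)
          (confNormal n m (coneField ν) x) = ric at *
  generalize coneWeight ν ε x = w at *
  generalize θ (Real.log ‖x‖) = T at *
  generalize deriv θ (Real.log ‖x‖) = T1 at *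
  generalize deriv (deriv θ) (Real.log ‖x‖) = T2 at *
  generalize coneNormSq ν x = h at *
  generalize logConfCoeff n m x = a at *
  generalize (confFactor n m x ^ 2)⁻¹ = c at *
  -- The two inequalities of the proof: Simons' inequality times φ⁻²θ², and the Ricci term, which is
  -- dropped.
  have key : c * (T ^ 2 * ((n - 2) * h)) ≤ c * (T ^ 2 * (w * G + h * (w * w))) := by gcongr
  have key2 : 0 ≤ ric * (T * w) ^ 2 := by positivity
  have e1 : c * (‖x‖ ^ 2)⁻¹ * (w * w * (T * (T2 + (n - 3) * (1 + a * ‖x‖ ^ 2) * T1)) +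
      (n - 2) * (‖x‖ ^ 2 * h) * T ^ 2) = c * ((‖x‖ ^ 2)⁻¹ * (w * w * T * (T2 + (n - 3) * T1))
        + w * w * T * (n - 3) * a * T1) + c * (T ^ 2 * ((n - 2) * h)) := by
    field_simp
    ring
  rw [e1]
  linarith

end IsClosedOrientedHypersurface

/-! ### The weight of the one-dimensional problem in t = log |x| -/

section Profile

variable {n : ℕ} {m : ℝ}

/-- The conformal factor as a function of `t = log |x|`. -/
def confProfile (n : ℕ) (m t : ℝ) : ℝ :=
  (1 + m / (2 * Real.exp t ^ (n - 2))) ^ (2 / ((n : ℝ) - 2))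

/-- The logarithmic derivative of the conformal factor with respect to `t = log |x|`. -/
def confRate (n : ℕ) (m t : ℝ) : ℝ :=
  -m / (Real.exp t ^ n + m / 2 * Real.exp t ^ 2) * Real.exp t ^ 2

lemma confFactor_eq_confProfile {x : Pt n} (hx : x ≠ 0) :
    confFactor n m x = confProfile n m (Real.log ‖x‖) := by
  rw [confFactor, confProfile, Real.exp_log (norm_pos_iff.2 hx)]

lemma logConfCoeff_eq_confRate {x : Pt n} (hx : x ≠ 0) :
    logConfCoeff n m x * ‖x‖ ^ 2 = confRate n m (Real.log ‖x‖) := by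
  rw [logConfCoeff, confRate, Real.exp_log (norm_pos_iff.2 hx)]

lemma hasDerivAt_confProfile (hn : 3 ≤ n) (hm : 0 < m) (t : ℝ) :
    HasDerivAt (confProfile n m) (confProfile n m t * confRate n m t) t := by
  -- The derivative is that of the conformal factor along the ray s ↦ eˢ e.
  set e : Pt n := EuclideanSpace.single ⟨0, by omega⟩ 1 with he
  have hen : ‖e‖ = 1 := by simp [he]
  have hnorm : ∀ s, ‖Real.exp s • e‖ = Real.exp s := fun s => by
    rw [norm_smul, hen, mul_one, Real.norm_of_nonneg (Real.exp_pos s).le]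
  have h0 : ∀ s, Real.exp s • e ≠ 0 := fun s => by
    rw [← norm_pos_iff, hnorm]; exact Real.exp_pos s
  have h1 : confProfile n m = fun s => confFactor n m (Real.exp s • e) := by
    funext s
    rw [confFactor_eq_confProfile (h0 s), hnorm, Real.log_exp]
  have h2 := (hasFDerivAt_confFactor hn hm (h0 t)).comp_hasDerivAt t
    ((Real.hasDerivAt_exp t).smul_const e)
  rw [h1]
  refine h2.congr_deriv ?_
  have h3 := logConfCoeff_eq_confRate (m := m) (h0 t)
  rw [hnorm, Real.log_exp] at h3
  rw [← h3]
  simp [hen]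
  ring

lemma one_le_confProfile (hn : 3 ≤ n) (hm : 0 < m) (t : ℝ) : 1 ≤ confProfile n m t := by
  have h3 : (3 : ℝ) ≤ n := by exact_mod_cast hn
  refine Real.one_le_rpow ?_ (div_nonneg (by norm_num) (by linarith))
  have : 0 ≤ m / (2 * Real.exp t ^ (n - 2)) := by positivity
  linarith

lemma confProfile_le (hn : 3 ≤ n) (hm : 0 < m) {t : ℝ} (ht : 0 ≤ t) :
    confProfile n m t ≤ confProfile n m 0 := by
  have h3 : (3 : ℝ) ≤ n := by exact_mod_cast hn
  refine Real.rpow_le_rpow (by positivity) ?_ (div_nonneg (by norm_num) (by linarith))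
  have h1 : 1 ≤ Real.exp t := Real.one_le_exp ht
  gcongr

lemma continuous_confProfile (hn : 3 ≤ n) (hm : 0 < m) : Continuous (confProfile n m) :=
  continuous_iff_continuousAt.2 fun t => (hasDerivAt_confProfile hn hm t).continuousAt

lemma continuous_confRate (hm : 0 < m) : Continuous (confRate n m) := by
  refine Continuous.mul (Continuous.div (by fun_prop) (by fun_prop) fun t => ?_) (by fun_prop)
  positivity

/-- The weight of the one-dimensional variational problem. -/
def radialWeight (n : ℕ) (m t : ℝ) : ℝ := (confProfile n m t * Real.exp t) ^ (n - 3)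

lemma continuous_radialWeight (hn : 3 ≤ n) (hm : 0 < m) : Continuous (radialWeight n m) :=
  ((continuous_confProfile hn hm).mul Real.continuous_exp).pow _

lemma hasDerivAt_radialWeight (hn : 4 ≤ n) (hm : 0 < m) (t : ℝ) :
    HasDerivAt (radialWeight n m) (((n : ℝ) - 3) * (1 + confRate n m t) * radialWeight n m t) t := by
  have h := ((hasDerivAt_confProfile (n := n) (by omega) hm t).mul (Real.hasDerivAt_exp t)).pow (n - 3)
  refine h.congr_deriv ?_
  obtain ⟨k, rfl⟩ : ∃ k, n = k + 4 := ⟨n - 4, by omega⟩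
  have e : k + 4 - 3 = k + 1 := by omega
  rw [radialWeight, e]
  simp only [Pi.mul_apply]
  push_cast
  rw [pow_succ]
  ring

/-- With q the weight, q' = (n-3)(1+z) q, so the bracket is q⁻¹(qθ')' and the identity is an
integration by parts. The compact support of θ removes the boundary terms. -/
lemma integral_radialWeight_mul (hn : 4 ≤ n) (hm : 0 < m) {θ : ℝ → ℝ} (hθ : ContDiff ℝ ∞ θ)
    (hc : HasCompactSupport θ) :
    ∫ t, radialWeight n m t * (θ t * (deriv (deriv θ) t +
      ((n : ℝ) - 3) * (1 + confRate n m t) * deriv θ t)) =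
      -∫ t, radialWeight n m t * deriv θ t ^ 2 := by
  have hθ1 : ContDiff ℝ ∞ (deriv θ) := by fun_prop
  have hθ2 : ContDiff ℝ ∞ (deriv (deriv θ)) := by fun_prop
  have c0 := hθ.continuous
  have c1 := hθ1.continuous
  have c2 := hθ2.continuous
  have cq := continuous_radialWeight (n := n) (by omega) hm
  have cr := continuous_confRate (n := n) hm
  have hd : ∀ t, HasDerivAt (fun t => θ t * (radialWeight n m t * deriv θ t))
      (radialWeight n m t * (θ t * (deriv (deriv θ) t +
      ((n : ℝ) - 3) * (1 + confRate n m t) * deriv θ t)) + radialWeight n m t * deriv θ t ^ 2) t := by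
    intro t
    have h0 := ((hθ.differentiable (by simp)) t).hasDerivAt
    have h1 := ((hθ1.differentiable (by simp)) t).hasDerivAt
    refine (h0.mul ((hasDerivAt_radialWeight hn hm t).mul h1)).congr_deriv ?_
    simp only [Pi.mul_apply]
    ring
  have i1 : Integrable fun t => radialWeight n m t * (θ t * (deriv (deriv θ) t +
      ((n : ℝ) - 3) * (1 + confRate n m t) * deriv θ t)) :=
    Continuous.integrable_of_hasCompactSupport (by fun_prop) (hc.mul_right.mul_left)
  have i2 : Integrable fun t => radialWeight n m t * deriv θ t ^ 2 := by
    refine Continuous.integrable_of_hasCompactSupport (by fun_prop) ?_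
    have : (fun t => radialWeight n m t * deriv θ t ^ 2) =
        fun t => (radialWeight n m t * deriv θ t) * deriv θ t := by funext t; ring
    rw [this]
    exact hc.deriv.mul_left
  have i0 : Integrable fun t => θ t * (radialWeight n m t * deriv θ t) :=
    Continuous.integrable_of_hasCompactSupport (by fun_prop) hc.mul_right
  have h := integral_eq_zero_of_hasDerivAt_of_integrable hd (i1.add i2) i0
  rw [integral_add i1 i2] at h
  linarith

end Profile

namespace IsClosedOrientedHypersurface

variable {n : ℕ} {Γ : Set (Pt n)} {ν : Pt n → Pt n} {m : ℝ}

lemma contDiff_coneTest (hΓ : IsClosedOrientedHypersurface Γ ν) {ε : ℝ} (hε : 0 < ε) {θ : ℝ → ℝ}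
    (hθ : ContDiff ℝ ∞ θ) {T : ℝ} (hT : 0 ≤ T) (hθT : ∀ t ≤ T, θ t = 0) :
    ContDiff ℝ ∞ (coneTest ν ε θ) := by
  rw [contDiff_iff_contDiffAt]
  intro x
  by_cases hx : x = 0
  · subst hx
    refine (contDiffAt_const (c := (0 : ℝ))).congr_of_eventuallyEq ?_
    filter_upwards [Metric.ball_mem_nhds (0 : Pt n) one_pos] with y hy
    -- On the unit ball log ‖y‖ ≤ 0 ≤ T, including y = 0 where log 0 = 0 by convention; the test
    -- function vanishes there and is smooth at the origin.
    have h1 : Real.log ‖y‖ ≤ T :=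
      (Real.log_nonpos (norm_nonneg y) (by simpa using (mem_ball_zero_iff.1 hy).le)).trans hT
    rw [coneTest, hθT _ h1, zero_mul]
  · exact hΓ.smoothOffZero_coneTest hε hθ x hx

lemma truncatedCone_inter_eq (R : ℝ) : truncatedCone n m Γ ∩ {x | ‖x‖ ≤ R} =
    coneOver Γ ∩ {x | horizonRadius n m ≤ ‖x‖ ∧ ‖x‖ ≤ R} := by
  ext x
  simp only [truncatedCone, Set.mem_inter_iff, Set.mem_ofPred_eq, and_assoc]

/-- The index form of the test functions. -/
lemma indexForm_coneTest_le (hΓ : IsClosedOrientedHypersurface Γ ν)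
    (hmin : IsMinimalInSphere Γ ν) (hn : 4 ≤ n) (hm : 0 < m) : ∃ κ κ' : ℝ, 0 ≤ κ ∧ 0 ≤ κ' ∧
      ((∃ x ∈ coneOver Γ, 0 < coneEnergy ν x) → 0 < κ) ∧
      ∀ (ε : ℝ), 0 < ε → ∀ (θ : ℝ → ℝ), ContDiff ℝ ∞ θ → ∀ (T R : ℝ), 0 < R →
      Real.log (horizonRadius n m) ≤ T → (∀ t ≤ T, θ t = 0) → (∀ t, Real.log R ≤ t → θ t = 0) →
      indexForm n m (truncatedCone n m Γ) (coneNormal n m ν) R (coneTest ν ε θ) ≤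
        (κ + ε * κ') * (∫ t, radialWeight n m t * deriv θ t ^ 2)
          - (n - 2) * κ * ∫ t, radialWeight n m t * θ t ^ 2 := by
  have hn3 : 3 ≤ n := by omega
  have hR0 := horizonRadius_pos n hm
  obtain ⟨κ, hκ, hκi, hκp⟩ := hΓ.exists_polar_integral (by omega)
    hΓ.smoothOffZero_coneEnergy.continuousOn (fun c hc x => coneEnergy_smul hc x) coneEnergy_nonneg
  obtain ⟨κ', hκ', hκi', -⟩ := hΓ.exists_polar_integral (by omega)
    (G := fun _ => (1 : ℝ)) continuousOn_const (fun _ _ _ => rfl) (fun _ => zero_le_one)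
  refine ⟨κ, κ', hκ, hκ', hκp, fun ε hε θ hθ T R hR hT hθT hθR => ?_⟩
  have hc : HasCompactSupport θ := by
    refine HasCompactSupport.of_support_subset_isCompact (isCompact_Icc (a := T) (b := Real.log R)) ?_
    intro t ht
    rw [Function.mem_support] at ht
    exact ⟨le_of_not_ge fun h => ht (hθT t h), le_of_not_ge fun h => ht (hθR t h)⟩
  have hθ1 : ContDiff ℝ ∞ (deriv θ) := by fun_prop
  have hθ2 : ContDiff ℝ ∞ (deriv (deriv θ)) := by fun_prop
  have c0 := hθ.continuous
  have c1 := hθ1.continuous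
  have c2 := hθ2.continuous
  have cq := continuous_radialWeight (n := n) hn3 hm
  have cr := continuous_confRate (n := n) hm
  set w1 : ℝ → ℝ := fun t => radialWeight n m t * (θ t * (deriv (deriv θ) t +
      ((n : ℝ) - 3) * (1 + confRate n m t) * deriv θ t)) with hw1
  set w2 : ℝ → ℝ := fun t => radialWeight n m t * θ t ^ 2 with hw2
  have cw1 : Continuous w1 := by fun_prop
  have cw2 : Continuous w2 := by fun_prop
  have i1 : Integrable w1 :=
    cw1.integrable_of_hasCompactSupport (hc.mul_right.mul_left)
  have i2 : Integrable w2 := by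
    refine cw2.integrable_of_hasCompactSupport ?_
    have : w2 = fun t => (radialWeight n m t * θ t) * θ t := by funext t; simp only [hw2]; ring
    rw [this]
    exact hc.mul_left
  set S := coneOver Γ ∩ {x : Pt n | horizonRadius n m ≤ ‖x‖ ∧ ‖x‖ ≤ R} with hS
  have hSm : MeasurableSet S := (hΓ.isCompact_cone_annulus hR0).measurableSet
  have hu := hΓ.smoothOffZero_coneTest hε hθ
  obtain ⟨J, hJc, hJ⟩ := hΓ.exists_continuousOn_jacobiOp hn3 hm hu
  have hφ : ContinuousOn (confFactor n m) {0}ᶜ := fun x hx =>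
    (hasFDerivAt_confFactor hn3 hm hx).continuousAt.continuousWithinAt
  have hlogc : ContinuousOn (fun x : Pt n => Real.log ‖x‖) {0}ᶜ :=
    ContinuousOn.log (by fun_prop) fun x hx => norm_ne_zero_iff.2 hx
  -- θ vanishes up to T ≥ log R₀, hence u = 0 on the horizon and the boundary integral disappears.
  have hbdry : ∫ x in truncatedCone n m Γ ∩ {x | ‖x‖ = horizonRadius n m},
      coneTest ν ε θ x * (fderiv ℝ (coneTest ν ε θ) x (-radialUnit n m x) -
        horizonSecondForm n m x (coneNormal n m ν x) * coneTest ν ε θ x)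
        * confFactor n m x ^ (n - 2) ∂μHE[n - 2] = 0 := by
    have hmeas : MeasurableSet (truncatedCone n m Γ ∩ {x | ‖x‖ = horizonRadius n m}) := by
      refine (hΓ.measurableSet_cone.inter ?_).inter ?_
      · exact measurableSet_le measurable_const measurable_norm
      · exact measurableSet_eq_fun measurable_norm measurable_const
    rw [setIntegral_congr_fun hmeas (g := fun _ => 0), integral_zero]
    rintro x ⟨-, hx⟩
    have : coneTest ν ε θ x = 0 := by
      rw [coneTest, hθT _ (by rw [show ‖x‖ = _ from hx]; exact hT), zero_mul]
    simp only [this, zero_mul]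
  rw [indexForm, hbdry, add_zero, truncatedCone_inter_eq]
  have hfi : IntegrableOn (fun x => coneTest ν ε θ x * jacobiOp (schwarzschild n m)
      (coneNormal n m ν) (coneTest ν ε θ) x * confFactor n m x ^ (n - 1)) S μHE[n - 1] := by
    refine IntegrableOn.congr_fun (f := fun x => coneTest ν ε θ x * J x * confFactor n m x ^ (n - 1))
      ?_ (fun x hx => by simp only [hJ x hx.1]) hSm
    exact hΓ.integrableOn_cone_annulus (by omega) hR0
      ((hu.continuousOn.mul hJc).mul (hφ.pow _))
  -- The radial factors vanish outside R₀ ≤ |x| ≤ R, so the integrals extend to the whole cone,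
  -- where the polar formula holds.
  have hpolar : ∀ {G : Pt n → ℝ} {w : ℝ → ℝ}, ContinuousOn G {0}ᶜ → Continuous w →
      (∀ t ≤ T, w t = 0) → (∀ t, Real.log R ≤ t → w t = 0) →
      IntegrableOn (fun x => G x * (‖x‖ ^ (n - 1))⁻¹ * w (Real.log ‖x‖)) S μHE[n - 1] ∧
      ∫ x in S, G x * (‖x‖ ^ (n - 1))⁻¹ * w (Real.log ‖x‖) ∂μHE[n - 1] =
        ∫ x in coneOver Γ, G x * (‖x‖ ^ (n - 1))⁻¹ * w (Real.log ‖x‖) ∂μHE[n - 1] := by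
    intro G w hG hw hwT hwR
    refine ⟨hΓ.integrableOn_cone_annulus (by omega) hR0 ((continuousOn_density hG).mul
      (hw.comp_continuousOn hlogc)), ?_⟩
    refine (setIntegral_eq_of_subset_of_forall_sdiff_eq_zero hΓ.measurableSet_cone
      Set.inter_subset_left ?_).symm
    rintro x ⟨hx, hxS⟩
    have h0 : 0 < ‖x‖ := norm_pos_iff.2 (hΓ.ne_zero_of_mem_cone hx)
    have : w (Real.log ‖x‖) = 0 := by
      by_cases h1 : horizonRadius n m ≤ ‖x‖
      · refine hwR _ (Real.log_le_log hR (le_of_lt ?_))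
        by_contra h2
        exact hxS ⟨hx, h1, not_lt.1 h2⟩
      · exact hwT _ ((Real.log_le_log h0 (not_le.1 h1).le).trans hT)
    rw [this, mul_zero]
  have hw1T : ∀ t ≤ T, w1 t = 0 := fun t ht => by simp only [hw1, hθT t ht]; ring
  have hw1R : ∀ t, Real.log R ≤ t → w1 t = 0 := fun t ht => by simp only [hw1, hθR t ht]; ring
  have hw2T : ∀ t ≤ T, w2 t = 0 := fun t ht => by simp only [hw2, hθT t ht]; ring
  have hw2R : ∀ t, Real.log R ≤ t → w2 t = 0 := fun t ht => by simp only [hw2, hθR t ht]; ring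
  have hEc := hΓ.smoothOffZero_coneEnergy.continuousOn
  obtain ⟨a1, b1⟩ := hpolar hEc (w := fun t => w1 t + (n - 2) * w2 t) (by fun_prop)
    (fun t ht => by rw [hw1T t ht, hw2T t ht]; ring) (fun t ht => by rw [hw1R t ht, hw2R t ht]; ring)
  obtain ⟨a2, b2⟩ := hpolar (G := fun _ => (1 : ℝ)) continuousOn_const cw1 hw1T hw1R
  replace b1 := b1.trans (hκi (fun t => w1 t + (n - 2) * w2 t) (by fun_prop))
  rw [integral_add i1 (i2.const_mul _), integral_const_mul] at b1
  replace b2 := b2.trans (hκi' _ cw1)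
  have hint : ∫ t, w1 t = -∫ t, radialWeight n m t * deriv θ t ^ 2 :=
    integral_radialWeight_mul hn hm hθ hc
  have hle : ∫ x in S, (coneEnergy ν x * (‖x‖ ^ (n - 1))⁻¹ *
        (w1 (Real.log ‖x‖) + (n - 2) * w2 (Real.log ‖x‖)) +
      ε * (1 * (‖x‖ ^ (n - 1))⁻¹ * w1 (Real.log ‖x‖))) ∂μHE[n - 1] ≤
      ∫ x in S, coneTest ν ε θ x * jacobiOp (schwarzschild n m)
      (coneNormal n m ν) (coneTest ν ε θ) x * confFactor n m x ^ (n - 1) ∂μHE[n - 1] := by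
    refine setIntegral_mono_on (a1.add (a2.const_mul ε)) hfi hSm fun x hx => ?_
    have h0 := hΓ.ne_zero_of_mem_cone hx.1
    have hr : 0 < ‖x‖ := norm_pos_iff.2 h0
    have hφ0 := confFactor_pos (n := n) hm x
    have h := hΓ.le_coneTest_mul_jacobiOp hmin hn3 hm hε hθ hx.1
    have h' := mul_le_mul_of_nonneg_right h (pow_nonneg hφ0.le (n - 1))
    refine le_of_eq_of_le ?_ h'
    simp only [hw1, hw2, radialWeight, ← confFactor_eq_confProfile h0,
      ← logConfCoeff_eq_confRate h0, Real.exp_log hr]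
    -- The powers match because φ^{n-1} φ⁻² |x|⁻² = (φ|x|)^{n-3} |x|^{1-n}.
    obtain ⟨k, rfl⟩ : ∃ k, n = k + 3 := ⟨n - 3, by omega⟩
    have e1 : k + 3 - 1 = k + 2 := by omega
    have e2 : k + 3 - 3 = k := by omega
    rw [e1, e2]
    field_simp
    ring
  rw [integral_add a1 (a2.const_mul ε), integral_const_mul, b1, b2, hint] at hle
  linarith

end IsClosedOrientedHypersurface

/-! ### Bumps with disjoint supports -/

section Bumps

/-- A smooth function supported in `[1/4, 3/4]`. -/
def unitBump : ContDiffBump (1 / 2 : ℝ) := ⟨1 / 8, 1 / 4, by norm_num, by norm_num⟩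

lemma unitBump_eq_zero {t : ℝ} (h : t ≤ 1 / 4 ∨ 3 / 4 ≤ t) : unitBump t = 0 := by
  refine unitBump.zero_of_le_dist ?_
  change 1 / 4 ≤ dist t (1 / 2)
  rw [Real.dist_eq, le_abs]
  rcases h with h | h
  · right; linarith
  · left; linarith

/-- The bumps `b((t - T) / L - i)`, with disjoint supports. -/
def shiftedBump (T L : ℝ) (i : ℕ) (t : ℝ) : ℝ := unitBump ((t - T) / L - i)

lemma contDiff_unitBump : ContDiff ℝ ∞ (unitBump : ℝ → ℝ) := unitBump.contDiff

lemma contDiff_shiftedBump (T L : ℝ) (i : ℕ) : ContDiff ℝ ∞ (shiftedBump T L i) :=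
  contDiff_unitBump.comp (by fun_prop)

lemma deriv_shiftedBump (T L : ℝ) (i : ℕ) (t : ℝ) :
    deriv (shiftedBump T L i) t = deriv unitBump ((t - T) / L - i) * L⁻¹ := by
  have h1 : HasDerivAt (fun t => (t - T) / L - i) L⁻¹ t := by
    have := (((hasDerivAt_id t).sub_const T).div_const L).sub_const (i : ℝ)
    simpa using this
  exact (((contDiff_unitBump.differentiable (by simp)) _).hasDerivAt.comp t h1).deriv

lemma deriv_unitBump_eq_zero {t : ℝ} (h : t < 1 / 4 ∨ 3 / 4 < t) : deriv unitBump t = 0 := by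
  have : (unitBump : ℝ → ℝ) =ᶠ[𝓝 t] fun _ => 0 := by
    rcases h with h | h
    · filter_upwards [gt_mem_nhds h] with s hs
      exact unitBump_eq_zero (Or.inl hs.le)
    · filter_upwards [lt_mem_nhds h] with s hs
      exact unitBump_eq_zero (Or.inr hs.le)
  rw [this.deriv_eq]
  simp

lemma sub_natCast_separated {i j : ℕ} (hij : i ≠ j) (s : ℝ) :
    (s - i < 1 / 4 ∨ 3 / 4 < s - i) ∨ (s - j < 1 / 4 ∨ 3 / 4 < s - j) := by
  by_contra h
  push Not at h
  obtain ⟨⟨h1, h2⟩, h3, h4⟩ := h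
  rcases lt_or_gt_of_ne hij with h | h
  · have : (i : ℝ) + 1 ≤ j := by exact_mod_cast h
    linarith
  · have : (j : ℝ) + 1 ≤ i := by exact_mod_cast h
    linarith

lemma shiftedBump_mul {T L : ℝ} {i j : ℕ} (hij : i ≠ j) (t : ℝ) :
    shiftedBump T L i t * shiftedBump T L j t = 0 := by
  rcases sub_natCast_separated hij ((t - T) / L) with h | h
  · rw [shiftedBump, unitBump_eq_zero (h.imp le_of_lt le_of_lt), zero_mul]
  · rw [mul_comm, shiftedBump, unitBump_eq_zero (h.imp le_of_lt le_of_lt), zero_mul]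

lemma deriv_shiftedBump_mul {T L : ℝ} {i j : ℕ} (hij : i ≠ j) (t : ℝ) :
    deriv (shiftedBump T L i) t * deriv (shiftedBump T L j) t = 0 := by
  rw [deriv_shiftedBump, deriv_shiftedBump]
  rcases sub_natCast_separated hij ((t - T) / L) with h | h
  · rw [deriv_unitBump_eq_zero h]; ring
  · rw [mul_comm, deriv_unitBump_eq_zero h]; ring

/-- Disjoint supports make ∫ χ² and ∫ χ'² diagonal in the coefficients, so one estimate for a single
bump serves the whole span. -/
lemma sq_sum_of_mul_eq_zero {k : ℕ} {f : Fin k → ℝ} (h : ∀ i j, i ≠ j → f i * f j = 0)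
    (c : Fin k → ℝ) : (∑ i, c i * f i) ^ 2 = ∑ i, c i ^ 2 * f i ^ 2 := by
  rw [sq, Finset.sum_mul_sum]
  refine Finset.sum_congr rfl fun i _ => ?_
  rw [Finset.sum_eq_single i]
  · ring
  · intro j _ hj
    have := h i j hj.symm
    linear_combination c i * c j * this
  · simp

lemma integral_comp_affine (f : ℝ → ℝ) (T : ℝ) {L : ℝ} (hL : 0 < L) (i : ℕ) :
    ∫ t, f ((t - T) / L - i) = L * ∫ t, f t := by
  rw [integral_sub_right_eq_self (fun t => f (t / L - i)) T,
    Measure.integral_comp_div (fun t => f (t - i)) L, integral_sub_right_eq_self f (i : ℝ),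
    abs_of_pos hL, smul_eq_mul]

lemma hasCompactSupport_unitBump : HasCompactSupport (unitBump : ℝ → ℝ) := unitBump.hasCompactSupport

lemma integrable_mul_sq {p f : ℝ → ℝ} (hp : Continuous p) (hf : Continuous f)
    (hfc : HasCompactSupport f) : Integrable fun t => p t * f t ^ 2 := by
  have h : Integrable fun t => p t * f t * f t :=
    ((hp.mul hf).mul hf).integrable_of_hasCompactSupport hfc.mul_left
  exact h.congr (Eventually.of_forall fun t => by ring)

lemma integral_sq_unitBump_pos : 0 < ∫ t, unitBump t ^ 2 := by
  have hc : Continuous fun t => unitBump t ^ 2 := contDiff_unitBump.continuous.pow 2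
  refine (hc.integral_pos_of_hasCompactSupport_nonneg_nonzero (x := 1 / 2) ?_ ?_ ?_)
  · have : (fun t => unitBump t ^ 2) = fun t => unitBump t * unitBump t := by funext t; ring
    rw [this]
    exact hasCompactSupport_unitBump.mul_left
  · intro t; positivity
  · have : unitBump (1 / 2) = 1 := unitBump.one_of_mem_closedBall
      (Metric.mem_closedBall_self unitBump.rIn_pos.le)
    rw [this]
    norm_num

end Bumps

/-! ### The Hardy constant and unbounded Dirichlet index -/

namespace IsClosedOrientedHypersurface

variable {n : ℕ} {Γ : Set (Pt n)} {ν : Pt n → Pt n} {m : ℝ}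

/-- Where |x|²|A|² vanishes at a point of Γ, all tangential derivatives of the normal of the cone
vanish, and on T_pΓ these are the derivatives of ν. -/
lemma exists_coneEnergy_pos (hΓ : IsClosedOrientedHypersurface Γ ν)
    (h : ¬ IsTotallyGeodesicInSphere Γ ν) : ∃ x ∈ coneOver Γ, 0 < coneEnergy ν x := by
  by_contra hcon
  push Not at hcon
  refine h fun p hp v hv w _ => ?_
  have hpn := hΓ.norm_eq_one hp
  have hpC : p ∈ coneOver Γ := ⟨1, one_pos, p, hp, (one_smul ℝ p).symm⟩
  have h0 := hΓ.ne_zero_of_mem_cone hpC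
  have h1 := le_antisymm (hcon p hpC) (coneEnergy_nonneg p)
  rw [coneEnergy, hpn, one_pow, one_mul, coneNormSq] at h1
  have h2 : ∀ i j, tangD (coneField ν) i (fun y => coneField ν y j) p = 0 := by
    intro i j
    have h3 := (Finset.sum_eq_zero_iff_of_nonneg fun i _ =>
      Finset.sum_nonneg fun j _ => mul_self_nonneg _).1 h1 i (Finset.mem_univ i)
    exact mul_self_eq_zero.1 ((Finset.sum_eq_zero_iff_of_nonneg fun j _ =>
      mul_self_nonneg _).1 h3 j (Finset.mem_univ j))
  have hcp : coneField ν p = ν p := by rw [coneField, hpn, inv_one, one_smul]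
  have h3 : fderiv ℝ (coneField ν) p v = 0 := by
    ext j
    rw [← fderiv_coord ((hΓ.contDiffAt_coneField h0).differentiableAt (by simp)),
      ← sum_mul_tangD (coneField ν) _ v (by rw [hcp, real_inner_comm]; exact hv.2)]
    simp [h2]
  have h4 : ⟪p, v⟫ = 0 := hv.1
  rw [hΓ.fderiv_coneField h0, hpn, inv_one, one_smul, one_smul, h4, zero_smul, sub_zero] at h3
  rw [linkSecondForm, h3, inner_zero_left, neg_zero]

/-- The index form of the test functions `e^{-(n-3)t/2} χ(t) (|x|² |A|² + ε)^{1/2}`. -/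
lemma exists_indexForm_le (hΓ : IsClosedOrientedHypersurface Γ ν) (hmin : IsMinimalInSphere Γ ν)
    (hn : 4 ≤ n) (hn7 : n ≤ 7) (hm : 0 < m) (h : ¬ IsTotallyGeodesicInSphere Γ ν) :
    ∃ κ ε K : ℝ, 0 < κ ∧ 0 < ε ∧ 0 ≤ K ∧ ∀ (χ : ℝ → ℝ), ContDiff ℝ ∞ χ →
      ∀ (T R : ℝ), 0 < R → 0 ≤ T → Real.log (horizonRadius n m) ≤ T → (∀ t ≤ T, χ t = 0) →
      (∀ t, Real.log R ≤ t → χ t = 0) →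
      indexForm n m (truncatedCone n m Γ) (coneNormal n m ν) R
        (coneTest ν ε fun t => Real.exp (-((n - 3) / 2 * t)) * χ t) ≤
        κ * (K * (∫ t, deriv χ t ^ 2) - 3 / 20 * ∫ t, χ t ^ 2) := by
  obtain ⟨κ, κ', hκ0, hκ', hκp, hQ⟩ := hΓ.indexForm_coneTest_le hmin hn hm
  have hκ := hκp (hΓ.exists_coneEnergy_pos h)
  have hn3 : 3 ≤ n := by omega
  -- Chosen so that εκ' ≤ κ/10: the regularisation costs at most a factor 11/10 in the gradient
  -- term.
  set ε := κ / (10 * (κ' + 1)) with hε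
  have hε0 : 0 < ε := by positivity
  have hεκ : ε * κ' ≤ κ / 10 := by
    rw [hε, div_mul_eq_mul_div, div_le_div_iff₀ (by positivity) (by norm_num)]
    nlinarith
  -- After the substitution the weight is φ^{n-3}, which lies between 1 and P0 for t ≥ 0.
  set P0 := confProfile n m 0 ^ (n - 3) with hP0
  have hP0' : 0 ≤ P0 := pow_nonneg (zero_le_one.trans (one_le_confProfile hn3 hm 0)) _
  refine ⟨κ, ε, 121 / 10 * P0, hκ, hε0, by positivity, fun χ hχ T R hR hT hRT hχT hχR => ?_⟩
  set α : ℝ := (n - 3) / 2 with hα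
  set θ : ℝ → ℝ := fun t => Real.exp (-(α * t)) * χ t with hθdef
  have hθ : ContDiff ℝ ∞ θ := by fun_prop
  have hQθ := hQ ε hε0 θ hθ T R hR hRT (fun t ht => by simp only [hθdef, hχT t ht, mul_zero])
    (fun t ht => by simp only [hθdef, hχR t ht, mul_zero])
  have hχ1 : ContDiff ℝ ∞ (deriv χ) := by fun_prop
  have hc : HasCompactSupport χ := by
    refine HasCompactSupport.of_support_subset_isCompact (isCompact_Icc (a := T) (b := Real.log R)) ?_
    intro t ht
    rw [Function.mem_support] at ht
    exact ⟨le_of_not_ge fun h => ht (hχT t h), le_of_not_ge fun h => ht (hχR t h)⟩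
  have hcθ : HasCompactSupport θ := hc.mul_left
  have cq := continuous_radialWeight (n := n) hn3 hm
  have hθ1 : ContDiff ℝ ∞ (deriv θ) := by fun_prop
  have i1 := integrable_mul_sq cq hθ1.continuous hcθ.deriv
  have i2 := integrable_mul_sq cq hθ.continuous hcθ
  have j1 := integrable_mul_sq (p := fun _ => 1) continuous_const hχ1.continuous hc.deriv
  have j2 := integrable_mul_sq (p := fun _ => 1) continuous_const hχ.continuous hc
  simp only [one_mul] at j1 j2
  have hdθ : ∀ t, deriv θ t = Real.exp (-(α * t)) * (deriv χ t - α * χ t) := by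
    intro t
    have h1 : HasDerivAt (fun t => Real.exp (-(α * t))) (Real.exp (-(α * t)) * -α) t := by
      have h := ((hasDerivAt_id t).const_mul α).neg.exp
      simpa using h
    have h2 : HasDerivAt θ _ t := h1.mul ((hχ.differentiable (by simp)) t).hasDerivAt
    rw [h2.deriv]
    ring
  have hweight : ∀ t, radialWeight n m t * Real.exp (-(α * t)) ^ 2 =
      confProfile n m t ^ (n - 3) := by
    intro t
    have h1 : Real.exp t ^ (n - 3) * Real.exp (-(α * t)) ^ 2 = 1 := by
      rw [← Real.exp_nat_mul, ← Real.exp_nat_mul, ← Real.exp_add, Real.exp_eq_one_iff, hα,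
        Nat.cast_sub hn3]
      push_cast
      ring
    rw [radialWeight, mul_pow, mul_assoc, h1, mul_one]
  -- The Hardy condition ((n-3)/2)² < n - 2 with two losses of 11/10, one from ε and one from
  -- Young's inequality. The case n = 7 is the tightest: 4.84 - 5 = -0.16. For n = 8 already 25/4 >
  -- 6.
  have hα2 : 121 / 100 * α ^ 2 - (n - 2) ≤ -(3 / 20) := by
    rw [hα]
    have : n = 4 ∨ n = 5 ∨ n = 6 ∨ n = 7 := by omega
    rcases this with rfl | rfl | rfl | rfl <;> norm_num
  have hpt : ∀ t, 11 / 10 * (radialWeight n m t * deriv θ t ^ 2) -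
      (n - 2) * (radialWeight n m t * θ t ^ 2) ≤
      121 / 10 * P0 * deriv χ t ^ 2 - 3 / 20 * χ t ^ 2 := by
    intro t
    have e1 : radialWeight n m t * deriv θ t ^ 2 =
        confProfile n m t ^ (n - 3) * (deriv χ t - α * χ t) ^ 2 := by
      rw [hdθ, ← hweight]; ring
    have e2 : radialWeight n m t * θ t ^ 2 = confProfile n m t ^ (n - 3) * χ t ^ 2 := by
      rw [← hweight]; simp only [hθdef]; ring
    rw [e1, e2]
    -- The upper bound for φ is available only for t ≥ 0; for t < 0 ≤ T the function χ vanishes near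
    -- t.
    rcases lt_or_ge t 0 with ht | ht
    · have h1 : χ =ᶠ[𝓝 t] fun _ => 0 := by
        filter_upwards [gt_mem_nhds (ht.trans_le hT)] with s hs
        exact hχT s hs.le
      rw [h1.deriv_eq, h1.eq_of_nhds]
      simp
    · have hP1 : 1 ≤ confProfile n m t ^ (n - 3) := one_le_pow₀ (one_le_confProfile hn3 hm t)
      have hP2 : confProfile n m t ^ (n - 3) ≤ P0 :=
        pow_le_pow_left₀ (zero_le_one.trans (one_le_confProfile hn3 hm t))
          (confProfile_le hn3 hm ht) _
      generalize confProfile n m t ^ (n - 3) = P at *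
      generalize deriv χ t = d
      generalize χ t = c
      -- Young's inequality with weights 1 + 10 and 1 + 1/10: the derivative of χ may be expensive,
      -- since it becomes small after stretching.
      have hsq : (d - α * c) ^ 2 ≤ 11 * d ^ 2 + 11 / 10 * α ^ 2 * c ^ 2 := by
        nlinarith [sq_nonneg (10 * d + α * c)]
      have s1 : P * (11 / 10 * (d - α * c) ^ 2 - (n - 2) * c ^ 2) ≤
          P * (121 / 10 * d ^ 2 - 3 / 20 * c ^ 2) := by
        refine mul_le_mul_of_nonneg_left ?_ (by linarith)
        nlinarith [sq_nonneg c]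
      nlinarith [mul_nonneg (sub_nonneg.2 hP2) (sq_nonneg d),
        mul_nonneg (sub_nonneg.2 hP1) (sq_nonneg c)]
  have hint := integral_mono ((i1.const_mul (11 / 10)).sub (i2.const_mul ((n : ℝ) - 2)))
    ((j1.const_mul (121 / 10 * P0)).sub (j2.const_mul (3 / 20))) hpt
  simp only [Pi.sub_apply] at hint
  rw [integral_sub (i1.const_mul _) (i2.const_mul _), integral_sub (j1.const_mul _) (j2.const_mul _),
    integral_const_mul, integral_const_mul, integral_const_mul, integral_const_mul] at hint
  have hI : 0 ≤ ∫ t, radialWeight n m t * deriv θ t ^ 2 := by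
    refine integral_nonneg fun t => ?_
    have h1 := one_le_confProfile hn3 hm t
    have : 0 ≤ radialWeight n m t := pow_nonneg (by positivity) _
    positivity
  refine hQθ.trans ?_
  calc (κ + ε * κ') * (∫ t, radialWeight n m t * deriv θ t ^ 2)
          - (n - 2) * κ * ∫ t, radialWeight n m t * θ t ^ 2
      ≤ κ * (11 / 10 * (∫ t, radialWeight n m t * deriv θ t ^ 2) -
          (n - 2) * ∫ t, radialWeight n m t * θ t ^ 2) := by
        nlinarith [mul_nonneg (sub_nonneg.2 hεκ) hI]
    _ ≤ _ := mul_le_mul_of_nonneg_left hint hκ.le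

/-- If the link is not totally geodesic, then the Dirichlet indices are unbounded. -/
theorem eventually_le_indD (hΓ : IsClosedOrientedHypersurface Γ ν) (hmin : IsMinimalInSphere Γ ν)
    (hn : 4 ≤ n) (hn7 : n ≤ 7) (hm : 0 < m) (h : ¬ IsTotallyGeodesicInSphere Γ ν) (k : ℕ) :
    ∀ᶠ R : ℝ in atTop, (k : ℕ∞) ≤ indD n m (truncatedCone n m Γ) (coneNormal n m ν) R := by
  obtain ⟨κ, ε, K, hκ, hε, hK, hQ⟩ := hΓ.exists_indexForm_le hmin hn hn7 hm h
  -- T ≥ 0 gives smoothness at the origin and the bound on φ; T ≥ log R₀ gives vanishing at the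
  -- horizon.
  set T := max 0 (Real.log (horizonRadius n m)) with hT
  have hT0 : 0 ≤ T := le_max_left _ _
  set B0 := ∫ t, unitBump t ^ 2 with hB0
  have hB0p : 0 < B0 := integral_sq_unitBump_pos
  set B1 := ∫ t, deriv unitBump t ^ 2 with hB1
  have hB1p : 0 ≤ B1 := integral_nonneg fun t => by positivity
  -- Stretching a bump by L multiplies ∫ χ² by L and ∫ χ'² by 1/L, so negativity requires K B1 <
  -- (3/20) B0 L². This L satisfies it, because L ≥ 1.
  set L := 1 + K * B1 / (3 / 20 * B0) with hL
  have hL1 : 1 ≤ L := by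
    have : 0 ≤ K * B1 / (3 / 20 * B0) := by positivity
    linarith
  have hLp : 0 < L := by linarith
  have hneg : K * (L⁻¹ * B1) - 3 / 20 * (L * B0) < 0 := by
    have h1 : K * B1 < 3 / 20 * B0 * L := by
      rw [hL, mul_add, mul_div_cancel₀ _ (by positivity)]
      linarith [hB0p]
    have h2 : K * B1 < L * (3 / 20 * B0 * L) :=
      h1.trans_le (le_mul_of_one_le_left (by positivity) hL1)
    have h3 : L * (K * (L⁻¹ * B1) - 3 / 20 * (L * B0)) < 0 := by
      have : L * (K * (L⁻¹ * B1) - 3 / 20 * (L * B0)) = K * B1 - L * (3 / 20 * B0 * L) := by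
        field_simp
      rw [this]; linarith
    by_contra h4
    exact absurd h3 (not_lt.2 (mul_nonneg hLp.le (not_lt.1 h4)))
  -- From this radius on there is room for k bumps of length L between T and log R.
  filter_upwards [eventually_ge_atTop (Real.exp (T + k * L)), eventually_gt_atTop 0] with R hR hR0
  have hlogR : T + k * L ≤ Real.log R := (Real.le_log_iff_exp_le hR0).2 hR
  set b : Fin k → ℝ → ℝ := fun i => shiftedBump T L i with hb
  set χ : (Fin k → ℝ) → ℝ → ℝ := fun c t => ∑ i, c i * b i t with hχ
  have hbT : ∀ i, ∀ t ≤ T, b i t = 0 := by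
    intro i t ht
    refine unitBump_eq_zero (Or.inl ?_)
    have h1 : (t - T) / L ≤ 0 := div_nonpos_of_nonpos_of_nonneg (by linarith) hLp.le
    have h2 : (0 : ℝ) ≤ (i : ℕ) := Nat.cast_nonneg _
    linarith
  have hbR : ∀ i, ∀ t, Real.log R ≤ t → b i t = 0 := by
    intro i t ht
    refine unitBump_eq_zero (Or.inr ?_)
    have h1 : (k : ℝ) ≤ (t - T) / L := by rw [le_div_iff₀ hLp]; linarith
    have h2 : ((i : ℕ) : ℝ) + 1 ≤ k := by exact_mod_cast i.2
    linarith
  have hχT : ∀ c, ∀ t ≤ T, χ c t = 0 := fun c t ht => by simp only [hχ, hbT _ t ht]; simp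
  have hχR : ∀ c, ∀ t, Real.log R ≤ t → χ c t = 0 := fun c t ht => by
    simp only [hχ, hbR _ t ht]; simp
  have hχs : ∀ c, ContDiff ℝ ∞ (χ c) := fun c =>
    ContDiff.sum fun i _ => contDiff_const.mul (contDiff_shiftedBump T L i)
  have hbc : ∀ i, HasCompactSupport (b i) := by
    intro i
    refine HasCompactSupport.of_support_subset_isCompact (isCompact_Icc (a := T) (b := Real.log R)) ?_
    intro t ht
    rw [Function.mem_support] at ht
    exact ⟨le_of_not_ge fun h => ht (hbT i t h), le_of_not_ge fun h => ht (hbR i t h)⟩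
  have hsqint : ∀ {f : ℝ → ℝ}, Continuous f → HasCompactSupport f → Integrable fun t => f t ^ 2 := by
    intro f hf hfc
    simpa using integrable_mul_sq (p := fun _ => 1) continuous_const hf hfc
  have hχsq : ∀ c, ∫ t, χ c t ^ 2 = (∑ i, c i ^ 2) * (L * B0) := by
    intro c
    have h1 : ∀ t, χ c t ^ 2 = ∑ i, c i ^ 2 * b i t ^ 2 := fun t =>
      sq_sum_of_mul_eq_zero (fun i j hij => shiftedBump_mul (fun h => hij (Fin.ext h)) t) c
    simp only [h1]
    rw [integral_finsetSum _ fun (i : Fin k) _ =>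
      (hsqint (contDiff_shiftedBump T L i).continuous (hbc i)).const_mul _, Finset.sum_mul]
    refine Finset.sum_congr rfl fun i _ => ?_
    rw [integral_const_mul]
    congr 1
    exact integral_comp_affine (fun t => unitBump t ^ 2) T hLp i
  have hχ'sq : ∀ c, ∫ t, deriv (χ c) t ^ 2 = (∑ i, c i ^ 2) * (L⁻¹ * B1) := by
    intro c
    have h0 : ∀ t, deriv (χ c) t = ∑ i, c i * deriv (b i) t := by
      intro t
      have : HasDerivAt (χ c) (∑ i, c i * deriv (b i) t) t := HasDerivAt.fun_sum fun i _ =>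
        (((contDiff_shiftedBump T L i).differentiable (by simp)) t).hasDerivAt.const_mul _
      exact this.deriv
    have h1 : ∀ t, deriv (χ c) t ^ 2 = ∑ i, c i ^ 2 * deriv (b i) t ^ 2 := fun t => by
      rw [h0]
      exact sq_sum_of_mul_eq_zero
        (fun i j hij => deriv_shiftedBump_mul (fun h => hij (Fin.ext h)) t) c
    simp only [h1]
    rw [integral_finsetSum _ fun (i : Fin k) _ => (hsqint ((contDiff_shiftedBump T L i).continuous_deriv
      (by simp)) (hbc i).deriv).const_mul _, Finset.sum_mul]
    refine Finset.sum_congr rfl fun i _ => ?_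
    rw [integral_const_mul]
    congr 1
    have h2 : ∀ t, deriv (b i) t ^ 2 = (fun s => (deriv unitBump s * L⁻¹) ^ 2) ((t - T) / L - (i : ℕ)) :=
      fun t => by simp only [hb, deriv_shiftedBump]
    rw [integral_congr_ae (Eventually.of_forall h2)]
    rw [integral_comp_affine (fun s => (deriv unitBump s * L⁻¹) ^ 2) T hLp i]
    simp only [mul_pow]
    rw [integral_mul_const, ← hB1]
    field_simp
  set v : Fin k → Pt n → ℝ := fun i =>
    coneTest ν ε fun t => Real.exp (-((n - 3) / 2 * t)) * b i t with hv
  set lin := Fintype.linearCombination ℝ v with hlin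
  have hlin' : ∀ c, lin c = coneTest ν ε fun t => Real.exp (-((n - 3) / 2 * t)) * χ c t := by
    intro c
    funext x
    rw [hlin, Fintype.linearCombination_apply, Finset.sum_apply]
    simp only [Pi.smul_apply, smul_eq_mul, hv, coneTest, hχ, Finset.mul_sum, Finset.sum_mul]
    exact Finset.sum_congr rfl fun i _ => by ring
  have hQc : ∀ c, c ≠ 0 →
      indexForm n m (truncatedCone n m Γ) (coneNormal n m ν) R (lin c) < 0 := by
    intro c hc
    have hpos : 0 < ∑ i, c i ^ 2 := by
      refine (Finset.sum_nonneg fun i _ => sq_nonneg _).lt_of_ne' fun h => hc ?_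
      funext i
      have := (Finset.sum_eq_zero_iff_of_nonneg fun i _ => sq_nonneg _).1 h i (Finset.mem_univ i)
      simpa using this
    rw [hlin']
    refine (hQ (χ c) (hχs c) T R hR0 hT0 (le_max_right _ _) (hχT c) (hχR c)).trans_lt ?_
    rw [hχsq, hχ'sq]
    have : κ * (K * ((∑ i, c i ^ 2) * (L⁻¹ * B1)) - 3 / 20 * ((∑ i, c i ^ 2) * (L * B0))) =
        κ * (∑ i, c i ^ 2) * (K * (L⁻¹ * B1) - 3 / 20 * (L * B0)) := by ring
    rw [this]
    exact mul_neg_of_pos_of_neg (by positivity) hneg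
  have hzero : indexForm n m (truncatedCone n m Γ) (coneNormal n m ν) R 0 = 0 := by
    simp [indexForm]
  -- Linear independence comes for free: a nonzero coefficient vector gives a strictly negative
  -- value of Q, whereas Q(0) = 0.
  have hinj : Function.Injective lin := by
    rw [← LinearMap.ker_eq_bot, LinearMap.ker_eq_bot']
    intro c hc
    by_contra hne
    have := hQc c hne
    rw [hc, hzero] at this
    exact lt_irrefl _ this
  have hrank : Cardinal.toENat (Module.rank ℝ (LinearMap.range lin)) = k := by
    rw [← Module.finrank_eq_rank, LinearMap.finrank_range_of_inj hinj]
    simp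
  rw [indD, negIndex, ← hrank]
  refine le_iSup₂_of_le (LinearMap.range lin) ⟨?_, ?_⟩ le_rfl
  · rintro _ ⟨c, rfl⟩
    rw [hlin']
    refine ⟨hΓ.contDiff_coneTest hε (by have := hχs c; fun_prop) hT0
      (fun t ht => by rw [hχT c t ht, mul_zero]), ?_⟩
    rintro x ⟨-, hx | hx⟩
    · rw [coneTest, hx, hχR c _ le_rfl, mul_zero, zero_mul]
    · rw [coneTest, hx, hχT c _ (le_max_right _ _), mul_zero, zero_mul]
  · rintro _ ⟨c, rfl⟩ hne
    exact hQc c fun h => hne (by rw [h, map_zero])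

end IsClosedOrientedHypersurface

/-! ### The area of the unit sphere -/

section SphereMeasure

open scoped Pointwise

/-- The hypothesis says that f is injective on s with K-Lipschitz inverse, to which the Lipschitz
bound applies. -/
lemma euclideanHausdorffMeasure_le_image {X Y : Type*} [MetricSpace X] [MeasurableSpace X]
    [BorelSpace X] [MetricSpace Y] [MeasurableSpace Y] [BorelSpace Y] {K : NNReal} {f : X → Y}
    {s : Set X} (hf : ∀ x ∈ s, ∀ y ∈ s, dist x y ≤ K * dist (f x) (f y)) (d : ℕ) :
    μHE[d] s ≤ (K : ENNReal) ^ d * μHE[d] (f '' s) := by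
  rcases s.eq_empty_or_nonempty with rfl | ⟨x₀, hx₀⟩
  · simp
  have : Nonempty X := ⟨x₀⟩
  have hinj : Set.InjOn f s := fun x hx y hy hxy => by
    have := hf x hx y hy
    rw [hxy, dist_self, mul_zero] at this
    exact dist_le_zero.1 this
  have hg : LipschitzOnWith K (Function.invFunOn f s) (f '' s) := by
    refine LipschitzOnWith.of_dist_le_mul ?_
    rintro _ ⟨x, hx, rfl⟩ _ ⟨y, hy, rfl⟩
    rw [hinj.leftInvOn_invFunOn hx, hinj.leftInvOn_invFunOn hy]
    exact hf x hx y hy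
  have h := euclideanHausdorffMeasure_image_le hg d
  rwa [hinj.leftInvOn_invFunOn.image_image] at h

/-- In 1 - c^{k+1} = (1 - c)(1 + c + ... + c^k) every summand is at least c^k. -/
lemma mul_pow_le_one_sub_pow {c : ℝ} (h0 : 0 ≤ c) (h1 : c ≤ 1) (k : ℕ) :
    ((k : ℝ) + 1) * (1 - c) * c ^ k ≤ 1 - c ^ (k + 1) := by
  induction k with
  | zero => simp
  | succ k ih =>
    push_cast
    have h2 : c ^ (k + 1) ≤ c ^ k := pow_le_pow_of_le_one h0 h1 k.le_succ
    have h3 : ((k : ℝ) + 1) * (1 - c) * c ^ (k + 1) ≤ ((k : ℝ) + 1) * (1 - c) * c ^ k := by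
      have : 0 ≤ ((k : ℝ) + 1) * (1 - c) := mul_nonneg (by positivity) (by linarith)
      gcongr
    have h4 : c ^ (k + 1 + 1) = c ^ (k + 1) * c := pow_succ _ _
    nlinarith

variable {k : ℕ}

/-- The map `t b ↦ π b + t p`, where `π` is the projection to the orthogonal complement of `p`. -/
def flattenSector (p x : Pt (k + 1)) : Pt (k + 1) :=
  (‖x‖⁻¹ • x - ⟪p, ‖x‖⁻¹ • x⟫ • p) + ‖x‖ • p

lemma flattenSector_smul {p b : Pt (k + 1)} (hb : ‖b‖ = 1) {t : ℝ} (ht : 0 < t) :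
    flattenSector p (t • b) = (b - ⟪p, b⟫ • p) + t • p := by
  have h1 : ‖t • b‖ = t := by rw [norm_smul, hb, mul_one, Real.norm_of_nonneg ht.le]
  rw [flattenSector, h1, smul_smul, inv_mul_cancel₀ ht.ne', one_smul]

lemma norm_sub_inner_smul_sq {p : Pt (k + 1)} (hp : ‖p‖ = 1) (w : Pt (k + 1)) :
    ‖w - ⟪p, w⟫ • p‖ ^ 2 = ‖w‖ ^ 2 - ⟪p, w⟫ ^ 2 := by
  rw [norm_sub_sq_real, inner_smul_right, norm_smul, hp, real_inner_comm w p, mul_one,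
    Real.norm_eq_abs, sq_abs]
  ring

lemma norm_smul_sub_smul_sq {b b' : Pt (k + 1)} (hb : ‖b‖ = 1) (hb' : ‖b'‖ = 1) (t t' : ℝ) :
    ‖t • b - t' • b'‖ ^ 2 = (t - t') ^ 2 + t * t' * ‖b - b'‖ ^ 2 := by
  rw [norm_sub_sq_real, norm_sub_sq_real, inner_smul_left, inner_smul_right, norm_smul, norm_smul,
    hb, hb', mul_one, mul_one, Real.norm_eq_abs, Real.norm_eq_abs, sq_abs, sq_abs]
  simp only [conj_trivial]
  ring

/-- b - b' is orthogonal to b + b', so p may be replaced by p minus the midpoint of b and b', a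
vector of length at most δ. Chords of a small cap are therefore almost orthogonal to p. -/
lemma abs_inner_sub_le {p b b' : Pt (k + 1)} (hb : ‖b‖ = 1) (hb' : ‖b'‖ = 1) {δ : ℝ}
    (h : dist b p ≤ δ) (h' : dist b' p ≤ δ) : |⟪p, b - b'⟫| ≤ δ * ‖b - b'‖ := by
  have h1 : ⟪b + b', b - b'⟫ = 0 := by
    rw [inner_add_left, inner_sub_right, inner_sub_right, real_inner_self_eq_norm_sq,
      real_inner_self_eq_norm_sq, hb, hb', real_inner_comm b b']
    ring
  have h2 : ⟪p, b - b'⟫ = ⟪p - (1 / 2 : ℝ) • (b + b'), b - b'⟫ := by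
    rw [inner_sub_left, inner_smul_left, h1, mul_zero, sub_zero]
  have h3 : ‖p - (1 / 2 : ℝ) • (b + b')‖ ≤ δ := by
    have : p - (1 / 2 : ℝ) • (b + b') = (1 / 2 : ℝ) • ((p - b) + (p - b')) := by module
    rw [this, norm_smul, Real.norm_of_nonneg (by norm_num : (0 : ℝ) ≤ 1 / 2)]
    have := norm_add_le (p - b) (p - b')
    rw [dist_comm, dist_eq_norm] at h h'
    linarith
  rw [h2]
  exact (abs_real_inner_le_norm _ _).trans (by gcongr)

lemma norm_flat_sub_sq {p b b' : Pt (k + 1)} (hp : ‖p‖ = 1) (t t' : ℝ) :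
    ‖((b - ⟪p, b⟫ • p) + t • p) - ((b' - ⟪p, b'⟫ • p) + t' • p)‖ ^ 2 =
      ‖(b - b') - ⟪p, b - b'⟫ • p‖ ^ 2 + (t - t') ^ 2 := by
  have h1 : ((b - ⟪p, b⟫ • p) + t • p) - ((b' - ⟪p, b'⟫ • p) + t' • p) =
      ((b - b') - ⟪p, b - b'⟫ • p) + (t - t') • p := by
    rw [inner_sub_right]; module
  have h2 : ⟪(b - b') - ⟪p, b - b'⟫ • p, (t - t') • p⟫ = 0 := by
    rw [inner_smul_right, inner_sub_left, inner_smul_left, real_inner_self_eq_norm_sq, hp,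
      real_inner_comm]
    simp
  rw [h1, norm_add_sq_real, h2, norm_smul, hp, mul_one, Real.norm_eq_abs, sq_abs]
  ring

/-- The volume of a product of an interval on the line through `p` and a set in its orthogonal
complement. -/
lemma volume_flat {p : Pt (k + 1)} (hp : ‖p‖ = 1) (A : Set (Pt (k + 1)))
    (hA : ∀ x ∈ A, ⟪p, x⟫ = 0) {a b : ℝ} :
    volume {x : Pt (k + 1) | ∃ w ∈ A, ∃ t ∈ Set.Ico a b, x = w + t • p} =
      ENNReal.ofReal (b - a) * μHE[k] A := by
  set s : Submodule ℝ (Pt (k + 1)) := Submodule.span ℝ {p} with hs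
  have hp0 : p ≠ 0 := fun h => by simp [h] at hp
  have hfin : Module.finrank ℝ sᗮ = k := by
    have h1 := s.finrank_add_finrank_orthogonal
    rw [hs, finrank_span_singleton hp0] at h1
    simp at h1
    rw [hs]
    omega
  set e := s.measurableEquivProd (0 : Pt (k + 1))
  have he : MeasurePreserving e (volume : Measure (Pt (k + 1))) volume := by
    have := s.measurePreserving_measurableEquivProd (0 : Pt (k + 1))
    rw [InnerProductSpace.euclideanHausdorffMeasure_eq_volume] at this
    exact this
  set ψ : ℝ ≃ₗᵢ[ℝ] s := LinearIsometryEquiv.toSpanUnitSingleton p hp with hψ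
  have hψv : ∀ t, (ψ t : Pt (k + 1)) = t • p := fun t => rfl
  set A' : Set sᗮ := (↑) ⁻¹' A with hA'
  have hAA : ((↑) : sᗮ → Pt (k + 1)) '' A' = A := by
    rw [hA', Set.image_preimage_eq_iff]
    intro x hx
    exact ⟨⟨x, by rw [hs, Submodule.mem_orthogonal_singleton_iff_inner_right]; exact hA x hx⟩, rfl⟩
  have himg : {x : Pt (k + 1) | ∃ w ∈ A, ∃ t ∈ Set.Ico a b, x = w + t • p} =
      e ⁻¹' ((ψ '' Set.Ico a b) ×ˢ A') := by
    rw [← e.image_symm]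
    ext x
    simp only [Set.mem_ofPred_eq, Set.mem_image, Set.mem_prod, Prod.exists]
    constructor
    · rintro ⟨w, hw, t, ht, rfl⟩
      refine ⟨ψ t, ⟨w, ?_⟩, ⟨⟨t, ht, rfl⟩, hw⟩, ?_⟩
      · rw [hs, Submodule.mem_orthogonal_singleton_iff_inner_right]; exact hA w hw
      · rw [Submodule.measurableEquivProd_symm_apply]
        simp [hψv, add_comm]
    · rintro ⟨u, w, ⟨⟨t, ht, rfl⟩, hw⟩, rfl⟩
      refine ⟨w, hw, t, ht, ?_⟩
      rw [Submodule.measurableEquivProd_symm_apply]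
      simp [hψv, add_comm]
  have hvol : (volume : Measure sᗮ) A' = μHE[k] A := by
    rw [← InnerProductSpace.euclideanHausdorffMeasure_eq_volume, hfin]
    exact (isometry_subtype_coe.euclideanHausdorffMeasure_image (d := k) A').symm.trans
      (congrArg _ hAA)
  have hint : volume (ψ '' Set.Ico a b) = ENNReal.ofReal (b - a) := by
    rw [ψ.image_eq_preimage_symm, ψ.symm.measurePreserving.measure_preimage
      measurableSet_Ico.nullMeasurableSet, Real.volume_Ico]
  rw [himg, he.measure_preimage_equiv, Measure.volume_eq_prod, Measure.prod_prod, hvol, hint]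

lemma measurableSet_Ioo_smul {B : Set (Metric.sphere (0 : Pt (k + 1)) 1)} (hB : MeasurableSet B) :
    MeasurableSet (Set.Ioo (0 : ℝ) 1 • ((↑) '' B : Set (Pt (k + 1)))) := by
  have hB' : MeasurableSet ((↑) '' B : Set (Pt (k + 1))) :=
    (MeasurableEmbedding.subtype_coe Metric.isClosed_sphere.measurableSet).measurableSet_image.2 hB
  have h : (Set.Ioo (0 : ℝ) 1 • ((↑) '' B : Set (Pt (k + 1)))) =
      {x | 0 < ‖x‖ ∧ ‖x‖ < 1} ∩ (fun x => ‖x‖⁻¹ • x) ⁻¹' ((↑) '' B : Set (Pt (k + 1))) := by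
    ext x
    constructor
    · rintro ⟨t, ht, _, ⟨b, hb, rfl⟩, rfl⟩
      have hn : ‖t • (b : Pt (k + 1))‖ = t := by
        rw [norm_smul, mem_sphere_zero_iff_norm.1 b.2, mul_one, Real.norm_of_nonneg ht.1.le]
      refine ⟨by rw [Set.mem_ofPred_eq, hn]; exact ht, ⟨b, hb, ?_⟩⟩
      simp only [hn, smul_smul, inv_mul_cancel₀ ht.1.ne', one_smul]
    · rintro ⟨hx, hb⟩
      refine ⟨‖x‖, hx, _, hb, ?_⟩
      simp only [smul_smul, mul_inv_cancel₀ hx.1.ne', one_smul]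
  rw [h]
  refine MeasurableSet.inter ?_ (hB'.preimage (by fun_prop))
  exact (measurableSet_lt measurable_const measurable_norm).inter
    (measurableSet_lt measurable_norm measurable_const)

/-- Comparison of the two measures of a subset of a small spherical cap. -/
lemma compare_sphere_measures {p : Pt (k + 1)} (hp : ‖p‖ = 1) {δ : ℝ} (h0 : 0 < δ) (h1 : δ < 1)
    {K : NNReal} (hK : (K : ℝ) = (1 - δ)⁻¹) {B : Set (Metric.sphere (0 : Pt (k + 1)) 1)}
    (hB : MeasurableSet B) (hBp : ∀ b ∈ B, dist (b : Pt (k + 1)) p ≤ δ) :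
    μHE[k] B ≤ (K : ENNReal) ^ (2 * k + 1) * (volume : Measure (Pt (k + 1))).toSphere B ∧
    (volume : Measure (Pt (k + 1))).toSphere B ≤ (K : ENNReal) ^ (2 * k + 1) * μHE[k] B := by
  have hc : 0 < 1 - δ := by linarith
  have hK0 : (0 : ℝ) < K := by rw [hK]; positivity
  have hK1 : (1 : ℝ) ≤ K := by rw [hK]; exact (one_le_inv₀ hc).2 (by linarith)
  have hKc : (K : ℝ) * (1 - δ) = 1 := by rw [hK]; field_simp
  set B' : Set (Pt (k + 1)) := (↑) '' B with hB'
  have hnorm : ∀ b ∈ B', ‖b‖ = 1 := by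
    rintro _ ⟨b, -, rfl⟩
    exact mem_sphere_zero_iff_norm.1 b.2
  have hdist : ∀ b ∈ B', dist b p ≤ δ := by
    rintro _ ⟨b, hb, rfl⟩
    exact hBp b hb
  set π : Pt (k + 1) → Pt (k + 1) := fun b => b - ⟪p, b⟫ • p with hπ
  set A := π '' B' with hA
  have hAp : ∀ x ∈ A, ⟪p, x⟫ = 0 := by
    rintro _ ⟨b, -, rfl⟩
    rw [hπ]
    simp only
    rw [inner_sub_right, inner_smul_right, real_inner_self_eq_norm_sq, hp]
    ring
  have hππ : ∀ b b', ‖π b - π b'‖ ^ 2 = ‖b - b'‖ ^ 2 - ⟪p, b - b'⟫ ^ 2 := by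
    intro b b'
    rw [← norm_sub_inner_smul_sq hp]
    congr 2
    simp only [hπ, inner_sub_right]
    module
  -- Projection along p shortens chords of the cap by at most the factor K⁻¹ = 1 - δ.
  have hlow : ∀ b ∈ B', ∀ b' ∈ B', ‖b - b'‖ ^ 2 ≤ K ^ 2 * ‖π b - π b'‖ ^ 2 := by
    intro b hb b' hb'
    have h2 := abs_inner_sub_le (hnorm b hb) (hnorm b' hb') (hdist b hb) (hdist b' hb')
    have h3 : ⟪p, b - b'⟫ ^ 2 ≤ (δ * ‖b - b'‖) ^ 2 := by
      rw [← sq_abs]; gcongr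
    have h4 : (1 - δ) ^ 2 * ‖b - b'‖ ^ 2 ≤ ‖π b - π b'‖ ^ 2 := by
      rw [hππ]; nlinarith [sq_nonneg ‖b - b'‖]
    calc ‖b - b'‖ ^ 2 = K ^ 2 * ((1 - δ) ^ 2 * ‖b - b'‖ ^ 2) := by
          rw [← mul_assoc, ← mul_pow, hKc]; ring
      _ ≤ _ := by gcongr
  have hHB : μHE[k] B = μHE[k] B' := by
    rw [hB', isometry_subtype_coe.euclideanHausdorffMeasure_image]
  have i1 : μHE[k] A ≤ μHE[k] B' := by
    have : LipschitzOnWith 1 π B' := by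
      refine LipschitzOnWith.of_dist_le_mul fun b _ b' _ => ?_
      rw [dist_eq_norm, dist_eq_norm, NNReal.coe_one, one_mul, ← sq_le_sq₀ (by positivity)
        (by positivity), hππ]
      nlinarith [sq_nonneg ⟪p, b - b'⟫]
    simpa using euclideanHausdorffMeasure_image_le this k
  have i2 : μHE[k] B' ≤ (K : ENNReal) ^ k * μHE[k] A := by
    refine euclideanHausdorffMeasure_le_image (fun b hb b' hb' => ?_) k
    rw [dist_eq_norm, dist_eq_norm, ← sq_le_sq₀ (by positivity) (by positivity), mul_pow]
    exact hlow b hb b' hb'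
  -- A thin sector over B. Flattening turns it into a product of an interval of length δ with the
  -- projected set A, and distorts lengths by at most K in both directions. Its volume thus links
  -- the Hausdorff measure of B with Lebesgue measure.
  set T : Set (Pt (k + 1)) := {x | ∃ b ∈ B', ∃ t ∈ Set.Ico (1 - δ) 1, x = t • b} with hT
  have hTimg : flattenSector p '' T = {x | ∃ w ∈ A, ∃ t ∈ Set.Ico (1 - δ) 1, x = w + t • p} := by
    ext x
    constructor
    · rintro ⟨_, ⟨b, hb, t, ht, rfl⟩, rfl⟩
      exact ⟨π b, ⟨b, hb, rfl⟩, t, ht, flattenSector_smul (hnorm b hb) (hc.trans_le ht.1)⟩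
    · rintro ⟨_, ⟨b, hb, rfl⟩, t, ht, rfl⟩
      exact ⟨t • b, ⟨b, hb, t, ht, rfl⟩, flattenSector_smul (hnorm b hb) (hc.trans_le ht.1)⟩
  have hTvol : volume (flattenSector p '' T) = ENNReal.ofReal δ * μHE[k] A := by
    rw [hTimg, volume_flat hp A hAp]; congr 2; ring
  have hupper : ∀ x ∈ T, ∀ y ∈ T, dist (flattenSector p x) (flattenSector p y) ≤ K * dist x y := by
    rintro _ ⟨b, hb, t, ht, rfl⟩ _ ⟨b', hb', t', ht', rfl⟩
    rw [flattenSector_smul (hnorm b hb) (hc.trans_le ht.1),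
      flattenSector_smul (hnorm b' hb') (hc.trans_le ht'.1), dist_eq_norm, dist_eq_norm,
      ← sq_le_sq₀ (by positivity) (by positivity), mul_pow, norm_flat_sub_sq hp,
      norm_smul_sub_smul_sq (hnorm b hb) (hnorm b' hb'), norm_sub_inner_smul_sq hp]
    have e1 : (1 - δ) ^ 2 ≤ t * t' := by
      rw [sq]; exact mul_le_mul ht.1 ht'.1 hc.le (hc.le.trans ht.1)
    have e2 : 1 ≤ (K : ℝ) ^ 2 * (t * t') := by
      calc (1 : ℝ) = K ^ 2 * (1 - δ) ^ 2 := by rw [← mul_pow, hKc, one_pow]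
        _ ≤ _ := by gcongr
    have e3 : (1 : ℝ) ≤ (K : ℝ) ^ 2 := one_le_pow₀ hK1
    nlinarith [mul_le_mul_of_nonneg_right e2 (sq_nonneg ‖b - b'‖),
      mul_le_mul_of_nonneg_right e3 (sq_nonneg (t - t')), sq_nonneg ⟪p, b - b'⟫]
  have hlower : ∀ x ∈ T, ∀ y ∈ T, dist x y ≤ K * dist (flattenSector p x) (flattenSector p y) := by
    rintro _ ⟨b, hb, t, ht, rfl⟩ _ ⟨b', hb', t', ht', rfl⟩
    rw [flattenSector_smul (hnorm b hb) (hc.trans_le ht.1),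
      flattenSector_smul (hnorm b' hb') (hc.trans_le ht'.1), dist_eq_norm, dist_eq_norm,
      ← sq_le_sq₀ (by positivity) (by positivity), mul_pow, norm_flat_sub_sq hp,
      norm_smul_sub_smul_sq (hnorm b hb) (hnorm b' hb'), norm_sub_inner_smul_sq hp, ← hππ]
    have e1 : t * t' ≤ 1 := mul_le_one₀ ht.2.le (hc.le.trans ht'.1) ht'.2.le
    have e3 : (1 : ℝ) ≤ (K : ℝ) ^ 2 := one_le_pow₀ hK1
    nlinarith [hlow b hb b' hb', mul_le_mul_of_nonneg_right e1 (sq_nonneg ‖b - b'‖),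
      mul_le_mul_of_nonneg_right e3 (sq_nonneg (t - t'))]
  have hHE : (μHE[k + 1] : Measure (Pt (k + 1))) = volume :=
    EuclideanSpace.euclideanHausdorffMeasure_eq_volume _
  have i3 : ENNReal.ofReal δ * μHE[k] A ≤ (K : ENNReal) ^ (k + 1) * volume T := by
    rw [← hTvol, ← hHE]
    exact euclideanHausdorffMeasure_image_le (LipschitzOnWith.of_dist_le_mul hupper) _
  have i4 : volume T ≤ (K : ENNReal) ^ (k + 1) * (ENNReal.ofReal δ * μHE[k] A) := by
    rw [← hTvol, ← hHE]
    exact euclideanHausdorffMeasure_le_image hlower _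
  -- The surface measure of B is k + 1 times the volume of the open cone U over B, and the sector is
  -- U minus its dilate by 1 - δ. The half-open interval in T makes this an exact equality of sets.
  set U : Set (Pt (k + 1)) := Set.Ioo (0 : ℝ) 1 • B' with hU
  have hUm : MeasurableSet U := measurableSet_Ioo_smul hB
  have hTU : T = U \ ((1 - δ) • U) := by
    ext x
    constructor
    · rintro ⟨b, hb, t, ht, rfl⟩
      refine ⟨Set.smul_mem_smul ⟨hc.trans_le ht.1, ht.2⟩ hb, ?_⟩
      rintro ⟨_, ⟨t', ht', b', hb', rfl⟩, h⟩
      have h2 : ‖(1 - δ) • t' • b'‖ = ‖t • b‖ := congrArg norm h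
      rw [norm_smul, norm_smul, norm_smul, hnorm b hb, hnorm b' hb',
        Real.norm_of_nonneg hc.le, Real.norm_of_nonneg ht'.1.le,
        Real.norm_of_nonneg (hc.le.trans ht.1)] at h2
      nlinarith [ht.1, ht'.2]
    · rintro ⟨⟨t, ht, b, hb, rfl⟩, h⟩
      refine ⟨b, hb, t, ⟨?_, ht.2⟩, rfl⟩
      by_contra! hlt
      refine h ⟨(t / (1 - δ)) • b, Set.smul_mem_smul ⟨div_pos ht.1 hc, (div_lt_one hc).2 hlt⟩ hb, ?_⟩
      simp only [smul_smul]
      congr 1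
      field_simp
  have hUfin : volume U ≠ ⊤ := by
    refine measure_ne_top_of_subset (s := Metric.ball (0 : Pt (k + 1)) 1) ?_
      (measure_ball_lt_top (μ := volume)).ne
    rintro _ ⟨t, ht, b, hb, rfl⟩
    rw [mem_ball_zero_iff]
    simp only [norm_smul, hnorm b hb, mul_one, Real.norm_of_nonneg ht.1.le, ht.2]
  have hσ : (volume : Measure (Pt (k + 1))).toSphere B = ENNReal.ofReal (k + 1) * volume U := by
    rw [Measure.toSphere_apply' _ hB, finrank_euclideanSpace_fin]
    congr 1
    rw [ENNReal.ofReal_add (by positivity) zero_le_one]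
    simp
  have hvT : volume T = ENNReal.ofReal (1 - (1 - δ) ^ (k + 1)) * volume U := by
    have hsub : (1 - δ) • U ⊆ U := by
      rintro _ ⟨_, ⟨t, ht, b, hb, rfl⟩, rfl⟩
      simp only [smul_smul]
      exact Set.smul_mem_smul ⟨mul_pos hc ht.1, by nlinarith [ht.1, ht.2]⟩ hb
    have hsc : volume ((1 - δ) • U) = ENNReal.ofReal ((1 - δ) ^ (k + 1)) * volume U := by
      rw [Measure.addHaar_smul_of_nonneg _ hc.le, finrank_euclideanSpace_fin]
    rw [hTU, measure_sdiff hsub (hUm.const_smul₀ _).nullMeasurableSet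
      (by rw [hsc]; exact ENNReal.mul_ne_top ENNReal.ofReal_ne_top hUfin), hsc,
      ENNReal.ofReal_sub _ (by positivity), ENNReal.ofReal_one, ENNReal.sub_mul (fun _ _ => hUfin),
      one_mul]
  have hδ0 : ENNReal.ofReal δ ≠ 0 := by simpa using h0
  -- Bernoulli's inequality, and its converse up to the factor K^k in the next estimate, compare the
  -- volume of the sector with δ(k+1) times that of U.
  have r1 : 1 - (1 - δ) ^ (k + 1) ≤ δ * (k + 1) := by
    have := one_add_mul_le_pow (a := -δ) (by linarith) (k + 1)
    push_cast at this
    rw [← sub_eq_add_neg] at this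
    linarith
  have r2 : δ * (k + 1) ≤ K ^ k * (1 - (1 - δ) ^ (k + 1)) := by
    have := mul_pow_le_one_sub_pow hc.le (by linarith) k
    calc δ * (k + 1) = K ^ k * (((k : ℝ) + 1) * (1 - (1 - δ)) * (1 - δ) ^ k) := by
          have : (K : ℝ) ^ k * (1 - δ) ^ k = 1 := by rw [← mul_pow, hKc, one_pow]
          linear_combination -(δ * ((k : ℝ) + 1)) * this
      _ ≤ _ := by gcongr
  rw [hHB, hσ]
  have hKK : (K : ENNReal) ^ (2 * k + 1) = K ^ k * K ^ (k + 1) := by rw [← pow_add]; congr 1; ring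
  rw [hKK]
  constructor
  · refine (ENNReal.mul_le_mul_iff_right hδ0 ENNReal.ofReal_ne_top).1 ?_
    calc ENNReal.ofReal δ * μHE[k] B' ≤ ENNReal.ofReal δ * (K ^ k * μHE[k] A) := by gcongr
      _ = K ^ k * (ENNReal.ofReal δ * μHE[k] A) := by ring
      _ ≤ K ^ k * (K ^ (k + 1) * (ENNReal.ofReal (δ * (k + 1)) * volume U)) := by
          refine mul_le_mul_right (i3.trans ?_) _
          rw [hvT]
          gcongr
      _ = _ := by rw [ENNReal.ofReal_mul h0.le]; ring
  · refine (ENNReal.mul_le_mul_iff_right hδ0 ENNReal.ofReal_ne_top).1 ?_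
    calc ENNReal.ofReal δ * (ENNReal.ofReal (k + 1) * volume U)
        = ENNReal.ofReal (δ * (k + 1)) * volume U := by rw [ENNReal.ofReal_mul h0.le]; ring
      _ ≤ ENNReal.ofReal (K ^ k * (1 - (1 - δ) ^ (k + 1))) * volume U := by gcongr
      _ = K ^ k * volume T := by
          rw [ENNReal.ofReal_mul (by positivity), hvT, ENNReal.ofReal_pow NNReal.zero_le_coe,
            ENNReal.ofReal_coe_nnreal]
          ring
      _ ≤ K ^ k * (K ^ (k + 1) * (ENNReal.ofReal δ * μHE[k] B')) := by
          refine mul_le_mul_right (i4.trans ?_) _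
          gcongr
      _ = _ := by ring

/-- Separability gives a countable cover by balls of radius δ; made disjoint, they cut s into small
pieces on which the hypothesis applies. -/
lemma le_mul_of_forall_small_le {X : Type*} [MetricSpace X] [MeasurableSpace X] [BorelSpace X]
    [TopologicalSpace.SeparableSpace X] {μ κ : Measure X} {c : ENNReal} {δ : ℝ} (hδ : 0 < δ)
    (h : ∀ p : X, ∀ B, MeasurableSet B → (∀ b ∈ B, dist b p ≤ δ) → μ B ≤ c * κ B)
    {s : Set X} (hs : MeasurableSet s) : μ s ≤ c * κ s := by
  rcases isEmpty_or_nonempty X with hX | hX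
  · simp [Set.eq_empty_of_isEmpty s]
  set q := TopologicalSpace.denseSeq X
  set D := disjointed fun i => Metric.closedBall (q i) δ with hD
  have hDm : ∀ i, MeasurableSet (D i) :=
    MeasurableSet.disjointed fun i => Metric.isClosed_closedBall.measurableSet
  have hDU : ⋃ i, D i = Set.univ := by
    rw [hD, iUnion_disjointed, Set.eq_univ_iff_forall]
    intro x
    obtain ⟨i, hi⟩ := (TopologicalSpace.denseRange_denseSeq X).exists_dist_lt x hδ
    exact Set.mem_iUnion.2 ⟨i, hi.le⟩
  have hdis : Pairwise (Function.onFun Disjoint fun i => s ∩ D i) := fun i j hij =>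
    (disjoint_disjointed _ hij).mono Set.inter_subset_right Set.inter_subset_right
  have hsU : s = ⋃ i, s ∩ D i := by rw [← Set.inter_iUnion, hDU, Set.inter_univ]
  conv_lhs => rw [hsU]
  conv_rhs => rw [hsU]
  rw [measure_iUnion hdis fun i => hs.inter (hDm i), measure_iUnion hdis fun i => hs.inter (hDm i),
    ← ENNReal.tsum_mul_left]
  exact ENNReal.tsum_le_tsum fun i => h (q i) _ (hs.inter (hDm i)) fun b hb =>
    disjointed_subset _ i hb.2

/-- The Euclidean Hausdorff measure of the unit sphere is its surface measure. -/
theorem euclideanHausdorffMeasure_sphere :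
    (μHE[k] : Measure (Metric.sphere (0 : Pt (k + 1)) 1)) =
      (volume : Measure (Pt (k + 1))).toSphere := by
  have hlim (a b : ENNReal) (hab : ∀ δ : ℝ, 0 < δ → δ < 1 → ∀ K : NNReal, (K : ℝ) = (1 - δ)⁻¹ →
      a ≤ (K : ENNReal) ^ (2 * k + 1) * b) : a ≤ b := by
    set K : ℕ → NNReal := fun j => 1 + 1 / ((j : NNReal) + 1) with hK
    have h1 : Tendsto K atTop (𝓝 1) := by
      have := (tendsto_one_div_add_atTop_nhds_zero_nat (𝕜 := NNReal)).const_add 1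
      simpa [hK] using this
    have h2 : Tendsto (fun j => (K j : ENNReal) ^ (2 * k + 1) * b) atTop (𝓝 (1 ^ (2 * k + 1) * b)) := by
      refine ENNReal.Tendsto.mul_const ?_ (Or.inl (by simp))
      exact ((ENNReal.continuous_pow _).tendsto _).comp (ENNReal.tendsto_coe.2 h1)
    rw [one_pow, one_mul] at h2
    -- δ = 1/(j+2) has (1 - δ)⁻¹ = 1 + 1/(j+1), which tends to 1.
    refine ge_of_tendsto' h2 fun j => hab (1 / ((j : ℝ) + 2)) (by positivity) ?_ _ ?_
    · rw [div_lt_one (by positivity)]; linarith [(Nat.cast_nonneg j : (0 : ℝ) ≤ j)]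
    · rw [hK]
      push_cast
      field_simp
      ring_nf
      field_simp
      ring
  ext s hs
  refine le_antisymm (hlim _ _ fun δ h0 h1 K hK => ?_) (hlim _ _ fun δ h0 h1 K hK => ?_)
  · exact le_mul_of_forall_small_le h0 (fun p B hB hBp => (compare_sphere_measures
      (mem_sphere_zero_iff_norm.1 p.2) h0 h1 hK hB hBp).1) hs
  · exact le_mul_of_forall_small_le h0 (fun p B hB hBp => (compare_sphere_measures
      (mem_sphere_zero_iff_norm.1 p.2) h0 h1 hK hB hBp).2) hs

end SphereMeasure

/-! ### Stability of the cones which are totally geodesic -/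

section SphericalPart

variable {d : ℕ}

/-- The closed annulus. -/
def annulus (d : ℕ) (a b : ℝ) : Set (Pt d) := {y | a ≤ ‖y‖ ∧ ‖y‖ ≤ b}

lemma isCompact_annulus (a b : ℝ) : IsCompact (annulus d a b) := by
  refine (isCompact_closedBall (0 : Pt d) b).of_isClosed_subset ?_ fun y hy => ?_
  · exact (isClosed_le continuous_const continuous_norm).inter
      (isClosed_le continuous_norm continuous_const)
  · exact mem_closedBall_zero_iff.2 hy.2

lemma measurableSet_annulus (a b : ℝ) : MeasurableSet (annulus d a b) :=
  (isCompact_annulus a b).isClosed.measurableSet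

/-- A function with radial weight has no net derivative along an infinitesimal rotation. -/
lemma integral_fderiv_skew {A : Pt d →L[ℝ] Pt d} (hA : A ∈ skewAdjoint (Pt d →L[ℝ] Pt d))
    {a b : ℝ} {c : ℝ → ℝ} (hc : ContinuousOn c (Set.Icc a b)) {f : Pt d → ℝ}
    (hf : ContDiff ℝ 1 f) :
    ∫ y in annulus d a b, c ‖y‖ * fderiv ℝ f y (A y) = 0 := by
  let _ : NormedAlgebra ℚ (Pt d →L[ℝ] Pt d) := NormedAlgebra.restrictScalars ℚ ℝ _
  set ρ : ℝ → (Pt d ≃ₗᵢ[ℝ] Pt d) := fun s => Unitary.linearIsometryEquiv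
    ⟨NormedSpace.exp (s • A), NormedSpace.exp_mem_unitary_of_mem_skewAdjoint
      (skewAdjoint.smul_mem s hA)⟩ with hρ
  have hρe : ∀ s y, ρ s y = NormedSpace.exp (s • A) y := fun s y => rfl
  have hρ0 : ∀ y, ρ 0 y = y := fun y => by rw [hρe, zero_smul ℝ A, NormedSpace.exp_zero]; rfl
  have hρd : ∀ y s, HasDerivAt (fun s => ρ s y) (A (ρ s y)) s := fun y s => by
    have := (hasDerivAt_exp_smul_const' (𝕂 := ℝ) A s)
    exact this.clm_apply (hasDerivAt_const s y) |>.congr_deriv (by simp [hρe])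
  have hmem : ∀ s y, ρ s y ∈ annulus d a b ↔ y ∈ annulus d a b := fun s y => by
    simp [annulus]
  have hcA : ContinuousOn (fun y : Pt d => c ‖y‖) (annulus d a b) :=
    hc.comp continuous_norm.continuousOn fun y hy => hy
  have hf1 : Continuous (fderiv ℝ f) := hf.continuous_fderiv (by simp)
  -- The rotation exp(sA) preserves Lebesgue measure, the annulus and |y|, so the integral does not
  -- depend on s. Its derivative at s = 0 is the integral in question.
  have hconst : ∀ s, ∫ y in annulus d a b, c ‖y‖ * f (ρ s y) =
      ∫ y in annulus d a b, c ‖y‖ * f y := by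
    intro s
    have h1 := (ρ s).measurePreserving.setIntegral_preimage_emb
      (ρ s).toHomeomorph.measurableEmbedding (fun y => c ‖y‖ * f y) (annulus d a b)
    have h2 : ρ s ⁻¹' annulus d a b = annulus d a b := Set.ext fun y => hmem s y
    rw [h2] at h1
    simpa using h1
  obtain ⟨C, hC⟩ := (isCompact_annulus (d := d) a b).exists_bound_of_continuousOn
    (f := fun y => c ‖y‖ * fderiv ℝ f y (A y))
    (hcA.mul (Continuous.continuousOn (by fun_prop)))
  have key := hasDerivAt_integral_of_dominated_loc_of_deriv_le
    (μ := volume.restrict (annulus d a b)) (F := fun s y => c ‖y‖ * f (ρ s y))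
    (F' := fun s y => c ‖y‖ * fderiv ℝ f (ρ s y) (A (ρ s y))) (x₀ := (0 : ℝ)) (s := Set.univ)
    (bound := fun _ => C) Filter.univ_mem ?_ ?_ ?_ ?_ ?_ ?_
  · have h1 := key.2
    simp only [hconst] at h1
    have h2 := h1.unique (hasDerivAt_const _ _)
    simpa only [hρ0] using h2
  · refine Eventually.of_forall fun s => ContinuousOn.aestronglyMeasurable
      (hcA.mul (Continuous.continuousOn ?_)) (measurableSet_annulus a b)
    exact hf.continuous.comp (ρ s).continuous
  · refine ContinuousOn.integrableOn_compact (isCompact_annulus a b)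
      (hcA.mul (Continuous.continuousOn ?_))
    exact hf.continuous.comp (ρ 0).continuous
  · simp only [hρ0]
    exact ContinuousOn.aestronglyMeasurable
      (hcA.mul (Continuous.continuousOn (by fun_prop))) (measurableSet_annulus a b)
  · refine (ae_restrict_iff' (measurableSet_annulus a b)).2 (Eventually.of_forall
      fun y hy s _ => ?_)
    have := hC _ ((hmem s y).2 hy)
    simpa using this
  · exact integrableOn_const (isCompact_annulus a b).measure_lt_top.ne
  · refine Eventually.of_forall fun y s _ => ?_
    have h1 : HasDerivAt (fun s => f (ρ s y)) (fderiv ℝ f (ρ s y) (A (ρ s y))) s :=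
      ((hf.differentiable (by simp)).differentiableAt.hasFDerivAt).comp_hasDerivAt s (hρd y s)
    exact h1.const_mul _

/-- Integration by parts for an infinitesimal rotation. -/
lemma integral_mul_skew_nonpos {A : Pt d →L[ℝ] Pt d} (hA : A ∈ skewAdjoint (Pt d →L[ℝ] Pt d))
    {a b : ℝ} {c : ℝ → ℝ} (hc : ContinuousOn c (Set.Icc a b)) (hc0 : ∀ r ∈ Set.Icc a b, 0 ≤ c r)
    {v : Pt d → ℝ} (hv : ContDiff ℝ ∞ v) :
    ∫ y in annulus d a b, c ‖y‖ *
      (v y * (fderiv ℝ (fderiv ℝ v) y (A y) (A y) + fderiv ℝ v y (A (A y)))) ≤ 0 := by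
  have hv1 : ContDiff ℝ ∞ (fderiv ℝ v) := hv.fderiv_right (by simp)
  have hv2 : ContDiff ℝ ∞ (fderiv ℝ (fderiv ℝ v)) := hv1.fderiv_right (by simp)
  have c0 := hv.continuous
  have c1 := hv1.continuous
  have c2 := hv2.continuous
  have hcA : ContinuousOn (fun y : Pt d => c ‖y‖) (annulus d a b) :=
    hc.comp continuous_norm.continuousOn fun y hy => hy
  -- For the rotation field X = A y this is X(v Xv) = (Xv)² + v X²v; the left side has integral zero
  -- against a radial weight.
  have hd : ∀ y, fderiv ℝ (fun y => v y * fderiv ℝ v y (A y)) y (A y) =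
      fderiv ℝ v y (A y) ^ 2 +
      v y * (fderiv ℝ (fderiv ℝ v) y (A y) (A y) + fderiv ℝ v y (A (A y))) := by
    intro y
    have h1 : HasFDerivAt v (fderiv ℝ v y) y :=
      ((hv.differentiable (by simp)) y).hasFDerivAt
    have h2 : HasFDerivAt (fderiv ℝ v) (fderiv ℝ (fderiv ℝ v) y) y :=
      ((hv1.differentiable (by simp)) y).hasFDerivAt
    have h3 := h1.mul (h2.clm_apply A.hasFDerivAt)
    have h4 : HasFDerivAt (fun y => v y * fderiv ℝ v y (A y)) _ y := h3
    rw [h4.fderiv]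
    simp
    ring
  have h0 := integral_fderiv_skew hA hc (f := fun y => v y * fderiv ℝ v y (A y))
    (ContDiff.of_le (by fun_prop) (by simp : (1 : WithTop ℕ∞) ≤ ∞))
  simp only [hd, mul_add (c _)] at h0
  rw [integral_add] at h0
  · have : 0 ≤ ∫ y in annulus d a b, c ‖y‖ * fderiv ℝ v y (A y) ^ 2 :=
      setIntegral_nonneg (measurableSet_annulus a b) fun y hy =>
        mul_nonneg (hc0 _ hy) (sq_nonneg _)
    linarith
  · exact ContinuousOn.integrableOn_compact (isCompact_annulus a b)
      (hcA.mul (Continuous.continuousOn (by fun_prop)))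
  · exact ContinuousOn.integrableOn_compact (isCompact_annulus a b)
      (hcA.mul (Continuous.continuousOn (by fun_prop)))

/-- The infinitesimal rotation of the coordinates `i`, `j`. -/
def planeRotation (i j : Fin d) : Pt d →L[ℝ] Pt d :=
  InnerProductSpace.rankOne ℝ (EuclideanSpace.single j 1) (EuclideanSpace.single i 1)
    - InnerProductSpace.rankOne ℝ (EuclideanSpace.single i 1) (EuclideanSpace.single j 1)

lemma planeRotation_apply (i j : Fin d) (y : Pt d) : planeRotation i j y =
    y i • EuclideanSpace.single j 1 - y j • EuclideanSpace.single i 1 := by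
  simp [planeRotation, EuclideanSpace.inner_single_left]

lemma planeRotation_mem (i j : Fin d) : planeRotation i j ∈ skewAdjoint (Pt d →L[ℝ] Pt d) := by
  rw [skewAdjoint.mem_iff, ContinuousLinearMap.star_eq_adjoint, planeRotation, map_sub,
    InnerProductSpace.adjoint_rankOne, InnerProductSpace.adjoint_rankOne, neg_sub]

lemma sum_smul_single (y : Pt d) : ∑ i, y i • (EuclideanSpace.single i 1 : Pt d) = y := by
  ext j
  simp [Pi.single_apply]

/-- Together with the next lemma this expresses the sum over i, j of the squared rotation fields as
twice the spherical Laplacian; here the first-order part. Every plane is counted twice, once for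
each order of i and j. -/
lemma sum_planeRotation_sq (y : Pt d) :
    ∑ i, ∑ j, planeRotation i j (planeRotation i j y) = -(2 * ((d : ℝ) - 1)) • y := by
  have h : ∀ i j, planeRotation i j (planeRotation i j y) =
      (if i = j then (2 : ℝ) else 0) • y i • (EuclideanSpace.single i 1 : Pt d)
      - y j • EuclideanSpace.single j 1 - y i • EuclideanSpace.single i 1 := by
    intro i j
    rw [planeRotation_apply, planeRotation_apply]
    by_cases hij : i = j
    · subst hij
      simp only [sub_self, if_true]
      module
    · simp [hij, Ne.symm hij]
  simp only [h, Finset.sum_sub_distrib, ite_smul, zero_smul, Finset.sum_ite_eq, Finset.mem_univ,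
    if_true, sum_smul_single, Finset.sum_const, Finset.card_univ, Fintype.card_fin,
    ← Finset.smul_sum]
  module

lemma sum_planeRotation_bilin (B : Pt d →L[ℝ] Pt d →L[ℝ] ℝ) (hB : ∀ v w, B v w = B w v)
    (y : Pt d) : ∑ i, ∑ j, B (planeRotation i j y) (planeRotation i j y) =
      2 * (‖y‖ ^ 2 * ∑ i, B (EuclideanSpace.single i 1) (EuclideanSpace.single i 1) - B y y) := by
  have h : ∀ i j, B (planeRotation i j y) (planeRotation i j y) =
      y i ^ 2 * B (EuclideanSpace.single j 1) (EuclideanSpace.single j 1)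
      + y j ^ 2 * B (EuclideanSpace.single i 1) (EuclideanSpace.single i 1)
      - 2 * B (y i • EuclideanSpace.single i 1) (y j • EuclideanSpace.single j 1) := by
    intro i j
    rw [planeRotation_apply]
    simp only [map_sub, map_smul, _root_.sub_apply, _root_.smul_apply, smul_eq_mul]
    rw [hB (EuclideanSpace.single j 1) (EuclideanSpace.single i 1)]
    ring
  have h2 : ∑ i, ∑ j, B (y i • EuclideanSpace.single i 1) (y j • EuclideanSpace.single j 1) =
      B y y := by
    simp only [← map_sum, ← _root_.sum_apply, sum_smul_single]
  have h3 : ∑ i, y i ^ 2 = ‖y‖ ^ 2 := by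
    rw [EuclideanSpace.real_norm_sq_eq]
  simp only [h, Finset.sum_sub_distrib, Finset.sum_add_distrib, ← Finset.mul_sum, ← Finset.sum_mul,
    h2, h3]
  ring

/-- The spherical part of the Laplacian is nonpositive. -/
lemma integral_spherical_nonpos {a b : ℝ} {c : ℝ → ℝ} (hc : ContinuousOn c (Set.Icc a b))
    (hc0 : ∀ r ∈ Set.Icc a b, 0 ≤ c r) {v : Pt d → ℝ} (hv : ContDiff ℝ ∞ v) :
    ∫ y in annulus d a b, c ‖y‖ * (v y * (‖y‖ ^ 2 *
      ∑ i, fderiv ℝ (fderiv ℝ v) y (EuclideanSpace.single i 1) (EuclideanSpace.single i 1)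
      - fderiv ℝ (fderiv ℝ v) y y y - ((d : ℝ) - 1) * fderiv ℝ v y y)) ≤ 0 := by
  have hv1 : ContDiff ℝ ∞ (fderiv ℝ v) := hv.fderiv_right (by simp)
  have hv2 : ContDiff ℝ ∞ (fderiv ℝ (fderiv ℝ v)) := hv1.fderiv_right (by simp)
  have c0 := hv.continuous
  have c1 := hv1.continuous
  have c2 := hv2.continuous
  have hcA : ContinuousOn (fun y : Pt d => c ‖y‖) (annulus d a b) :=
    hc.comp continuous_norm.continuousOn fun y hy => hy
  -- |y|²Δ - D²(y, y) - (d-1) D(y) is the Laplacian of the sphere, equal to half the sum of X² over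
  -- the rotation fields X of the ordered coordinate pairs.
  have h : ∀ y, c ‖y‖ * (v y * (‖y‖ ^ 2 *
      ∑ i, fderiv ℝ (fderiv ℝ v) y (EuclideanSpace.single i 1) (EuclideanSpace.single i 1)
      - fderiv ℝ (fderiv ℝ v) y y y - ((d : ℝ) - 1) * fderiv ℝ v y y)) =
      2⁻¹ * ∑ i, ∑ j, c ‖y‖ * (v y * (fderiv ℝ (fderiv ℝ v) y (planeRotation i j y)
        (planeRotation i j y) + fderiv ℝ v y (planeRotation i j (planeRotation i j y)))) := by
    intro y
    have hs : ∀ p q, fderiv ℝ (fderiv ℝ v) y p q = fderiv ℝ (fderiv ℝ v) y q p := fun p q =>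
      ((hv.contDiffAt (x := y)).isSymmSndFDerivAt (by simp; norm_cast)).eq p q
    simp only [← Finset.mul_sum, Finset.sum_add_distrib, ← map_sum]
    rw [sum_planeRotation_bilin _ hs, sum_planeRotation_sq, map_smul, smul_eq_mul]
    ring
  simp only [h]
  rw [integral_const_mul, integral_finsetSum]
  · refine mul_nonpos_of_nonneg_of_nonpos (by norm_num) (Finset.sum_nonpos fun i _ => ?_)
    rw [integral_finsetSum]
    · exact Finset.sum_nonpos fun j _ => integral_mul_skew_nonpos (planeRotation_mem i j) hc hc0 hv
    · exact fun j _ => ContinuousOn.integrableOn_compact (isCompact_annulus a b)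
        (hcA.mul (Continuous.continuousOn (by fun_prop)))
  · exact fun i _ => ContinuousOn.integrableOn_compact (isCompact_annulus a b)
      (continuousOn_finsetSum _ fun j _ => hcA.mul (Continuous.continuousOn (by fun_prop)))

end SphericalPart

/-! ### The radial part of the index form on a hyperplane -/

section RadialPart

variable {n : ℕ} {m : ℝ}

lemma confRate_eq (hn : 3 ≤ n) (hm : 0 < m) (t : ℝ) :
    confRate n m t = -m / (Real.exp t ^ (n - 2) + m / 2) := by
  obtain ⟨k, rfl⟩ : ∃ k, n = k + 2 := ⟨n - 2, by omega⟩
  rw [confRate, Nat.add_sub_cancel, pow_add]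
  have := Real.exp_pos t
  field_simp

/-- The Riccati equation for z, now in the variable t. It makes the Ricci potential an exact
derivative, which allows the square to be completed in `integral_radialDensity_le`. -/
lemma hasDerivAt_confRate (hn : 3 ≤ n) (hm : 0 < m) (t : ℝ) :
    HasDerivAt (confRate n m) (-((n : ℝ) - 2) * (confRate n m t + confRate n m t ^ 2 / 2)) t := by
  have h0 : Real.exp t ^ (n - 2) + m / 2 ≠ 0 := by positivity
  have h1 := ((((Real.hasDerivAt_exp t).pow (n - 2)).add_const (m / 2)).inv h0).const_mul (-m)
  have h2 : confRate n m = fun t => -m * (Real.exp t ^ (n - 2) + m / 2)⁻¹ := by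
    funext s
    rw [confRate_eq hn hm, div_eq_mul_inv]
  rw [h2]
  refine h1.congr_deriv ?_
  obtain ⟨k, rfl⟩ : ∃ k, n = k + 3 := ⟨n - 3, by omega⟩
  have e : k + 3 - 2 = k + 1 := by omega
  simp only [e, Nat.add_sub_cancel, Pi.pow_apply]
  rw [e] at h0
  push_cast
  field_simp
  ring

/-- The area radius φ|x| is stationary at the horizon: its t-derivative is (1 + z) φ|x|. -/
lemma confRate_log_horizonRadius (hn : 3 ≤ n) (hm : 0 < m) :
    confRate n m (Real.log (horizonRadius n m)) = -1 := by
  have hn' : (3 : ℝ) ≤ n := by exact_mod_cast hn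
  have h : horizonRadius n m ^ (n - 2) = m / 2 := by
    rw [horizonRadius, ← Real.rpow_natCast, ← Real.rpow_mul (by positivity),
      Nat.cast_sub (by omega), Nat.cast_ofNat, one_div, inv_mul_cancel₀ (by linarith),
      Real.rpow_one]
  rw [confRate_eq hn hm, Real.exp_log (horizonRadius_pos n hm), h]
  field_simp
  ring

/-- The density of the radial part of the index form. -/
def radialDensity (n : ℕ) (m r w w₁ w₂ : ℝ) : ℝ :=
  confProfile n m (Real.log r) ^ (n - 3) * (w * ((r ^ 2)⁻¹ * (r ^ 2 * w₂ +
    (((n : ℝ) - 2) + ((n : ℝ) - 3) * confRate n m (Real.log r)) * (r * w₁)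
    - ((n : ℝ) - 2) * (confRate n m (Real.log r) + confRate n m (Real.log r) ^ 2 / 2) * w)))

/-- The radial index form is bounded below by its boundary term. -/
lemma integral_radialDensity_le (hn : 4 ≤ n) (hm : 0 < m) {R : ℝ} (hR : horizonRadius n m ≤ R)
    {w w₁ w₂ : ℝ → ℝ} (hw : ∀ r, HasDerivAt w (w₁ r) r) (hw₁ : ∀ r, HasDerivAt w₁ (w₂ r) r)
    (hw₂ : Continuous w₂) (hwR : w R = 0) :
    ∫ r in (horizonRadius n m)..R, radialDensity n m r (w r) (w₁ r) (w₂ r) * r ^ (n - 2) ≤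
      -((confProfile n m (Real.log (horizonRadius n m)) * horizonRadius n m) ^ (n - 3) *
        (horizonRadius n m * (w (horizonRadius n m) * w₁ (horizonRadius n m)))) := by
  have hn3 : 3 ≤ n := by omega
  have hr0 := horizonRadius_pos n hm
  set r₀ := horizonRadius n m with hr₀
  set P : ℝ → ℝ := fun r => confProfile n m (Real.log r) with hP
  set Z : ℝ → ℝ := fun r => confRate n m (Real.log r) with hZ
  have c0 : Continuous w := continuous_iff_continuousAt.2 fun r => (hw r).continuousAt
  have c1 : Continuous w₁ := continuous_iff_continuousAt.2 fun r => (hw₁ r).continuousAt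
  have hlog : ContinuousOn Real.log (Set.uIcc r₀ R) := by
    rw [Set.uIcc_of_le hR]
    exact Real.continuousOn_log.mono fun r hr => (hr0.trans_le hr.1).ne'
  have cP : ContinuousOn P (Set.uIcc r₀ R) := (continuous_confProfile hn3 hm).comp_continuousOn hlog
  have cZ : ContinuousOn Z (Set.uIcc r₀ R) := (continuous_confRate hm).comp_continuousOn hlog
  have cinv : ContinuousOn (fun r : ℝ => (r ^ 2)⁻¹) (Set.uIcc r₀ R) := by
    rw [Set.uIcc_of_le hR]
    exact ContinuousOn.inv₀ (by fun_prop) fun r hr => (pow_pos (hr0.trans_le hr.1) 2).ne'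
  have hF : ContinuousOn (fun r => radialDensity n m r (w r) (w₁ r) (w₂ r) * r ^ (n - 2))
      (Set.uIcc r₀ R) := by
    unfold radialDensity
    have e1 := c0.continuousOn (s := Set.uIcc r₀ R)
    have e2 := c1.continuousOn (s := Set.uIcc r₀ R)
    have e3 := hw₂.continuousOn (s := Set.uIcc r₀ R)
    have e4 : ContinuousOn (fun r => confRate n m (Real.log r)) (Set.uIcc r₀ R) := cZ
    exact ((cP.pow _).mul (e1.mul (cinv.mul (by fun_prop)))).mul (by fun_prop)
  -- The square obtained by comparison with (φ r)⁻¹, whose logarithmic t-derivative is -(1 + z). The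
  -- leftover coefficient n - 4 is where n ≥ 4 enters.
  set E : ℝ → ℝ := fun r => (P r * r) ^ (n - 3) * (r * (r ^ 2)⁻¹ * ((r * w₁ r + (1 + Z r) * w r) ^ 2 +
    ((n : ℝ) - 4) * (1 + Z r) ^ 2 * w r ^ 2)) with hE
  have hEc : ContinuousOn E (Set.uIcc r₀ R) := by
    have e1 := c0.continuousOn (s := Set.uIcc r₀ R)
    have e2 := c1.continuousOn (s := Set.uIcc r₀ R)
    exact ((cP.mul (by fun_prop)).pow _).mul (((continuousOn_id.mul cinv)).mul (by fun_prop))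
  have hEnn : ∀ r ∈ Set.Icc r₀ R, 0 ≤ E r := by
    intro r hr
    have hrp : 0 < r := hr0.trans_le hr.1
    have hPp : 0 < P r := one_pos.trans_le (one_le_confProfile hn3 hm _)
    have hn' : (0 : ℝ) ≤ (n : ℝ) - 4 := by
      have : (4 : ℝ) ≤ n := by exact_mod_cast hn
      linarith
    rw [hE]
    positivity
  have hder : ∀ r ∈ Set.uIcc r₀ R, HasDerivAt
      (fun r => (P r * r) ^ (n - 3) * (r * (w r * w₁ r) + (1 + Z r) * w r ^ 2))
      (radialDensity n m r (w r) (w₁ r) (w₂ r) * r ^ (n - 2) + E r) r := by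
    intro r hr
    rw [Set.uIcc_of_le hR] at hr
    have hrp : 0 < r := hr0.trans_le hr.1
    have h1 := (hasDerivAt_confProfile hn3 hm (Real.log r)).comp r (Real.hasDerivAt_log hrp.ne')
    have h2 := (hasDerivAt_confRate hn3 hm (Real.log r)).comp r (Real.hasDerivAt_log hrp.ne')
    have h3 : HasDerivAt (fun r => (P r * r) ^ (n - 3) * (r * (w r * w₁ r) + (1 + Z r) * w r ^ 2))
      _ r := ((h1.mul (hasDerivAt_id r)).pow (n - 3)).mul
        (((hasDerivAt_id r).mul ((hw r).mul (hw₁ r))).add ((h2.const_add 1).mul ((hw r).pow 2)))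
    refine h3.congr_deriv ?_
    obtain ⟨l, rfl⟩ : ∃ l, n = l + 4 := ⟨n - 4, by omega⟩
    have e1 : l + 4 - 3 = l + 1 := by omega
    have e2 : l + 4 - 2 = l + 1 + 1 := by omega
    simp only [hE, radialDensity, e1, e2, Pi.mul_apply, Pi.pow_apply,
      Function.comp_apply, id, Nat.add_sub_cancel, hP, hZ]
    push_cast
    field_simp
    ring
  have hint := intervalIntegral.integral_eq_sub_of_hasDerivAt hder
    (hF.add hEc).intervalIntegrable
  rw [intervalIntegral.integral_add hF.intervalIntegrable hEc.intervalIntegrable, hwR] at hint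
  have hE0 : 0 ≤ ∫ r in r₀..R, E r := intervalIntegral.integral_nonneg hR hEnn
  -- At r₀ the term (1 + Z) w² of the primitive vanishes, and at R so does w; only the w w₁ term at
  -- the horizon survives.
  have hZ0 : Z r₀ = -1 := confRate_log_horizonRadius hn3 hm
  rw [hZ0] at hint
  have : (confProfile n m (Real.log r₀)) = P r₀ := rfl
  rw [this]
  nlinarith

end RadialPart

/-! ### Polar coordinates on an annulus -/

section Polar

variable {k : ℕ}

/-- Integration in polar coordinates. -/
lemma integral_annulus_polar {a b : ℝ} (ha : 0 < a) (hab : a ≤ b) {f : Pt (k + 1) → ℝ}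
    (hf : ContinuousOn f (annulus (k + 1) a b)) :
    Integrable (fun θ : Metric.sphere (0 : Pt (k + 1)) 1 =>
      ∫ r in a..b, f (r • (θ : Pt (k + 1))) * r ^ k) (volume : Measure (Pt (k + 1))).toSphere ∧
    ∫ y in annulus (k + 1) a b, f y = ∫ θ : Metric.sphere (0 : Pt (k + 1)) 1,
      (∫ r in a..b, f (r • (θ : Pt (k + 1))) * r ^ k) ∂(volume : Measure (Pt (k + 1))).toSphere := by
  -- Extension by zero lets the global polar decomposition of Lebesgue measure and Fubini's theorem
  -- be applied to f, which is continuous only on the annulus.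
  set g := (annulus (k + 1) a b).indicator f with hg
  have hgi : Integrable g volume :=
    (integrable_indicator_iff (measurableSet_annulus a b)).2
      (hf.integrableOn_compact (isCompact_annulus a b))
  set Φ := homeomorphUnitSphereProd (Pt (k + 1)) with hΦ
  have hmp := (volume : Measure (Pt (k + 1))).measurePreserving_homeomorphUnitSphereProd
  have hfin : Module.finrank ℝ (Pt (k + 1)) - 1 = k := by simp
  rw [hfin] at hmp
  set G : Metric.sphere (0 : Pt (k + 1)) 1 × Set.Ioi (0 : ℝ) → ℝ :=
    fun x => g (x.2.1 • (x.1 : Pt (k + 1))) with hG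
  have hGΦ : ∀ x, G (Φ x) = g x := by
    intro x
    have : ((Φ.symm (Φ x) : ({0}ᶜ : Set (Pt (k + 1)))) : Pt (k + 1)) = x := by
      rw [Φ.symm_apply_apply]
    rw [← this]
    rfl
  have hinner : ∀ θ : Metric.sphere (0 : Pt (k + 1)) 1,
      ∫ r, G (θ, r) ∂(Measure.volumeIoiPow k) = ∫ r in a..b, f (r • (θ : Pt (k + 1))) * r ^ k := by
    intro θ
    have hθ : ‖(θ : Pt (k + 1))‖ = 1 := mem_sphere_zero_iff_norm.1 θ.2
    simp only [Measure.volumeIoiPow, ENNReal.ofReal]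
    rw [integral_withDensity_eq_integral_smul
      (measurable_subtype_coe.pow_const _).real_toNNReal,
      integral_subtype_comap measurableSet_Ioi
        (fun r : ℝ => Real.toNNReal (r ^ k) • g (r • (θ : Pt (k + 1)))),
      intervalIntegral.integral_of_le hab, ← integral_Icc_eq_integral_Ioc]
    have hsub : Set.Icc a b ⊆ Set.Ioi 0 := fun r hr => ha.trans_le hr.1
    have hnorm : ∀ r : ℝ, 0 < r → ‖r • (θ : Pt (k + 1))‖ = r := fun r hr => by
      rw [norm_smul, hθ, mul_one, Real.norm_of_nonneg hr.le]
    rw [setIntegral_eq_of_subset_of_forall_sdiff_eq_zero measurableSet_Ioi hsub]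
    · refine setIntegral_congr_fun measurableSet_Icc fun r hr => ?_
      have hr0 : 0 < r := hsub hr
      have hmem : r • (θ : Pt (k + 1)) ∈ annulus (k + 1) a b := by
        rw [annulus, Set.mem_ofPred_eq, hnorm r hr0]; exact hr
      simp only [hg, Set.indicator_of_mem hmem]
      rw [NNReal.smul_def, Real.coe_toNNReal _ (by positivity), smul_eq_mul, mul_comm]
    · rintro r ⟨hr0, hr⟩
      have hmem : r • (θ : Pt (k + 1)) ∉ annulus (k + 1) a b := by
        rw [annulus, Set.mem_ofPred_eq, hnorm r hr0]; exact hr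
      simp only [hg, Set.indicator_of_notMem hmem, smul_zero]
  have hGi : Integrable G ((volume : Measure (Pt (k + 1))).toSphere.prod (Measure.volumeIoiPow k)) := by
    rw [← hmp.integrable_comp_emb Φ.measurableEmbedding]
    have : G ∘ Φ = g ∘ ((↑) : ({0}ᶜ : Set (Pt (k + 1))) → Pt (k + 1)) := funext hGΦ
    rw [this, ← integrableOn_iff_comap_subtypeVal (measurableSet_singleton _).compl]
    exact hgi.integrableOn
  refine ⟨by simpa only [hinner] using hGi.integral_prod_left, ?_⟩
  calc ∫ y in annulus (k + 1) a b, f y = ∫ y, g y :=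
        (integral_indicator (measurableSet_annulus a b)).symm
    _ = ∫ x : ↥({0}ᶜ : Set (Pt (k + 1))), g (x : Pt (k + 1)) ∂(volume.comap Subtype.val) := by
        rw [integral_subtype_comap (measurableSet_singleton _).compl, restrict_compl_singleton]
    _ = ∫ x, G x ∂((volume : Measure (Pt (k + 1))).toSphere.prod (Measure.volumeIoiPow k)) := by
        rw [← hmp.integral_comp Φ.measurableEmbedding]
        exact integral_congr_ae (Eventually.of_forall fun x => (hGΦ x).symm)
    _ = _ := by
        rw [integral_prod _ hGi]
        simp only [hinner]

end Polar

/-! ### Stability of a hyperplane -/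

section FlatHyperplane

variable {k : ℕ} {m : ℝ}

/-- The density of the index form of a hyperplane through the origin. -/
def hyperplaneDensity (k : ℕ) (m : ℝ) (v : Pt (k + 1) → ℝ) (y : Pt (k + 1)) : ℝ :=
  confProfile (k + 2) m (Real.log ‖y‖) ^ (k - 1) * (v y *
    (∑ i, fderiv ℝ (fderiv ℝ v) y (EuclideanSpace.single i 1) (EuclideanSpace.single i 1)
    + ((k : ℝ) - 1) * (confRate (k + 2) m (Real.log ‖y‖) * (‖y‖ ^ 2)⁻¹) * fderiv ℝ v y y
    - k * (confRate (k + 2) m (Real.log ‖y‖) + confRate (k + 2) m (Real.log ‖y‖) ^ 2 / 2) *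
      (‖y‖ ^ 2)⁻¹ * v y))

/-- Hyperplanes through the origin are stable. -/
theorem integral_hyperplaneDensity_le (hk : 2 ≤ k) (hm : 0 < m) {R : ℝ}
    (hR : horizonRadius (k + 2) m ≤ R) {v : Pt (k + 1) → ℝ} (hv : ContDiff ℝ ∞ v)
    (hvR : ∀ y, ‖y‖ = R → v y = 0) :
    ∫ y in annulus (k + 1) (horizonRadius (k + 2) m) R, hyperplaneDensity k m v y ≤
      ∫ θ : Metric.sphere (0 : Pt (k + 1)) 1,
        -((confProfile (k + 2) m (Real.log (horizonRadius (k + 2) m)) * horizonRadius (k + 2) m) ^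
          (k - 1) * (horizonRadius (k + 2) m * (v (horizonRadius (k + 2) m • (θ : Pt (k + 1))) *
            fderiv ℝ v (horizonRadius (k + 2) m • (θ : Pt (k + 1))) θ)))
        ∂(volume : Measure (Pt (k + 1))).toSphere := by
  have hn3 : 3 ≤ k + 2 := by omega
  have hr0 := horizonRadius_pos (k + 2) hm
  have hv1 : ContDiff ℝ ∞ (fderiv ℝ v) := hv.fderiv_right (by simp)
  have hv2 : ContDiff ℝ ∞ (fderiv ℝ (fderiv ℝ v)) := hv1.fderiv_right (by simp)
  have c0 := hv.continuous
  have c1 := hv1.continuous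
  have c2 := hv2.continuous
  have hrad : ∀ θ : Metric.sphere (0 : Pt (k + 1)) 1, _ :=
    fun θ : Metric.sphere (0 : Pt (k + 1)) 1 => integral_radialDensity_le
      (n := k + 2) (by omega) hm hR
      (w := fun r => v (r • (θ : Pt (k + 1))))
      (w₁ := fun r => fderiv ℝ v (r • (θ : Pt (k + 1))) θ)
      (w₂ := fun r => fderiv ℝ (fderiv ℝ v) (r • (θ : Pt (k + 1))) θ θ)
      (fun r => by
        have h1 := ((hasDerivAt_id r).smul_const (θ : Pt (k + 1)))
        rw [one_smul] at h1
        exact ((hv.differentiable (by simp)) _).hasFDerivAt.comp_hasDerivAt r h1)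
      (fun r => by
        have h1 := ((hasDerivAt_id r).smul_const (θ : Pt (k + 1)))
        rw [one_smul] at h1
        have h2 := ((hv1.differentiable (by simp)) (r • (θ : Pt (k + 1)))).hasFDerivAt.comp_hasDerivAt r h1
        exact (h2.clm_apply (hasDerivAt_const r (θ : Pt (k + 1)))).congr_deriv (by simp))
      (by fun_prop)
      (hvR _ (by rw [norm_smul, mem_sphere_zero_iff_norm.1 θ.2, mul_one,
        Real.norm_of_nonneg (hr0.le.trans hR)]))
  have ek : k + 2 - 3 = k - 1 := by omega
  simp only [ek, Nat.add_sub_cancel] at hrad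
  set r₀ := horizonRadius (k + 2) m with hr₀
  set P : ℝ → ℝ := fun r => confProfile (k + 2) m (Real.log r) with hP
  set Z : ℝ → ℝ := fun r => confRate (k + 2) m (Real.log r) with hZ
  have hlog : ContinuousOn Real.log (Set.Icc r₀ R) :=
    Real.continuousOn_log.mono fun r hr => (hr0.trans_le hr.1).ne'
  have cP : ContinuousOn P (Set.Icc r₀ R) := (continuous_confProfile hn3 hm).comp_continuousOn hlog
  have cZ : ContinuousOn Z (Set.Icc r₀ R) := (continuous_confRate hm).comp_continuousOn hlog
  have cinv : ContinuousOn (fun r : ℝ => (r ^ 2)⁻¹) (Set.Icc r₀ R) :=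
    ContinuousOn.inv₀ (by fun_prop) fun r hr => (pow_pos (hr0.trans_le hr.1) 2).ne'
  have cinv1 : ContinuousOn (fun r : ℝ => r⁻¹) (Set.Icc r₀ R) :=
    ContinuousOn.inv₀ (by fun_prop) fun r hr => (hr0.trans_le hr.1).ne'
  have hmaps : Set.MapsTo (fun y : Pt (k + 1) => ‖y‖) (annulus (k + 1) r₀ R) (Set.Icc r₀ R) :=
    fun y hy => hy
  have aP := cP.comp continuous_norm.continuousOn hmaps
  have aZ := cZ.comp continuous_norm.continuousOn hmaps
  have ainv := cinv.comp continuous_norm.continuousOn hmaps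
  have ainv1 := cinv1.comp continuous_norm.continuousOn hmaps
  simp only [Function.comp_def] at aP aZ ainv ainv1
  set c : ℝ → ℝ := fun r => P r ^ (k - 1) * (r ^ 2)⁻¹ with hc
  have cc : ContinuousOn c (Set.Icc r₀ R) := (cP.pow _).mul cinv
  have ac := cc.comp continuous_norm.continuousOn hmaps
  simp only [Function.comp_def] at ac
  have hc0 : ∀ r ∈ Set.Icc r₀ R, 0 ≤ c r := fun r _ => by
    have hPp : 0 < P r := one_pos.trans_le (one_le_confProfile hn3 hm _)
    rw [hc]; positivity
  set Frad : Pt (k + 1) → ℝ := fun y => radialDensity (k + 2) m ‖y‖ (v y) (‖y‖⁻¹ * fderiv ℝ v y y)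
    ((‖y‖ ^ 2)⁻¹ * fderiv ℝ (fderiv ℝ v) y y y) with hFrad
  have aF : ContinuousOn Frad (annulus (k + 1) r₀ R) := by
    simp only [hFrad, radialDensity]
    have e4 : ContinuousOn (fun y : Pt (k + 1) => confRate (k + 2) m (Real.log ‖y‖))
      (annulus (k + 1) r₀ R) := aZ
    have e5 := c0.continuousOn (s := annulus (k + 1) r₀ R)
    have e6 : ContinuousOn (fun y => fderiv ℝ v y y) (annulus (k + 1) r₀ R) :=
      Continuous.continuousOn (by fun_prop)
    have e7 : ContinuousOn (fun y => fderiv ℝ (fderiv ℝ v) y y y) (annulus (k + 1) r₀ R) :=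
      Continuous.continuousOn (by fun_prop)
    exact (aP.pow _).mul (e5.mul (ainv.mul (by fun_prop)))
  -- The spherical part, of nonpositive integral; the rest `Frad` contains only derivatives along
  -- rays and is handled ray by ray.
  set T : Pt (k + 1) → ℝ := fun y => c ‖y‖ * (v y * (‖y‖ ^ 2 *
      ∑ i, fderiv ℝ (fderiv ℝ v) y (EuclideanSpace.single i 1) (EuclideanSpace.single i 1)
      - fderiv ℝ (fderiv ℝ v) y y y - (((k + 1 : ℕ) : ℝ) - 1) * fderiv ℝ v y y)) with hT
  have aT : ContinuousOn T (annulus (k + 1) r₀ R) :=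
    ac.mul (Continuous.continuousOn (by fun_prop))
  have hsplit : ∀ y ∈ annulus (k + 1) r₀ R, hyperplaneDensity k m v y = T y + Frad y := by
    intro y hy
    have hy0 : ‖y‖ ≠ 0 := (hr0.trans_le hy.1).ne'
    simp only [hyperplaneDensity, hT, hFrad, radialDensity, hc, hP, ek]
    push_cast
    field_simp
    ring
  have hpolar := integral_annulus_polar hr0 hR aF
  have hFθ : ∀ θ : Metric.sphere (0 : Pt (k + 1)) 1,
      ∫ r in r₀..R, Frad (r • (θ : Pt (k + 1))) * r ^ k =
      ∫ r in r₀..R, radialDensity (k + 2) m r (v (r • (θ : Pt (k + 1))))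
        (fderiv ℝ v (r • (θ : Pt (k + 1))) θ)
        (fderiv ℝ (fderiv ℝ v) (r • (θ : Pt (k + 1))) θ θ) * r ^ k := by
    intro θ
    refine intervalIntegral.integral_congr fun r hr => ?_
    rw [Set.uIcc_of_le hR] at hr
    have hr' : 0 < r := hr0.trans_le hr.1
    have hnorm : ‖r • (θ : Pt (k + 1))‖ = r := by
      rw [norm_smul, mem_sphere_zero_iff_norm.1 θ.2, mul_one, Real.norm_of_nonneg hr'.le]
    simp only [hFrad, hnorm, map_smul, _root_.smul_apply, smul_eq_mul]
    congr 2
    · field_simp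
    · field_simp
  rw [setIntegral_congr_fun (measurableSet_annulus _ _) hsplit,
    integral_add (aT.integrableOn_compact (isCompact_annulus _ _))
      (aF.integrableOn_compact (isCompact_annulus _ _)), hpolar.2]
  have h1 := integral_spherical_nonpos cc hc0 hv
  have h2 : ∫ θ : Metric.sphere (0 : Pt (k + 1)) 1, (∫ r in r₀..R, Frad (r • (θ : Pt (k + 1))) * r ^ k)
      ∂(volume : Measure (Pt (k + 1))).toSphere ≤ ∫ θ : Metric.sphere (0 : Pt (k + 1)) 1,
        -((P r₀ * r₀) ^ (k - 1) * (r₀ * (v (r₀ • (θ : Pt (k + 1))) *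
            fderiv ℝ v (r₀ • (θ : Pt (k + 1))) θ)))
        ∂(volume : Measure (Pt (k + 1))).toSphere := by
    refine integral_mono hpolar.1 ?_ fun θ => ?_
    · exact Continuous.integrable_of_hasCompactSupport (by fun_prop)
        (HasCompactSupport.of_compactSpace _)
    · simp only [hFθ]
      exact hrad θ
  linarith

end FlatHyperplane

/-! ### From the cone in Schwarzschild space to a Euclidean hyperplane -/

section Transfer

variable {n k : ℕ} {m : ℝ}

/-- The horizon is totally geodesic. -/
lemma horizonSecondForm_eq_zero (hn : 3 ≤ n) (hm : 0 < m) {x v : Pt n}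
    (hx : ‖x‖ = horizonRadius n m) (hv : ⟪x, v⟫ = 0) : horizonSecondForm n m x v = 0 := by
  have hr0 := horizonRadius_pos n hm
  have hx0 : x ≠ 0 := norm_pos_iff.1 (hx ▸ hr0)
  have hφ := confFactor_pos (n := n) hm x
  have hz : logConfCoeff n m x * ‖x‖ ^ 2 = -1 := by
    rw [logConfCoeff_eq_confRate hx0, hx, confRate_log_horizonRadius hn hm]
  have h1 : HasFDerivAt (fun y : Pt n => ‖y‖) (‖x‖⁻¹ • innerSL ℝ x) x := by
    have := hasFDerivAt_comp_norm hx0 (hasDerivAt_id ‖x‖)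
    simpa using this
  have h2 : ∃ c : ℝ, HasFDerivAt (fun y => (confFactor n m y * ‖y‖)⁻¹) (c • innerSL ℝ x) x := by
    have h3 := (hasFDerivAt_confFactor hn hm hx0).mul h1
    have h4 := (hasDerivAt_inv (mul_ne_zero hφ.ne' (norm_ne_zero_iff.2 hx0))).comp_hasFDerivAt x h3
    rw [smul_smul, smul_smul, ← add_smul, smul_smul] at h4
    exact ⟨_, h4⟩
  obtain ⟨c, hc⟩ := h2
  set ψ := (confFactor n m x * ‖x‖)⁻¹ with hψ
  have hη : HasFDerivAt (radialUnit n m) _ x := hc.smul (hasFDerivAt_id x)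
  have hpart : ∀ j, ∑ i, partialD i (fun y => radialUnit n m y j) x * v i = ψ * v j := by
    intro j
    have h5 : fderiv ℝ (fun y => radialUnit n m y j) x v = ψ * v j := by
      rw [fderiv_coord hη.differentiableAt, hη.fderiv]
      simp [hv, hψ]
    rw [← h5, fderiv_apply_eq_sum]
    exact Finset.sum_congr rfl fun i _ => mul_comm _ _
  have hxv : ∑ i, x i * v i = 0 := by
    rw [← hv, PiLp.inner_apply]; simp [mul_comm]
  -- For tangential v the Euclidean derivative of η contributes ψ v and the Christoffel terms
  -- contribute ψ z v; these cancel because z = -1.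
  have hcov : (covDeriv (schwarzschild n m) (radialUnit n m) x).mulVec v = 0 := by
    funext j
    have h6 : ∀ i, covDeriv (schwarzschild n m) (radialUnit n m) x j i * v i =
        partialD i (fun y => radialUnit n m y j) x * v i
        + ψ * (logConfCoeff n m x * ‖x‖ ^ 2) * (kron i j * v i) := by
      intro i
      rw [covDeriv_schwarzschild hn hm hx0]
      simp only [radialUnit, PiLp.smul_apply, smul_eq_mul, inner_smul_right,
        real_inner_self_eq_norm_sq, ← hψ]
      ring
    have h7 : ∑ i, kron i j * v i = v j := by
      simp [kron]
    change ∑ i, covDeriv (schwarzschild n m) (radialUnit n m) x j i * v i = 0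
    simp only [h6, Finset.sum_add_distrib, ← Finset.mul_sum, h7, hpart, hz]
    ring
  rw [horizonSecondForm, hcov]
  simp [metricInner]

/-- A linear isometry onto a hyperplane. -/
lemma exists_isometry_hyperplane {a : Pt (k + 2)} (ha : ‖a‖ = 1) :
    ∃ ι : Pt (k + 1) →ₗᵢ[ℝ] Pt (k + 2), ∀ x, (∃ y, ι y = x) ↔ ⟪a, x⟫ = 0 := by
  set s : Submodule ℝ (Pt (k + 2)) := Submodule.span ℝ {a} with hs
  have ha0 : a ≠ 0 := fun h => by simp [h] at ha
  have hfin : Module.finrank ℝ sᗮ = k + 1 := by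
    have h1 := s.finrank_add_finrank_orthogonal
    rw [hs, finrank_span_singleton ha0] at h1
    simp at h1
    rw [hs]
    omega
  set e : Pt (k + 1) ≃ₗᵢ[ℝ] sᗮ :=
    ((stdOrthonormalBasis ℝ sᗮ).reindex (finCongr hfin)).repr.symm
  refine ⟨sᗮ.subtypeₗᵢ.comp e.toLinearIsometry, fun x => ?_⟩
  rw [← Submodule.mem_orthogonal_singleton_iff_inner_right (𝕜 := ℝ), ← hs]
  constructor
  · rintro ⟨y, rfl⟩
    exact (e y).2
  · intro hx
    exact ⟨e.symm ⟨x, hx⟩, by simp⟩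

lemma setIntegral_image_isometry {X Y : Type*} [MetricSpace X] [MeasurableSpace X] [BorelSpace X]
    [CompleteSpace X] [MetricSpace Y] [MeasurableSpace Y] [BorelSpace Y] {ι : X → Y}
    (hι : Isometry ι) (d : ℕ) (A : Set X) (f : Y → ℝ) :
    ∫ x in ι '' A, f x ∂μHE[d] = ∫ y in A, f (ι y) ∂μHE[d] := by
  have hemb : MeasurableEmbedding ι := hι.isClosedEmbedding.measurableEmbedding
  have h1 := hemb.setIntegral_map (μ := μHE[d]) f (ι '' A)
  rw [Set.preimage_image_eq _ hι.injective, hι.map_euclideanHausdorffMeasure,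
    Measure.restrict_restrict_of_subset (Set.image_subset_range _ _)] at h1
  exact h1

/-- The boundary integral of Q is taken with Hausdorff measure, the radial estimate with the surface
measure of the unit sphere; this is where the two are identified. -/
lemma setIntegral_sphere {r : ℝ} (hr : 0 < r) (f : Pt (k + 1) → ℝ) :
    ∫ y in {y : Pt (k + 1) | ‖y‖ = r}, f y ∂μHE[k] =
      ∫ θ : Metric.sphere (0 : Pt (k + 1)) 1, r ^ k * f (r • (θ : Pt (k + 1)))
        ∂(volume : Measure (Pt (k + 1))).toSphere := by
  have hemb : MeasurableEmbedding fun x : Pt (k + 1) => r • x :=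
    (Homeomorph.smulOfNeZero r hr.ne').measurableEmbedding
  have hpre : (fun x : Pt (k + 1) => r • x) ⁻¹' {y | ‖y‖ = r} =
      ((↑) : Metric.sphere (0 : Pt (k + 1)) 1 → Pt (k + 1)) '' Set.univ := by
    rw [Set.image_univ, Subtype.range_coe]
    ext x
    rw [Set.mem_preimage, Set.mem_ofPred_eq, norm_smul, Real.norm_of_nonneg hr.le,
      mem_sphere_zero_iff_norm, mul_eq_left₀ hr.ne']
  conv_lhs => rw [map_smul_euclideanHausdorffMeasure k hr]
  rw [Measure.restrict_smul, integral_smul_measure, hemb.setIntegral_map, hpre,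
    setIntegral_image_isometry isometry_subtype_coe, setIntegral_univ,
    euclideanHausdorffMeasure_sphere, ENNReal.toReal_ofReal (by positivity), smul_eq_mul,
    integral_const_mul]

/-- Traces of a bilinear form over a hyperplane. -/
lemma sum_bilin_isometry (ι : Pt (k + 1) →ₗᵢ[ℝ] Pt (k + 2)) {a : Pt (k + 2)} (ha : ‖a‖ = 1)
    (hι : ∀ x, (∃ y, ι y = x) ↔ ⟪a, x⟫ = 0) (B : Pt (k + 2) →L[ℝ] Pt (k + 2) →L[ℝ] ℝ) :
    ∑ i, B (EuclideanSpace.single i 1 - a i • a) (EuclideanSpace.single i 1 - a i • a) =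
      ∑ j, B (ι (EuclideanSpace.single j 1)) (ι (EuclideanSpace.single j 1)) := by
  set f : Fin (k + 1) → Pt (k + 2) := fun j => ι (EuclideanSpace.single j 1) with hf
  have hfo : ∀ j l, ⟪f j, f l⟫ = if j = l then 1 else 0 := by
    intro j l
    rw [hf]
    simp only [ι.inner_map_map, EuclideanSpace.inner_single_left]
    simp
  have hP : ∀ i, EuclideanSpace.single i 1 - a i • a = ∑ j, f j i • f j := by
    intro i
    have h1 : ⟪a, EuclideanSpace.single i 1 - a i • a⟫ = 0 := by
      rw [inner_sub_right, inner_smul_right, real_inner_self_eq_norm_sq, ha,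
        EuclideanSpace.inner_single_right]
      simp
    obtain ⟨y, hy⟩ := (hι _).2 h1
    have h2 : ∀ j, y j = f j i := by
      intro j
      have h3 : ⟪f j, ι y⟫ = y j := by
        rw [hf]
        simp [ι.inner_map_map, EuclideanSpace.inner_single_left]
      have h4 : ⟪a, f j⟫ = 0 := (hι _).1 ⟨_, rfl⟩
      rw [← h3, hy, inner_sub_right, inner_smul_right, real_inner_comm a, h4,
        EuclideanSpace.inner_single_right]
      simp
    rw [← hy, ← sum_smul_single y, map_sum]
    refine Finset.sum_congr rfl fun j _ => ?_
    rw [map_smul, h2]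
  have hsum : ∀ j l, ∑ i, f j i * f l i = if j = l then 1 else 0 := by
    intro j l
    rw [← hfo, PiLp.inner_apply]
    simp [mul_comm]
  have hterm : ∀ i, B (EuclideanSpace.single i 1 - a i • a) (EuclideanSpace.single i 1 - a i • a) =
      ∑ j, ∑ l, f j i * f l i * B (f j) (f l) := by
    intro i
    rw [hP i]
    simp only [map_sum, map_smul, _root_.sum_apply, _root_.smul_apply, smul_eq_mul, Finset.mul_sum]
    rw [Finset.sum_comm]
    exact Finset.sum_congr rfl fun j _ => Finset.sum_congr rfl fun l _ => by ring
  simp only [hterm]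
  rw [Finset.sum_comm]
  refine Finset.sum_congr rfl fun j _ => ?_
  rw [Finset.sum_comm]
  simp only [← Finset.sum_mul, hsum, ite_mul, one_mul, zero_mul, Finset.sum_ite_eq,
    Finset.mem_univ, if_true]
  rfl

end Transfer

/-! ### Vanishing index in the totally geodesic case, infinite index otherwise -/

namespace IsClosedOrientedHypersurface

section Stability

variable {k : ℕ} {m : ℝ} {Γ : Set (Pt (k + 2))} {ν : Pt (k + 2) → Pt (k + 2)}

lemma fderiv_coneField_eq_zero {n : ℕ} {Γ : Set (Pt n)} {ν : Pt n → Pt n}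
    (hΓ : IsClosedOrientedHypersurface Γ ν) (hTG : IsTotallyGeodesicInSphere Γ ν) {x v : Pt n}
    (hx : x ∈ coneOver Γ) (hv : ⟪coneField ν x, v⟫ = 0) : fderiv ℝ (coneField ν) x v = 0 := by
  rw [hΓ.fderiv_coneField (hΓ.ne_zero_of_mem_cone hx),
    hΓ.fderiv_normal_eq_zero hTG (hΓ.direction_mem hx) (hΓ.sub_smul_direction_mem hx hv), smul_zero]

/-- For a constant normal a, the second fundamental form vanishes and the tangential Laplacian is
the trace of the Hessian over the hyperplane, hence the Laplacian in the coordinates given by ι. The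
Ricci term becomes explicit in z by the Riccati identity. -/
lemma jacobiOp_mul_eq (hΓ : IsClosedOrientedHypersurface Γ ν)
    (hTG : IsTotallyGeodesicInSphere Γ ν) (hk : 2 ≤ k) (hm : 0 < m) {a : Pt (k + 2)}
    (ha : ‖a‖ = 1) (haΓ : ∀ p ∈ Γ, ν p = a) {ι : Pt (k + 1) →ₗᵢ[ℝ] Pt (k + 2)}
    (hι : ∀ x, (∃ y, ι y = x) ↔ ⟪a, x⟫ = 0) {u : Pt (k + 2) → ℝ} (hu : ContDiff ℝ ∞ u)
    {y : Pt (k + 1)} (hy : ι y ∈ coneOver Γ) :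
    u (ι y) * jacobiOp (schwarzschild (k + 2) m) (coneNormal (k + 2) m ν) u (ι y) *
      confFactor (k + 2) m (ι y) ^ (k + 1) = hyperplaneDensity k m (fun y => u (ι y)) y := by
  have hn3 : 3 ≤ k + 2 := by omega
  have hx0 := hΓ.ne_zero_of_mem_cone hy
  have hφ := confFactor_pos (n := k + 2) hm (ι y)
  have hN : coneField ν (ι y) = a := haΓ _ (hΓ.direction_mem hy)
  have hproj := hΓ.inner_coneField_proj hy
  have htang : ∀ i j, tangD (coneField ν) i (fun y => coneField ν y j) (ι y) = 0 := fun i j => by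
    rw [hΓ.tangD_coneField_apply hx0, hΓ.fderiv_coneField_eq_zero hTG hy (hproj i)]
    rfl
  have hsq : coneNormSq ν (ι y) = 0 := by simp [coneNormSq, htang]
  have hu1 : ContDiff ℝ ∞ (fderiv ℝ u) := hu.fderiv_right (by simp)
  have hlap : ∑ i, tangD (coneField ν) i (tangD (coneField ν) i u) (ι y) =
      ∑ j, fderiv ℝ (fderiv ℝ u) (ι y) (ι (EuclideanSpace.single j 1))
        (ι (EuclideanSpace.single j 1)) := by
    rw [← sum_bilin_isometry ι ha hι]
    refine Finset.sum_congr rfl fun i _ => ?_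
    rw [tangD_tangD (fun x hx => hΓ.contDiffAt_coneField hx) (fun x _ => hu.contDiffAt) hx0, htang,
      hΓ.fderiv_coneField_eq_zero hTG hy (hproj i), map_zero, hN]
    ring
  have hd1 : ∀ z w, fderiv ℝ (fun y => u (ι y)) z w = fderiv ℝ u (ι z) (ι w) := fun z w => by
    have h1 : HasFDerivAt (fun y => u (ι y)) _ z :=
      ((hu.differentiable (by simp)) (ι z)).hasFDerivAt.comp z ι.toContinuousLinearMap.hasFDerivAt
    rw [h1.fderiv]
    rfl
  have hd2 : ∀ w, fderiv ℝ (fderiv ℝ (fun y => u (ι y))) y w w =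
      fderiv ℝ (fderiv ℝ u) (ι y) (ι w) (ι w) := fun w => by
    have hv : ContDiff ℝ ∞ (fderiv ℝ (fun y => u (ι y))) := by
      have : ContDiff ℝ ∞ (fun y => u (ι y)) := hu.comp ι.toContinuousLinearMap.contDiff
      exact this.fderiv_right (by simp)
    have h1 := ((hv.differentiable (by simp)) y).hasFDerivAt.clm_apply (hasFDerivAt_const w y)
    have h2 : HasFDerivAt (fun z => fderiv ℝ u (ι z) (ι w)) _ y :=
      ((((hu1.differentiable (by simp)) (ι y)).hasFDerivAt.comp y
        ι.toContinuousLinearMap.hasFDerivAt)).clm_apply (hasFDerivAt_const (ι w) y)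
    simp only [hd1] at h1
    have h3 := congrArg (fun L : Pt (k + 1) →L[ℝ] ℝ => L w) (h1.unique h2)
    simpa using h3
  rw [hΓ.jacobiOp_cone hn3 hm hy (fun x _ => hu.contDiffAt), hsq, hlap,
    ricci_confNormal hn3 hm hx0 (hΓ.inner_coneField hy) (hΓ.norm_coneField hy), hyperplaneDensity]
  simp only [hd1, hd2]
  have hy0 : ‖y‖ ≠ 0 := by
    rw [← ι.norm_map]; exact norm_ne_zero_iff.2 hx0
  have hid := logConfCoeff_identity hn3 hm hx0
  have hZ := logConfCoeff_eq_confRate (m := m) hx0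
  have hP := confFactor_eq_confProfile (m := m) hx0
  rw [ι.norm_map] at hid hZ hP
  rw [← hP, ← hZ, ι.norm_map]
  obtain ⟨l, rfl⟩ : ∃ l, k = l + 1 := ⟨k - 1, by omega⟩
  rw [Nat.add_sub_cancel]
  generalize logConfCoeff (l + 1 + 2) m (ι y) = A at *
  generalize logConfCoeff' (l + 1 + 2) m (ι y) = B at *
  generalize confFactor (l + 1 + 2) m (ι y) = φ at *
  generalize ∑ j, fderiv ℝ (fderiv ℝ u) (ι y) (ι (EuclideanSpace.single j 1))
        (ι (EuclideanSpace.single j 1)) = S at *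
  generalize fderiv ℝ u (ι y) (ι y) = D at *
  generalize u (ι y) = U at *
  generalize ‖y‖ = r at *
  -- The Riccati identity solved for b, so that only z = a|x|² is left in the Ricci term.
  have hB : B = (-2 * ((l + 1 + 2 : ℕ) : ℝ) * (A * r ^ 2) + (2 - ((l + 1 + 2 : ℕ) : ℝ)) *
      (A * r ^ 2) ^ 2) / (2 * r ^ 4) := by
    rw [eq_div_iff (mul_ne_zero two_ne_zero (pow_ne_zero 4 hy0))]
    linear_combination hid
  rw [hB]
  push_cast
  field_simp
  ring

/-- Cones over totally geodesic links are stable. -/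
theorem indexForm_nonneg (hΓ : IsClosedOrientedHypersurface Γ ν)
    (hTG : IsTotallyGeodesicInSphere Γ ν) (hk : 2 ≤ k) (hm : 0 < m) {R : ℝ}
    (hR : horizonRadius (k + 2) m ≤ R) {u : Pt (k + 2) → ℝ} (hu : ContDiff ℝ ∞ u)
    (huR : ∀ x ∈ truncatedCone (k + 2) m Γ ∩ {x | ‖x‖ = R}, u x = 0) :
    0 ≤ indexForm (k + 2) m (truncatedCone (k + 2) m Γ) (coneNormal (k + 2) m ν) R u := by
  have hn3 : 3 ≤ k + 2 := by omega
  have hr0 := horizonRadius_pos (k + 2) hm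
  obtain ⟨a, ha, haΓ, hΓa⟩ := hΓ.eq_great_sphere hn3 hTG
  obtain ⟨ι, hι⟩ := exists_isometry_hyperplane ha
  have hcone : ∀ y : Pt (k + 1), y ≠ 0 → ι y ∈ coneOver Γ := by
    intro y hy
    have hy0 := norm_pos_iff.2 hy
    refine ⟨‖y‖, hy0, ‖y‖⁻¹ • ι y, (hΓa _).2 ⟨?_, ?_⟩, ?_⟩
    · rw [norm_smul, ι.norm_map, norm_inv, norm_norm, inv_mul_cancel₀ hy0.ne']
    · rw [inner_smul_right, (hι (ι y)).1 ⟨y, rfl⟩, mul_zero]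
    · rw [smul_smul, mul_inv_cancel₀ hy0.ne', one_smul]
  have hrange : ∀ x ∈ coneOver Γ, ∃ y, ι y = x := by
    rintro _ ⟨c, -, p, hp, rfl⟩
    rw [hι, inner_smul_right, ((hΓa p).1 hp).2, mul_zero]
  have hset : ∀ s : Set ℝ, (∀ r ∈ s, horizonRadius (k + 2) m ≤ r) →
      coneOver Γ ∩ {x | ‖x‖ ∈ s} = ι '' {y | ‖y‖ ∈ s} := by
    intro s hs
    ext x
    constructor
    · rintro ⟨hx, hxs⟩
      obtain ⟨y, rfl⟩ := hrange x hx
      rw [Set.mem_ofPred_eq, ι.norm_map] at hxs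
      exact ⟨y, hxs, rfl⟩
    · rintro ⟨y, hy, rfl⟩
      refine ⟨hcone y (norm_pos_iff.1 (hr0.trans_le (hs _ hy))), ?_⟩
      rwa [Set.mem_ofPred_eq, ι.norm_map]
  have hset1 : truncatedCone (k + 2) m Γ ∩ {x | ‖x‖ ≤ R} =
      ι '' annulus (k + 1) (horizonRadius (k + 2) m) R := by
    rw [truncatedCone_inter_eq]
    exact hset (Set.Icc (horizonRadius (k + 2) m) R) fun r hr => hr.1
  have hset2 : ∀ r, horizonRadius (k + 2) m ≤ r → truncatedCone (k + 2) m Γ ∩ {x | ‖x‖ = r} =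
      ι '' {y | ‖y‖ = r} := by
    intro r hr
    have h := hset {r} (by rintro _ rfl; exact hr)
    simp only [Set.mem_singleton_iff] at h
    rw [← h]
    ext x
    simp only [truncatedCone, Set.mem_inter_iff, Set.mem_ofPred_eq]
    constructor
    · rintro ⟨⟨h1, -⟩, h2⟩; exact ⟨h1, h2⟩
    · rintro ⟨h1, h2⟩; exact ⟨⟨h1, h2 ▸ hr⟩, h2⟩
  have hv : ContDiff ℝ ∞ (fun y => u (ι y)) := hu.comp ι.toContinuousLinearMap.contDiff
  have hvR : ∀ y, ‖y‖ = R → u (ι y) = 0 := fun y hy =>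
    huR _ (by rw [hset2 R hR]; exact ⟨y, hy, rfl⟩)
  have hflat := integral_hyperplaneDensity_le hk hm hR hv hvR
  set r₀ := horizonRadius (k + 2) m with hr₀
  rw [indexForm, hset1, hset2 _ le_rfl]
  change 0 ≤ -(∫ x in ι '' annulus (k + 1) r₀ R, u x * jacobiOp (schwarzschild (k + 2) m)
    (coneNormal (k + 2) m ν) u x * confFactor (k + 2) m x ^ (k + 1) ∂μHE[k + 1])
    + ∫ x in ι '' {y | ‖y‖ = r₀}, u x * (fderiv ℝ u x (-radialUnit (k + 2) m x) -
      horizonSecondForm (k + 2) m x (coneNormal (k + 2) m ν x) * u x) *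
      confFactor (k + 2) m x ^ k ∂μHE[k]
  rw [setIntegral_image_isometry ι.isometry, setIntegral_image_isometry ι.isometry,
    setIntegral_sphere hr0, EuclideanSpace.euclideanHausdorffMeasure_eq_volume,
    setIntegral_congr_fun (measurableSet_annulus _ _) fun y hy =>
      hΓ.jacobiOp_mul_eq hTG hk hm ha haΓ hι hu
        (hcone y (norm_pos_iff.1 (hr0.trans_le hy.1)))]
  -- The second fundamental form of the horizon drops out, and ν = -η gives the radial derivative
  -- divided by -φ. The result is exactly the upper bound found for the interior integral, so the
  -- two contributions to Q add up to something nonnegative.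
  have hbdry : ∀ θ : Metric.sphere (0 : Pt (k + 1)) 1, r₀ ^ k *
      (u (ι (r₀ • (θ : Pt (k + 1)))) *
        (fderiv ℝ u (ι (r₀ • (θ : Pt (k + 1)))) (-radialUnit (k + 2) m (ι (r₀ • (θ : Pt (k + 1))))) -
        horizonSecondForm (k + 2) m (ι (r₀ • (θ : Pt (k + 1))))
          (coneNormal (k + 2) m ν (ι (r₀ • (θ : Pt (k + 1))))) * u (ι (r₀ • (θ : Pt (k + 1))))) *
        confFactor (k + 2) m (ι (r₀ • (θ : Pt (k + 1)))) ^ k) =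
      -((confProfile (k + 2) m (Real.log r₀) * r₀) ^ (k - 1) *
        (r₀ * (u (ι (r₀ • (θ : Pt (k + 1)))) *
          fderiv ℝ (fun y => u (ι y)) (r₀ • (θ : Pt (k + 1))) θ))) := by
    intro θ
    have hnorm : ‖ι (r₀ • (θ : Pt (k + 1)))‖ = r₀ := by
      rw [ι.norm_map, norm_smul, mem_sphere_zero_iff_norm.1 θ.2, mul_one,
        Real.norm_of_nonneg hr0.le]
    have hx0 : ι (r₀ • (θ : Pt (k + 1))) ≠ 0 := by
      rw [← norm_pos_iff, hnorm]; exact hr0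
    have hx : ι (r₀ • (θ : Pt (k + 1))) ∈ coneOver Γ :=
      hcone _ fun h => hx0 (by rw [h, map_zero])
    have hφ := confFactor_pos (n := k + 2) hm (ι (r₀ • (θ : Pt (k + 1))))
    have hP := confFactor_eq_confProfile (m := m) hx0
    rw [hnorm] at hP
    have hsec : horizonSecondForm (k + 2) m (ι (r₀ • (θ : Pt (k + 1))))
        (coneNormal (k + 2) m ν (ι (r₀ • (θ : Pt (k + 1))))) = 0 := by
      refine horizonSecondForm_eq_zero hn3 hm hnorm ?_
      have := hΓ.inner_coneField hx
      rw [coneNormal, inner_smul_right]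
      exact mul_eq_zero_of_right _ this
    have hd : fderiv ℝ (fun y => u (ι y)) (r₀ • (θ : Pt (k + 1))) θ =
        fderiv ℝ u (ι (r₀ • (θ : Pt (k + 1)))) (ι θ) := by
      have h1 : HasFDerivAt (fun y => u (ι y)) _ (r₀ • (θ : Pt (k + 1))) :=
        ((hu.differentiable (by simp)) (ι (r₀ • (θ : Pt (k + 1))))).hasFDerivAt.comp _
          ι.toContinuousLinearMap.hasFDerivAt
      rw [h1.fderiv]
      rfl
    rw [hsec, hd, ← hP, radialUnit, hnorm]
    set φ := confFactor (k + 2) m (ι (r₀ • (θ : Pt (k + 1))))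
    have h2 : ∀ L : Pt (k + 2) →L[ℝ] ℝ, L (-((φ * r₀)⁻¹ • ι (r₀ • (θ : Pt (k + 1))))) =
        -(φ⁻¹ * L (ι θ)) := fun L => by
      rw [map_neg, map_smul, map_smul ι r₀, map_smul, smul_eq_mul, smul_eq_mul]
      field_simp
    rw [h2]
    obtain ⟨l, rfl⟩ : ∃ l, k = l + 1 := ⟨k - 1, by omega⟩
    rw [Nat.add_sub_cancel]
    field_simp
    ring
  simp only [hbdry]
  linarith

end Stability

variable {n : ℕ} {m : ℝ} {Γ : Set (Pt n)} {ν : Pt n → Pt n}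

lemma indF_eq_zero (hΓ : IsClosedOrientedHypersurface Γ ν)
    (hTG : IsTotallyGeodesicInSphere Γ ν) (hn : 4 ≤ n) (hm : 0 < m) {R : ℝ}
    (hR : horizonRadius n m ≤ R) :
    indF n m (truncatedCone n m Γ) (coneNormal n m ν) R = 0 := by
  obtain ⟨k, rfl⟩ : ∃ k, n = k + 2 := ⟨n - 2, by omega⟩
  rw [indF, negIndex, ← nonpos_iff_eq_zero]
  refine iSup₂_le fun V hV => ?_
  have hV0 : V = ⊥ := by
    rw [Submodule.eq_bot_iff]
    intro u hu
    by_contra hne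
    exact (hV.2 u hu hne).not_ge
      (hΓ.indexForm_nonneg hTG (by omega) hm hR (hV.1 u hu).1 (hV.1 u hu).2)
  rw [hV0, rank_bot, map_zero]

/-- The Morse index of cones over totally geodesic links. -/
theorem morseIndex_eq_zero (hΓ : IsClosedOrientedHypersurface Γ ν)
    (hTG : IsTotallyGeodesicInSphere Γ ν) (hn : 4 ≤ n) (hm : 0 < m) :
    morseIndex n m (truncatedCone n m Γ) (coneNormal n m ν) = 0 := by
  rw [morseIndex, limsup_congr (v := fun _ => 0), limsup_const]
  filter_upwards [eventually_ge_atTop (horizonRadius n m)] with R hR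
  exact hΓ.indF_eq_zero hTG hn hm hR

/-- Vanishing on the whole boundary is the stronger condition, so every space admitted for the
Dirichlet index is admitted for the free boundary index. -/
lemma indD_le_indF (n : ℕ) (m : ℝ) (S : Set (Pt n)) (ξ : Pt n → Pt n) (R : ℝ) :
    indD n m S ξ R ≤ indF n m S ξ R := by
  refine iSup₂_le fun V hV => ?_
  exact le_iSup₂_of_le (f := fun (V : Submodule ℝ (Pt n → ℝ)) _ => Cardinal.toENat (Module.rank ℝ V))
    V ⟨fun u hu => ⟨(hV.1 u hu).1, fun x hx => (hV.1 u hu).2 x ⟨hx.1, Or.inl hx.2⟩⟩, hV.2⟩ le_rfl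

/-- The Morse index of the other cones. -/
theorem morseIndex_eq_top (hΓ : IsClosedOrientedHypersurface Γ ν)
    (hmin : IsMinimalInSphere Γ ν) (hn : 4 ≤ n) (hn7 : n ≤ 7) (hm : 0 < m)
    (h : ¬ IsTotallyGeodesicInSphere Γ ν) :
    morseIndex n m (truncatedCone n m Γ) (coneNormal n m ν) = ⊤ := by
  refine ENat.eq_top_iff_forall_ge.2 fun k => ?_
  refine le_limsup_of_frequently_le (Eventually.frequently ?_)
  filter_upwards [hΓ.eventually_le_indD hmin hn hn7 hm h k] with R hR
  exact hR.trans (indD_le_indF _ _ _ _ _)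

end IsClosedOrientedHypersurface

end

/-! ### The main theorem -/

theorem mainTheorem2 (n : ℕ) (hn4 : 4 ≤ n) (hn7 : n ≤ 7) (m : ℝ) (hm : 0 < m)
    (Γ : Set (Pt n)) (ν : Pt n → Pt n)
    (hΓ : IsClosedOrientedHypersurface Γ ν) (hmin : IsMinimalInSphere Γ ν) :
    (morseIndex n m (truncatedCone n m Γ) (coneNormal n m ν) < ⊤ ↔
      IsTotallyGeodesicInSphere Γ ν) ∧
    (IsTotallyGeodesicInSphere Γ ν ↔
      ∃ T : Pt n ≃ₗᵢ[ℝ] Pt n, LinearMap.det (T.toLinearEquiv : Pt n →ₗ[ℝ] Pt n) = 1 ∧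
        T '' truncatedCone n m Γ = truncatedHyperplane n m) ∧
    (IsTotallyGeodesicInSphere Γ ν →
      morseIndex n m (truncatedCone n m Γ) (coneNormal n m ν) = 0) ∧
    (¬ IsTotallyGeodesicInSphere Γ ν → ∀ k : ℕ, ∀ᶠ R : ℝ in atTop,
      (k : ℕ∞) ≤ indD n m (truncatedCone n m Γ) (coneNormal n m ν) R) := by
  have htop : ¬ IsTotallyGeodesicInSphere Γ ν →
      morseIndex n m (truncatedCone n m Γ) (coneNormal n m ν) = ⊤ :=
    hΓ.morseIndex_eq_top hmin hn4 hn7 hm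
  have hzero : IsTotallyGeodesicInSphere Γ ν →
      morseIndex n m (truncatedCone n m Γ) (coneNormal n m ν) = 0 :=
    fun h => hΓ.morseIndex_eq_zero h hn4 hm
  refine ⟨⟨fun h => ?_, fun h => ?_⟩, ?_, hzero, fun h k => hΓ.eventually_le_indD hmin hn4 hn7 hm h k⟩
  · by_contra hne
    exact h.ne (htop hne)
  · rw [hzero h]
    exact ENat.top_pos
  · exact totallyGeodesic_iff_exists_rotation (by omega) hm hΓ
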